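/- \textbf{Setting.} Let $n,L,J\ge 1$, $M=2^J$, $1\le K_a\le K$, $P>0$, and let $\mathcal K_a\subset\mathcal K=[K]$ be a set of $K_a$ active users. The receiver has $L$ antennas. User $k$ has a codebook $\mathbf x_{k,1},\dots,\mathbf x_{k,M}\in\mathbb C^n$ with $\|\mathbf x_{k,m}\|_2^2\le nP$. The messages $W_k$, $k\in\mathcal K_a$, are independent and uniform on $[M]$, and antenna $l$ receives $\mathbf y_l=\sum_{k\in\mathcal K_a}h_{k,l}\mathbf x_{k,W_k}+\mathbf z_l$, where $\mathbf H=(h_{k,l})\in\mathbb C^{K\times L}$ and the noise $\mathbf Z=[\mathbf z_1,\dots,\mathbf z_L]$ have i.i.d. $\mathcal{CN}(0,1)$ entries, and $\mathbf H$, $\mathbf Z$ and the messages are independent. The receiver knows $\mathbf H$ and $K_a$, but not $\mathcal K_a$. The per-user probability of error (PUPE) is $P_e=\frac1{K_a}\sum_{k\in\mathcal K_a}\mathbb P[W_k\neq\hat W_k]$. \textbf{Scheme.} Let $0<P'<P$ and let $\mathbf A\in\mathbb C^{n\times MK}$, with columns $\mathbf c_{k,m}$, have i.i.d. $\mathcal{CN}(0,P')$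 entries, independent of the rest. User $k$ uses the codewords $\mathbf x_{k,m}=\mathbf c_{k,m}1\{\|\mathbf c_{k,m}\|_2^2\le nP\}$. The decoder is a (measurable) maximum-likelihood decoder: it minimizes $\sum_{l=1}^L\|\mathbf y_l-\sum_{k\in\hat{\mathcal K}_a}h_{k,l}\mathbf c_{k,\hat W_k}\|_2^2$ over all $\hat{\mathcal K}_a\subset\mathcal K$ with $|\hat{\mathcal K}_a|=K_a$ and all $\hat W_k\in[M]$, $k\in\hat{\mathcal K}_a$, breaking ties arbitrarily; a user $k\notin\hat{\mathcal K}_a$ is declared inactive. \textbf{Bound.} Let $\gamma(a,x)=\int_0^x y^{a-1}e^{-y}\,dy$ for $x>0$ and $\gamma(a,x)=0$ for $x\le0$, and write $Q(a,x)=\gamma(a,x)/\Gamma(a)$. For $1\le t\le K_a$ let $S_1$ be any $t$-subset of $\mathcal K_a$ and, for $0\le t_0\le t$ with $t-t_0\le K-K_a$, let $S_2$ be the union of any $t_0$-subset of $S_1$ and any $(t-t_0)$-subset of $\mathcal K\setminus\mathcal K_a$ (the terms with $t-t_0>K-K_a$ below are $0$). Fix messages $w_k\neq w'_k$ in $[M]$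 for every $k$. Let $\tilde{\mathbf A}_{S_1}\in\mathbb C^{n\times K}$ have $k$-th column $\mathbf c_{k,w_k}$ if $k\in S_1$ and $\mathbf 0$ otherwise, let $\tilde{\mathbf A}'_{S_2}\in\mathbb C^{n\times K}$ have $k$-th column $\mathbf c_{k,w'_k}$ if $k\in S_2$ and $\mathbf 0$ otherwise, and let $\mathbf H_1,\mathbf H_2\in\mathbb C^{t\times L}$ be formed by the rows of $\mathbf H$ in $S_1$, $S_2$. Minima stand for infima in $[0,\infty]$, and expectations of nonnegative functions may be $+\infty$. Put $$B(P')=p_0+\sum_{t=1}^{K_a}\frac t{K_a}\min\{1,p_{1,t},p_{2,t}\},\qquad p_0=K_a\Big(1-Q\big(n,\tfrac{nP}{P'}\big)\Big),$$ $$p_{1,t}=\min_{0\le\omega\le1,\ \nu\ge0}\{q_{1,t}(\omega,\nu)+q_{2,t}(\omega,\nu)\},$$ $$q_{1,t}(\omega,\nu)=\sum_{t_0=0}^tC_{t_0,t}\,\mathbb E\Big[\min_{u\ge0,\ r\ge0,\ u\ne r\omega,\ \lambda_{\min}(\tilde{\mathbf B})>-1}\exp\big\{-L\big(n\ln(1+r(1-\omega))+\ln|\mathbf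 I_K+\tilde{\mathbf B}|-rn\nu\big)\big\}\Big],$$ $$C_{t_0,t}=\binom{K_a}t\binom t{t_0}\binom{K-K_a}{t-t_0}(M-1)^{t_0}M^{t-t_0},$$ $$\tilde{\mathbf B}=\tfrac{(1+r-u)(u-r\omega)}{1+r(1-\omega)}\big(\tilde{\mathbf A}_{S_1}-\tfrac u{u-r\omega}\tilde{\mathbf A}'_{S_2}\big)^H\big(\tilde{\mathbf A}_{S_1}-\tfrac u{u-r\omega}\tilde{\mathbf A}'_{S_2}\big)-\tfrac{r\omega u}{u-r\omega}(\tilde{\mathbf A}'_{S_2})^H\tilde{\mathbf A}'_{S_2}.$$ For $\omega\in(0,1]$ and $t<n$, $$q_{2,t}(\omega,\nu)=\min_{\eta,\delta\ge0}\binom{K_a}t\Big\{\mathbb E\Big[Q\Big(tL,\,L\big(t(1+\eta)-n\nu+n(1+\delta)(1-\omega)\big)\big|\mathbf I_n+\omega\tilde{\mathbf A}_{S_1}\tilde{\mathbf A}_{S_1}^H\big|^{-1/t}\Big)\Big]+2-Q(tL,tL(1+\eta))-Q(nL,nL(1+\delta))\Big\};$$ for $\omega\in(0,1]$ and $t\ge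 n$, $$q_{2,t}(\omega,\nu)=\min_{\eta\ge0}\binom{K_a}t\,\mathbb E\Big[Q\Big(nL,\frac{nL(1+\eta-\nu)}{\omega|\mathbf I_n+\tilde{\mathbf A}_{S_1}\tilde{\mathbf A}_{S_1}^H|^{1/n}}\Big)\Big]+1-Q(nL,nL(1+\eta));$$ and $q_{2,t}(0,\nu)=1-Q(nL,nL\nu)$. Finally, with no upper limit on $\beta$ when $\rho=0$, $$p_{2,t}=\min_{0\le\rho\le1,\ 0\le\beta<1/\rho}\ \sum_{t_0=0}^t\binom{K_a}t\binom t{t_0}\binom{K-K_a}{t-t_0}M^{\rho t}\,\mathbb E\Big[\exp\Big\{(1-\rho)n\ln\big|\mathbf I_L+\beta P'\mathbf H_2^H\mathbf H_2\big|-n\ln\big|\mathbf I_L+\beta(1-\rho\beta)P'(\rho\mathbf H_1^H\mathbf H_1+\mathbf H_2^H\mathbf H_2)\big|\Big\}\Big].$$ \textbf{Theorem.} A measurable maximum-likelihood decoder exists, and for every such decoder: (i) for every $P'\in(0,P)$ the PUPE of the scheme, averaged over $\mathbf A$, is at most $B(P')$; (ii) for every $P'\in(0,P)$ there is a fixed $\mathbf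 A$ whose codewords $\mathbf x_{k,m}$ satisfy $\|\mathbf x_{k,m}\|_2^2\le nP$ and give, with this decoder, a PUPE of at most $B(P')$; (iii) consequently the infimum over $\mathbf A$ of the PUPE is at most $\inf_{0<P'<P}B(P')$. -/

import Mathlib

open MeasureTheory ProbabilityTheory
open scoped ENNReal NNReal Matrix

noncomputable section

namespace MassiveAccess

/-! ### Gaussian laws and the lower incomplete gamma function -/

/-- The circularly symmetric complex Gaussian law `CN(0, v)`: the real and imaginary parts are
independent real centred Gaussians of variance `v / 2` each. -/
def cGaussian (v : ℝ≥0) : Measure ℂ :=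
  ((gaussianReal 0 (v / 2)).prod (gaussianReal 0 (v / 2))).map
    (fun p : ℝ × ℝ => (⟨p.1, p.2⟩ : ℂ))

/-- The law of an array with i.i.d. `CN(0, v)` entries. -/
def cGaussianArray (ι κ : Type*) [Fintype ι] [Fintype κ] (v : ℝ≥0) : Measure (ι → κ → ℂ) :=
  Measure.pi fun _ => Measure.pi fun _ => cGaussian v

/-- The lower incomplete gamma function `γ(a, x) = ∫₀ˣ y ^ (a - 1) e ^ (-y) dy`,
equal to `0` for `x ≤ 0`. -/
def lowerGamma (a x : ℝ) : ℝ :=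
  ∫ y in Set.Ioc 0 x, y ^ (a - 1) * Real.exp (-y)

/-- The ratio `γ(a, x) / Γ(a)`. -/
def gammaRatio (a x : ℝ) : ℝ := lowerGamma a x / Real.Gamma a

/-! ### Codes, channel and decoder

`n` is the blocklength, `K` the number of users, `L` the number of receive antennas and `M` the
number of messages of each user. -/

/-- The concatenation of the codebooks of the `K` users, an `n × MK` array: the column `(k, m)` is
the `m`-th codeword of user `k`. -/
abbrev Codebook (n K M : ℕ) := Fin n → Fin K × Fin M → ℂ

/-- An output of the decoder: `none` for a user that is declared inactive, and `some m` for a user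
that is declared active with the message `m`. -/
abbrev Estimate (K M : ℕ) := Fin K → Option (Fin M)

/-- The number of users that an estimate declares active. -/
def numDetected {K M : ℕ} (e : Estimate K M) : ℕ :=
  (Finset.univ.filter fun k => (e k).isSome = true).card

/-- Every codeword has energy at most `n P`. -/
def PowerConstraint {n K M : ℕ} (P : ℝ) (X : Codebook n K M) : Prop :=
  ∀ (k : Fin K) (m : Fin M), ∑ i, ‖X i (k, m)‖ ^ 2 ≤ n * P

open Classical in
/-- The transmitted codebook `x = c · 1{‖c‖² ≤ n P}`: the codewords of `A` that violate the power
constraint are replaced by the zero word. -/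
def truncateCodebook {n K M : ℕ} (P : ℝ) (A : Codebook n K M) : Codebook n K M :=
  fun i km => if ∑ j, ‖A j km‖ ^ 2 ≤ n * P then A i km else 0

/-- The received signal `Y`, with `Y i l = ∑_{k active} h_{k,l} x_{k, W_k, i} + z_{i,l}`. -/
def received {n K L M : ℕ} (active : Finset (Fin K)) (X : Codebook n K M) (W : Fin K → Fin M)
    (H : Fin K → Fin L → ℂ) (Z : Fin n → Fin L → ℂ) : Fin n → Fin L → ℂ :=
  fun i l => ∑ k ∈ active, H k l * X i (k, W k) + Z i l

/-- The decoding metric `∑_l ‖y_l - ∑_k h_{k,l} ĉ_(k)‖²`. It is, up to an additive constant, the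
negative of the log-likelihood of `Y` given the codewords and the fading coefficients. -/
def metric {n K L M : ℕ} (A : Codebook n K M) (Y : Fin n → Fin L → ℂ) (H : Fin K → Fin L → ℂ)
    (e : Estimate K M) : ℝ :=
  ∑ l, ∑ i, ‖Y i l - ∑ k, (e k).elim 0 (fun m => H k l * A i (k, m))‖ ^ 2

/-- A maximum-likelihood decoder with channel state information and known number `Ka` of active
users: a measurable function of the codebook, the received signal and the fading coefficients, which
minimizes the metric over all sets of `Ka` users and all choices of their messages
(ties are broken arbitrarily). -/
structure IsMLDecoder {n K L M : ℕ} (Ka : ℕ)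
    (dec : Codebook n K M → (Fin n → Fin L → ℂ) → (Fin K → Fin L → ℂ) → Estimate K M) :
    Prop where
  measurable : ∀ e : Estimate K M, MeasurableSet
    {p : Codebook n K M × (Fin n → Fin L → ℂ) × (Fin K → Fin L → ℂ) | dec p.1 p.2.1 p.2.2 = e}
  numDetected_eq : ∀ A Y H, numDetected (dec A Y H) = Ka
  metric_le : ∀ A Y H (e : Estimate K M), numDetected e = Ka →
    metric A Y H (dec A Y H) ≤ metric A Y H e

/-- The joint law of the messages (uniform and independent), of the fading coefficients
(i.i.d. `CN(0,1)`) and of the noise (i.i.d. `CN(0,1)`), which are independent. The messages of the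
inactive users are not used. -/
def channelLaw (n K L M : ℕ) :
    Measure ((Fin K → Fin M) × (Fin K → Fin L → ℂ) × (Fin n → Fin L → ℂ)) :=
  (uniformOn Set.univ).prod
    ((cGaussianArray (Fin K) (Fin L) 1).prod (cGaussianArray (Fin n) (Fin L) 1))

/-- The per-user probability of error `(1 / K_a) ∑_{k active} ℙ[W_k ≠ Ŵ_k]` of the transmitted
codebook `X` with the decoder `dec`, a function of the received signal and of the fading. -/
def pupe {n K L M : ℕ} (active : Finset (Fin K)) (X : Codebook n K M)
    (dec : (Fin n → Fin L → ℂ) → (Fin K → Fin L → ℂ) → Estimate K M) : ℝ≥0∞ :=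
  (∑ k ∈ active, channelLaw n K L M
    {ω | dec (received active X ω.1 ω.2.1 ω.2.2) ω.2.1 k ≠ some (ω.1 k)}) / active.card

/-- The law of a codebook with i.i.d. `CN(0, P')` entries. -/
def codebookLaw (n K M : ℕ) (P' : ℝ) : Measure (Codebook n K M) :=
  cGaussianArray (Fin n) (Fin K × Fin M) P'.toNNReal

/-- The per-user probability of error of random coding: a codebook `A` with i.i.d. `CN(0, P')`
entries is drawn, its truncation is transmitted, and the decoder is used with `A`. -/
def randomCodingPUPE {n K L M : ℕ} (active : Finset (Fin K)) (P P' : ℝ)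
    (dec : Codebook n K M → (Fin n → Fin L → ℂ) → (Fin K → Fin L → ℂ) → Estimate K M) : ℝ≥0∞ :=
  ∫⁻ A, pupe active (truncateCodebook P A) (dec A) ∂(codebookLaw n K M P')

/-! ### The bound

Expectations are integrals of nonnegative functions with values in `[0, ∞]`, and minima are infima
in `[0, ∞]`. -/

/-- The binary selection matrix of the users in `S` with the messages `w`. -/
def selection {K M : ℕ} (S : Finset (Fin K)) (w : Fin K → Fin M) :
    Matrix (Fin K × Fin M) (Fin K) ℂ :=
  Matrix.of fun km k => if km.1 = k ∧ k ∈ S ∧ km.2 = w k then 1 else 0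

/-- The `n × K` matrix `Ã = A Φ` of the selected codewords. -/
def selected {n K M : ℕ} (A : Codebook n K M) (S : Finset (Fin K)) (w : Fin K → Fin M) :
    Matrix (Fin n) (Fin K) ℂ :=
  Matrix.of A * selection S w

/-- The term `p₀`. -/
def p0 (n Ka : ℕ) (P P' : ℝ) : ℝ≥0∞ :=
  ENNReal.ofReal (Ka * (1 - gammaRatio n (n * P / P')))

/-- The matrix `B̃`, for `u ≠ r ω`. -/
def matB {n K : ℕ} (ω u r : ℝ) (A₁ A₂ : Matrix (Fin n) (Fin K) ℂ) : Matrix (Fin K) (Fin K) ℂ :=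
  ((1 + r - u) * (u - r * ω) / (1 + r * (1 - ω))) •
      ((A₁ - (u / (u - r * ω)) • A₂)ᴴ * (A₁ - (u / (u - r * ω)) • A₂))
    - (r * ω * u / (u - r * ω)) • (A₂ᴴ * A₂)

/-- The Chernoff minimum over `u ≥ 0` and `r ≥ 0` such that `B̃` is defined, that is `u ≠ r ω`, and
has its smallest eigenvalue above `-1`. -/
def chernoffMin {n K : ℕ} (L : ℕ) (ω ν : ℝ) (A₁ A₂ : Matrix (Fin n) (Fin K) ℂ) : ℝ≥0∞ :=
  ⨅ (u : ℝ) (r : ℝ) (_ : 0 ≤ u ∧ 0 ≤ r ∧ u ≠ r * ω ∧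
      ∀ x ∈ spectrum ℝ (matB ω u r A₁ A₂), -1 < x),
    ENNReal.ofReal (Real.exp (-(L : ℝ) *
      (n * Real.log (1 + r * (1 - ω)) + Real.log ((1 + matB ω u r A₁ A₂).det.re) - r * n * ν)))

/-- The coefficient `C_{t₀,t}`: the number of choices of the sets `S₁`, `S₂` of `t` users with
`|S₁ ∩ S₂| = t₀` and of the false alarm codewords of the users in `S₂`. -/
def countC (K Ka M t₀ t : ℕ) : ℕ :=
  Ka.choose t * t.choose t₀ * (K - Ka).choose (t - t₀) * (M - 1) ^ t₀ * M ^ (t - t₀)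

/-- The term `q_{1,t}(ω, ν)`; `S₁` is a `t`-set of active users, and `S₂ t₀` is the set of users
with false alarm codewords when `t₀` of them are in `S₁`. -/
def q1 {K M : ℕ} (n L Ka : ℕ) (P' : ℝ) (S₁ : Finset (Fin K)) (S₂ : ℕ → Finset (Fin K))
    (w w' : Fin K → Fin M) (t : ℕ) (ω ν : ℝ) : ℝ≥0∞ :=
  ∑ t₀ ∈ Finset.range (t + 1), (countC K Ka M t₀ t : ℝ≥0∞) *
    ∫⁻ A, chernoffMin L ω ν (selected A S₁ w) (selected A (S₂ t₀) w') ∂(codebookLaw n K M P')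

/-- The term `q_{2,t}(ω, ν)`. -/
def q2 {K M : ℕ} (n L Ka : ℕ) (P' : ℝ) (S₁ : Finset (Fin K)) (w : Fin K → Fin M)
    (t : ℕ) (ω ν : ℝ) : ℝ≥0∞ :=
  if ω = 0 then ENNReal.ofReal (1 - gammaRatio (n * L) (n * L * ν))
  else if t < n then
    ⨅ (η : ℝ) (δ : ℝ) (_ : 0 ≤ η ∧ 0 ≤ δ),
      (Ka.choose t : ℝ≥0∞) * (∫⁻ A, ENNReal.ofReal (gammaRatio (t * L)
          (L * ((t * (1 + η) - n * ν + n * (1 + δ) * (1 - ω)) *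
            ((1 + ω • (selected A S₁ w * (selected A S₁ w)ᴴ)).det.re) ^ (-(1 / (t : ℝ))))))
        ∂(codebookLaw n K M P'))
      + (Ka.choose t : ℝ≥0∞) * ENNReal.ofReal
          (2 - gammaRatio (t * L) (t * L * (1 + η)) - gammaRatio (n * L) (n * L * (1 + δ)))
  else
    ⨅ (η : ℝ) (_ : 0 ≤ η),
      (Ka.choose t : ℝ≥0∞) * (∫⁻ A, ENNReal.ofReal (gammaRatio (n * L)
          (n * L * (1 + η - ν) /
            (ω * ((1 + selected A S₁ w * (selected A S₁ w)ᴴ).det.re) ^ (1 / (n : ℝ)))))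
        ∂(codebookLaw n K M P'))
      + ENNReal.ofReal (1 - gammaRatio (n * L) (n * L * (1 + η)))

/-- The "good region" bound `p_{1,t}`. -/
def p1 {K M : ℕ} (n L Ka : ℕ) (P' : ℝ) (S₁ : Finset (Fin K)) (S₂ : ℕ → Finset (Fin K))
    (w w' : Fin K → Fin M) (t : ℕ) : ℝ≥0∞ :=
  ⨅ (ω : ℝ) (ν : ℝ) (_ : 0 ≤ ω ∧ ω ≤ 1 ∧ 0 ≤ ν),
    q1 n L Ka P' S₁ S₂ w w' t ω ν + q2 n L Ka P' S₁ w t ω ν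

/-- The submatrix of `H` formed by the rows in `S`. -/
def rows {K L : ℕ} (H : Fin K → Fin L → ℂ) (S : Finset (Fin K)) : Matrix S (Fin L) ℂ :=
  Matrix.of fun k l => H k l

/-- The bound `p_{2,t}` from Gallager's `ρ`-trick; `β < 1 / ρ` is written as `ρ β < 1`, so that
there is no upper limit on `β` for `ρ = 0`. -/
def p2 {K : ℕ} (n L Ka M : ℕ) (P' : ℝ) (S₁ : Finset (Fin K)) (S₂ : ℕ → Finset (Fin K))
    (t : ℕ) : ℝ≥0∞ :=
  ⨅ (ρ : ℝ) (β : ℝ) (_ : 0 ≤ ρ ∧ ρ ≤ 1 ∧ 0 ≤ β ∧ ρ * β < 1),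
    ∑ t₀ ∈ Finset.range (t + 1),
      ((Ka.choose t * t.choose t₀ * (K - Ka).choose (t - t₀) : ℕ) : ℝ≥0∞) *
        ENNReal.ofReal ((M : ℝ) ^ (ρ * t)) *
        ∫⁻ H, ENNReal.ofReal (Real.exp (
            (1 - ρ) * n * Real.log ((1 + (β * P') • ((rows H (S₂ t₀))ᴴ * rows H (S₂ t₀))).det.re)
            - n * Real.log ((1 + (β * (1 - ρ * β) * P') •
                (ρ • ((rows H S₁)ᴴ * rows H S₁) + (rows H (S₂ t₀))ᴴ * rows H (S₂ t₀))).det.re)))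
          ∂(cGaussianArray (Fin K) (Fin L) 1)

/-- The whole bound `p₀ + ∑_t (t / K_a) min {1, p_{1,t}, p_{2,t}}`. -/
def pupeBound {K M : ℕ} (n L Ka : ℕ) (P P' : ℝ) (S₁ : ℕ → Finset (Fin K))
    (S₂ : ℕ → ℕ → Finset (Fin K)) (w w' : Fin K → Fin M) : ℝ≥0∞ :=
  p0 n Ka P P' + ∑ t ∈ Finset.Icc 1 Ka, (t : ℝ≥0∞) / (Ka : ℝ≥0∞) *
    min 1 (min (p1 n L Ka P' (S₁ t) (S₂ t) w w' t) (p2 n L Ka M P' (S₁ t) (S₂ t) t))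

/-- `S₁` and `S₂` are admissible: for `1 ≤ t ≤ K_a`, the set `S₁ t` consists of `t` active users,
and for every `t₀ ≤ t` with `t - t₀ ≤ K - K_a` the set `S₂ t t₀` is the union of a set of `t₀`
users of `S₁ t` and of a set of `t - t₀` inactive users. -/
def AdmissibleSets {K : ℕ} (active : Finset (Fin K)) (S₁ : ℕ → Finset (Fin K))
    (S₂ : ℕ → ℕ → Finset (Fin K)) : Prop :=
  ∀ t, 1 ≤ t → t ≤ active.card →
    (S₁ t ⊆ active ∧ (S₁ t).card = t) ∧
    ∀ t₀ ≤ t, t - t₀ ≤ K - active.card →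
      ∃ S₂₁ S₂₂ : Finset (Fin K), S₂ t t₀ = S₂₁ ∪ S₂₂ ∧
        S₂₁ ⊆ S₁ t ∧ S₂₁.card = t₀ ∧ Disjoint S₂₂ active ∧ S₂₂.card = t - t₀

end MassiveAccess

end

open MassiveAccess

noncomputable section

namespace MassiveAccess

open scoped ComplexOrder MatrixOrder

/-! ### Products of integrals and of densities -/

/-! Fix the messages `W`. If every transmitted codeword meets the power constraint, truncation does
not change the received signal, so it may be dropped at the price of a union bound over the active
users, which is `p0`. For the untruncated code, the sum over the active users of the error
probabilities is the expected number of misdecoded users, `∑ t · ℙ[exactly t errors]`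
(`sum_measure_decodeEvent`), and it remains to bound each of these probabilities by `p1` and by
`p2`.

The decoder's output is compared with the truth, which is itself a candidate (`exists_confusion`).
Let `S₁` be the set of misdecoded active users and `S₂` the set of users declared active with a
wrong message or while inactive. Both have `t` elements, because the decoder declares exactly `K_a`
users, and the contributions of the correctly decoded users cancel. Hence `‖Z + (A₁ - A₂) H‖² ≤
‖Z‖²`, where `A₁` and `A₂` hold the sent and the false codewords. The event of `t` errors is covered
by such confusion events, and their probabilities are bounded in two ways.

Good region (`p1`). Each confusion event is intersected with `‖Z‖² ≤ ω ‖Z + A₁ H‖² + nLν`. Inside,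
given the codebook, Markov's inequality is applied to the exponential of both inequalities with
multipliers `u` and `r`. The antennas are i.i.d., and for one antenna two successive Gaussian
integrals, over the noise and then over the fading, give the determinant of `1 + matB`
(`lintegral_chernoff_column`, `goodRegion_le_chernoffMin`). Outside, a singular value decomposition
makes the rows independent with unequal variances, so that the critical event is that a Gaussian
vector lies in an ellipsoid; among ellipsoids of equal volume the ball is the most likely
(`stdC_ellipsoid_le`), whence the incomplete gamma functions at a power of a determinant. When `t <
n` the difference of energies is first rewritten as a difference of two squared norms of prescribed
variances (`exists_energy_difference`, `badRegion_le`).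

Gallager's bound (`p2`). Given the fading, the noise and the sent codewords, the false codewords are
fresh Gaussian vectors. A Chernoff bound with parameter `β` for each of them, the union bound raised
to the power `ρ`, and the integration over the sent codewords and the noise give the `n`-th power of
a Gaussian integral for one channel use (`gallager_union_le`, `lintegral_gallager_row`).

Relabelling users and messages preserves the i.i.d. laws, so every expectation depends only on `t`
and `t₀` and may be computed for the representative sets and messages (`lintegral_selected_eq`,
`lintegral_rows_eq`). The bound is uniform in `W`, hence survives the average over the messages; and
some codebook does no worse than the average one. -/

theorem lintegral_fin_prod {n : ℕ} {E : Type*} [MeasurableSpace E]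
    (μ : Fin n → Measure E) [∀ i, SigmaFinite (μ i)] {f : Fin n → E → ℝ≥0∞}
    (hf : ∀ i, Measurable (f i)) :
    ∫⁻ x, ∏ i, f i (x i) ∂(Measure.pi μ) = ∏ i, ∫⁻ x, f i x ∂(μ i) := by
  induction n with
  | zero => simp
  | succ n ih =>
    have hm : Measurable fun x : Fin n → E => ∏ i : Fin n, f i.succ (x i) :=
      Finset.measurable_prod _ fun i _ => (hf _).comp (measurable_pi_apply i)
    have h := (measurePreserving_piFinSuccAbove μ 0).lintegral_comp_emb
      (MeasurableEquiv.measurableEmbedding _) fun y => f 0 y.1 * ∏ i : Fin n, f i.succ (y.2 i)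
    calc _ = _ := by simp_rw [Fin.prod_univ_succ]; exact h
      _ = _ := lintegral_prod_mul (hf 0).aemeasurable hm.aemeasurable
      _ = _ := by
        rw [Fin.prod_univ_succ]
        exact congrArg _ (ih (fun i => μ (Fin.succ i)) fun i => hf (Fin.succ i))

theorem lintegral_fintype_prod {ι : Type*} [Fintype ι] {E : Type*} [MeasurableSpace E]
    (μ : ι → Measure E) [∀ i, SigmaFinite (μ i)] {f : ι → E → ℝ≥0∞}
    (hf : ∀ i, Measurable (f i)) :
    ∫⁻ x, ∏ i, f i (x i) ∂(Measure.pi μ) = ∏ i, ∫⁻ x, f i x ∂(μ i) := by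
  let e := (Fintype.equivFin ι).symm
  rw [← (measurePreserving_piCongrLeft μ e).lintegral_comp_emb
    (MeasurableEquiv.measurableEmbedding _)]
  simp_rw [← e.prod_comp, MeasurableEquiv.coe_piCongrLeft, Equiv.piCongrLeft_apply_apply]
  exact lintegral_fin_prod (fun i => μ (e i)) (f := fun i => f (e i)) fun i => hf _

theorem pi_withDensity {ι : Type*} [Fintype ι] {E : Type*} [MeasurableSpace E]
    (μ : ι → Measure E) [∀ i, SigmaFinite (μ i)] {f : ι → E → ℝ≥0∞} (hf : ∀ i, Measurable (f i))
    [∀ i, SigmaFinite ((μ i).withDensity (f i))] :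
    Measure.pi (fun i => (μ i).withDensity (f i)) =
      (Measure.pi μ).withDensity fun x => ∏ i, f i (x i) := by
  refine Measure.pi_eq fun s hs => ?_
  rw [withDensity_apply _ (MeasurableSet.univ_pi hs), ← lintegral_indicator (MeasurableSet.univ_pi hs)]
  have : ∀ x : ι → E, (Set.univ.pi s).indicator (fun x => ∏ i, f i (x i)) x
      = ∏ i, (s i).indicator (f i) (x i) := by
    intro x
    by_cases hx : x ∈ Set.univ.pi s
    · rw [Set.indicator_of_mem hx]
      exact Finset.prod_congr rfl fun i _ => (Set.indicator_of_mem (hx i trivial) _).symm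
    · rw [Set.indicator_of_notMem hx]
      simp only [Set.mem_pi, Set.mem_univ, true_implies, not_forall] at hx
      obtain ⟨i, hi⟩ := hx
      exact (Finset.prod_eq_zero (Finset.mem_univ i) (Set.indicator_of_notMem hi _)).symm
  simp_rw [this]
  rw [lintegral_fintype_prod μ fun i => (hf i).indicator (hs i)]
  exact Finset.prod_congr rfl fun i _ => by
    rw [lintegral_indicator (hs i), withDensity_apply _ (hs i)]

/-! ### The standard complex Gaussian vector -/

theorem measurable_complex_mk : Measurable (fun p : ℝ × ℝ => (⟨p.1, p.2⟩ : ℂ)) :=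
  Complex.measurableEquivRealProd.symm.measurable

instance isProbabilityMeasure_cGaussian (v : ℝ≥0) : IsProbabilityMeasure (cGaussian v) :=
  Measure.isProbabilityMeasure_map measurable_complex_mk.aemeasurable

theorem cGaussian_one_eq : cGaussian 1 =
    volume.withDensity fun z : ℂ => ENNReal.ofReal (Real.pi⁻¹ * Real.exp (-‖z‖ ^ 2)) := by
  have h2 : (1 / 2 : ℝ≥0) ≠ 0 := by norm_num
  unfold cGaussian
  rw [gaussianReal_of_var_ne_zero 0 h2, prod_withDensity (measurable_gaussianPDF _ _)
    (measurable_gaussianPDF _ _), ← Measure.volume_eq_prod]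
  have hmp := Complex.volume_preserving_equiv_real_prod.symm
  ext s hs
  rw [Measure.map_apply measurable_complex_mk hs,
    withDensity_apply _ (measurable_complex_mk hs), withDensity_apply _ hs,
    ← hmp.setLIntegral_comp_preimage_emb (MeasurableEquiv.measurableEmbedding _)]
  refine lintegral_congr fun p => ?_
  rw [gaussianPDF, gaussianPDF, ← ENNReal.ofReal_mul (gaussianPDFReal_nonneg _ _ _)]
  congr 1
  simp only [gaussianPDFReal]
  have : ‖Complex.measurableEquivRealProd.symm p‖ ^ 2 = p.1 ^ 2 + p.2 ^ 2 := by
    rw [← Complex.normSq_eq_norm_sq, Complex.normSq_apply]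
    simp [Complex.measurableEquivRealProd_symm_apply]; ring
  rw [this]
  have h3 : ((1 / 2 : ℝ≥0) : ℝ) = 1 / 2 := by norm_num
  rw [h3]
  have h4 : 2 * Real.pi * (1 / 2) = Real.pi := by ring
  rw [h4, show (√Real.pi)⁻¹ * Real.exp (-(p.1 - 0) ^ 2 / (2 * (1 / 2)))
    * ((√Real.pi)⁻¹ * Real.exp (-(p.2 - 0) ^ 2 / (2 * (1 / 2)))) =
    (√Real.pi * √Real.pi)⁻¹ * (Real.exp (-(p.1 - 0) ^ 2 / (2 * (1 / 2))) *
      Real.exp (-(p.2 - 0) ^ 2 / (2 * (1 / 2)))) by rw [mul_inv]; ring,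
    Real.mul_self_sqrt Real.pi_pos.le, ← Real.exp_add]
  congr 2; ring

/-- Scaling reduces every variance, including the degenerate `v = 0`, to variance one, for which
there is a density. -/
theorem cGaussian_eq_map (v : ℝ≥0) :
    cGaussian v = (cGaussian 1).map fun z => ((√(v : ℝ) : ℝ) : ℂ) * z := by
  unfold cGaussian
  rw [Measure.map_map (by fun_prop) measurable_complex_mk]
  have h : gaussianReal 0 (v / 2) = (gaussianReal 0 (1 / 2)).map (√(v : ℝ) * ·) := by
    rw [gaussianReal_map_const_mul]
    congr 1
    · simp
    · ext; simp [Real.sq_sqrt]; ring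
  rw [h, Measure.map_prod_map _ _ (by fun_prop) (by fun_prop),
    Measure.map_map measurable_complex_mk (by fun_prop)]
  congr 1
  ext p
  simp [Prod.map, Complex.ext_iff]

/-- The law of a vector of independent `CN(0, 1)` variables. -/
abbrev stdC (ι : Type*) [Fintype ι] : Measure (ι → ℂ) := Measure.pi fun _ => cGaussian 1

theorem stdC_eq (ι : Type*) [Fintype ι] : stdC ι = volume.withDensity fun z : ι → ℂ =>
    ENNReal.ofReal ((Real.pi ^ Fintype.card ι)⁻¹ * Real.exp (-∑ i, ‖z i‖ ^ 2)) := by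
  have hm : Measurable fun z : ℂ => ENNReal.ofReal (Real.pi⁻¹ * Real.exp (-‖z‖ ^ 2)) := by
    fun_prop
  have hs : SigmaFinite (volume.withDensity fun z : ℂ =>
      ENNReal.ofReal (Real.pi⁻¹ * Real.exp (-‖z‖ ^ 2))) := by
    rw [← cGaussian_one_eq]; infer_instance
  unfold stdC
  simp_rw [cGaussian_one_eq]
  rw [pi_withDensity (fun _ => volume) fun _ => hm, ← volume_pi]
  congr 1
  ext z
  rw [← ENNReal.ofReal_prod_of_nonneg fun i _ => by positivity, Finset.prod_mul_distrib,
    ← Real.exp_sum]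
  simp

theorem lintegral_stdC {ι : Type*} [Fintype ι] {f : (ι → ℂ) → ℝ≥0∞} (hf : Measurable f) :
    ∫⁻ z, f z ∂(stdC ι) = ∫⁻ z, ENNReal.ofReal ((Real.pi ^ Fintype.card ι)⁻¹ *
      Real.exp (-∑ i, ‖z i‖ ^ 2)) * f z := by
  rw [stdC_eq, lintegral_withDensity_eq_lintegral_mul _ (by fun_prop) hf]
  rfl

/-- Nothing has to be integrated: `stdC ι` has total mass one, so the integral is the inverse of its
normalizing constant. -/
theorem lintegral_exp_neg_norm_sq (ι : Type*) [Fintype ι] :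
    ∫⁻ z : ι → ℂ, ENNReal.ofReal (Real.exp (-∑ i, ‖z i‖ ^ 2)) =
      ENNReal.ofReal (Real.pi ^ Fintype.card ι) := by
  have h := lintegral_stdC (ι := ι) (f := fun _ => 1) measurable_const
  have hp : 0 < Real.pi ^ Fintype.card ι := by positivity
  simp only [lintegral_const, measure_univ, mul_one,
    ENNReal.ofReal_mul (inv_nonneg.2 hp.le)] at h
  rw [lintegral_const_mul _ (by fun_prop), ENNReal.ofReal_inv_of_pos hp] at h
  rw [eq_comm, mul_comm, ← div_eq_mul_inv, ENNReal.div_eq_one_iff (by simpa using hp)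
    ENNReal.ofReal_ne_top] at h
  exact h

/-- The Jacobian of a complex linear map, regarded as a real one, is the squared modulus of its
complex determinant. -/
theorem lintegral_comp_mulVec {ι : Type*} [Fintype ι] [DecidableEq ι] {N : Matrix ι ι ℂ}
    (hN : N.det ≠ 0) {f : (ι → ℂ) → ℝ≥0∞} (hf : Measurable f) :
    ∫⁻ z, f (N *ᵥ z) = ENNReal.ofReal ((‖N.det‖ ^ 2)⁻¹) * ∫⁻ z, f z := by
  let g : (ι → ℂ) →ₗ[ℝ] (ι → ℂ) := (Matrix.toLin' N).restrictScalars ℝ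
  have hdet : LinearMap.det g = ‖N.det‖ ^ 2 := by
    rw [LinearMap.det_restrictScalars, LinearMap.det_toLin', Algebra.norm_complex_apply,
      Complex.normSq_eq_norm_sq]
  have hg : LinearMap.det g ≠ 0 := by rw [hdet]; simpa using hN
  have hm := Measure.map_linearMap_addHaar_eq_smul_addHaar (volume : Measure (ι → ℂ)) hg
  have hgm : Measurable g := by
    have : Continuous g := LinearMap.continuous_of_finiteDimensional g
    exact this.measurable
  calc ∫⁻ z, f (N *ᵥ z) = ∫⁻ z, f z ∂(volume.map g) := by
        rw [lintegral_map hf hgm]; rfl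
    _ = _ := by
        rw [hm, lintegral_smul_measure, hdet, abs_of_nonneg (by positivity), smul_eq_mul]

/-- The real quadratic form `z ↦ zᴴ M z` of a Hermitian matrix. -/
def quadForm {ι : Type*} [Fintype ι] (M : Matrix ι ι ℂ) (z : ι → ℂ) : ℝ :=
  (star z ⬝ᵥ (M *ᵥ z)).re

@[fun_prop]
theorem measurable_quadForm {ι : Type*} [Fintype ι] (M : Matrix ι ι ℂ) :
    Measurable (quadForm M) := by
  unfold quadForm dotProduct Matrix.mulVec dotProduct
  simp only [Pi.star_apply]
  fun_prop

theorem quadForm_one {ι : Type*} [Fintype ι] [DecidableEq ι] (z : ι → ℂ) :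
    quadForm (1 : Matrix ι ι ℂ) z = ∑ i, ‖z i‖ ^ 2 := by
  simp [quadForm, dotProduct, ← Complex.normSq_eq_norm_sq, Complex.normSq_apply]

theorem quadForm_conjTranspose_mul_mul {ι κ : Type*} [Fintype ι] [Fintype κ]
    (M : Matrix κ κ ℂ) (V : Matrix κ ι ℂ) (z : ι → ℂ) :
    quadForm (Vᴴ * M * V) z = quadForm M (V *ᵥ z) := by
  unfold quadForm
  rw [← Matrix.mulVec_mulVec, ← Matrix.mulVec_mulVec, Matrix.dotProduct_mulVec,
    Matrix.vecMul_conjTranspose, star_star]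

theorem quadForm_conjTranspose_mul_self {ι κ : Type*} [Fintype ι] [Fintype κ]
    (V : Matrix κ ι ℂ) (z : ι → ℂ) :
    quadForm (Vᴴ * V) z = ∑ i, ‖(V *ᵥ z) i‖ ^ 2 := by
  classical
  rw [← quadForm_one, ← quadForm_conjTranspose_mul_mul, Matrix.mul_one]

theorem quadForm_add {ι : Type*} [Fintype ι] (M N : Matrix ι ι ℂ) (z : ι → ℂ) :
    quadForm (M + N) z = quadForm M z + quadForm N z := by
  simp [quadForm, Matrix.add_mulVec, dotProduct_add]

theorem quadForm_sub {ι : Type*} [Fintype ι] (M N : Matrix ι ι ℂ) (z : ι → ℂ) :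
    quadForm (M - N) z = quadForm M z - quadForm N z := by
  simp [quadForm, Matrix.sub_mulVec, dotProduct_sub]

theorem quadForm_smul {ι : Type*} [Fintype ι] (c : ℝ) (M : Matrix ι ι ℂ) (z : ι → ℂ) :
    quadForm (c • M) z = c * quadForm M z := by
  simp [quadForm, Matrix.smul_mulVec, dotProduct_smul]

theorem _root_.Matrix.PosDef.det_re_pos {ι : Type*} [Fintype ι] [DecidableEq ι]
    {M : Matrix ι ι ℂ} (hM : M.PosDef) : 0 < M.det.re ∧ ((M.det.re : ℝ) : ℂ) = M.det := by
  have h := hM.det_pos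
  rw [Complex.lt_def] at h
  exact ⟨by simpa using h.1, Complex.ext rfl (by simpa using h.2)⟩

/-- Writing `M = Nᴴ N` turns the form into `‖N z‖²`, and the Jacobian of `z ↦ N z` is `|det N|² =
det M`. -/
theorem lintegral_exp_neg_quadForm {ι : Type*} [Fintype ι] [DecidableEq ι] {M : Matrix ι ι ℂ}
    (hM : M.PosDef) : ∫⁻ z, ENNReal.ofReal (Real.exp (-quadForm M z)) =
      ENNReal.ofReal (Real.pi ^ Fintype.card ι / M.det.re) := by
  obtain ⟨N, hN⟩ := CStarAlgebra.nonneg_iff_eq_star_mul_self.mp hM.posSemidef.nonneg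
  rw [Matrix.star_eq_conjTranspose] at hN
  have hd : ‖N.det‖ ^ 2 = M.det.re := by
    rw [hN, Matrix.det_mul, Matrix.det_conjTranspose, ← Complex.normSq_eq_norm_sq,
      ← Complex.ofReal_re (Complex.normSq _), Complex.normSq_eq_conj_mul_self]
    rfl
  have hpos := hM.det_re_pos.1
  have h0 : N.det ≠ 0 := by
    intro h; rw [h] at hd; simp at hd; linarith
  have hf : Measurable fun z : ι → ℂ => ENNReal.ofReal (Real.exp (-∑ i, ‖z i‖ ^ 2)) := by
    fun_prop
  rw [hN]
  simp_rw [quadForm_conjTranspose_mul_self]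
  rw [lintegral_comp_mulVec h0 hf, lintegral_exp_neg_norm_sq, ← ENNReal.ofReal_mul (by positivity),
    ← hN, hd, div_eq_inv_mul]

theorem quadForm_add_vec {ι : Type*} [Fintype ι] {M : Matrix ι ι ℂ} (hM : M.IsHermitian)
    (x m : ι → ℂ) : quadForm M (x + m) =
      quadForm M x + 2 * (star (M *ᵥ m) ⬝ᵥ x).re + quadForm M m := by
  have h : (star m ⬝ᵥ (M *ᵥ x)) = star (M *ᵥ m) ⬝ᵥ x := by
    rw [Matrix.dotProduct_mulVec, Matrix.star_mulVec, hM.eq]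
  have h' : (star x ⬝ᵥ (M *ᵥ m)).re = (star (M *ᵥ m) ⬝ᵥ x).re := by
    rw [Matrix.star_dotProduct]
    simp
  simp only [quadForm, star_add, Matrix.mulVec_add, add_dotProduct, dotProduct_add, Complex.add_re,
    h, h']
  ring

/-- The Gaussian integral of the exponential of a quadratic function. -/
theorem lintegral_stdC_exp_quadForm {ι : Type*} [Fintype ι] [DecidableEq ι] {M : Matrix ι ι ℂ}
    (hM : (1 + M).PosDef) (b : ι → ℂ) :
    ∫⁻ z, ENNReal.ofReal (Real.exp (-quadForm M z + 2 * (star b ⬝ᵥ z).re)) ∂(stdC ι) =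
      ENNReal.ofReal (Real.exp (quadForm (1 + M)⁻¹ b) / (1 + M).det.re) := by
  have hmeas : Measurable fun z : ι → ℂ => (star b ⬝ᵥ z).re := by
    unfold dotProduct; fun_prop
  have hp : 0 < Real.pi ^ Fintype.card ι := by positivity
  rw [lintegral_stdC (by fun_prop)]
  -- Completing the square: `m` is the maximizer of the total exponent, density included. After the
  -- translation by `m` the linear term disappears and the constant `quadForm (1 + M)⁻¹ b` remains.
  set m := (1 + M)⁻¹ *ᵥ b with hm
  have hmb : (1 + M) *ᵥ m = b := by
    rw [hm, Matrix.mulVec_mulVec, Matrix.mul_nonsing_inv _ ((Matrix.isUnit_iff_isUnit_det _).1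
      hM.isUnit), Matrix.one_mulVec]
  have hqm : quadForm (1 + M) m = quadForm (1 + M)⁻¹ b := by
    have hu := (Matrix.isUnit_iff_isUnit_det _).1 hM.isUnit
    have := quadForm_conjTranspose_mul_mul (1 + M) (1 + M)⁻¹ b
    rw [← hm, hM.inv.isHermitian.eq, Matrix.nonsing_inv_mul _ hu, Matrix.one_mul] at this
    exact this.symm
  have hbm : (star b ⬝ᵥ m).re = quadForm (1 + M)⁻¹ b := by rw [hm]; rfl
  rw [← lintegral_add_right_eq_self _ m]
  have : ∀ z : ι → ℂ, ENNReal.ofReal ((Real.pi ^ Fintype.card ι)⁻¹ *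
      Real.exp (-∑ i, ‖(z + m) i‖ ^ 2)) *
      ENNReal.ofReal (Real.exp (-quadForm M (z + m) + 2 * (star b ⬝ᵥ (z + m)).re)) =
      ENNReal.ofReal ((Real.pi ^ Fintype.card ι)⁻¹ * Real.exp (quadForm (1 + M)⁻¹ b)) *
      ENNReal.ofReal (Real.exp (-quadForm (1 + M) z)) := by
    intro z
    rw [← ENNReal.ofReal_mul (by positivity), ← ENNReal.ofReal_mul (by positivity),
      mul_assoc, mul_assoc, ← Real.exp_add, ← Real.exp_add]
    congr 3
    have h1 := quadForm_add 1 M (z + m)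
    rw [quadForm_one, quadForm_add_vec hM.isHermitian, hmb, hqm] at h1
    rw [dotProduct_add, Complex.add_re, hbm]
    linarith
  simp_rw [this]
  rw [lintegral_const_mul _ (by fun_prop), lintegral_exp_neg_quadForm hM,
    ← ENNReal.ofReal_mul (by positivity)]
  congr 1
  field_simp

theorem lintegral_stdC_exp_neg_quadForm {ι : Type*} [Fintype ι] [DecidableEq ι]
    {M : Matrix ι ι ℂ} (hM : (1 + M).PosDef) :
    ∫⁻ z, ENNReal.ofReal (Real.exp (-quadForm M z)) ∂(stdC ι) =
      ENNReal.ofReal ((1 + M).det.re)⁻¹ := by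
  simpa [quadForm] using lintegral_stdC_exp_quadForm hM 0

/-! ### The law of the energy of a Gaussian vector -/

/-- Polar coordinates in real dimension `2 * card ι`, followed by the substitution `s = r²`. The
constant involves the volume of the unit ball, which is never computed: the choice `g = 1`
determines `C` later. -/
theorem exists_integral_energy (ι : Type*) [Fintype ι] [Nonempty ι] : ∃ C : ℝ, ∀ g : ℝ → ℝ,
    ∫ z, g (∑ i, ‖z i‖ ^ 2) ∂(stdC ι) =
      C * ∫ s in Set.Ioi (0 : ℝ), s ^ ((Fintype.card ι : ℝ) - 1) * Real.exp (-s) * g s := by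
  let E := EuclideanSpace ℂ ι
  let e : (ι → ℂ) ≃L[ℝ] E := (PiLp.continuousLinearEquiv 2 ℝ (fun _ : ι => ℂ)).symm
  let μ : Measure E := volume.map e
  have hμ : μ.IsAddHaarMeasure := e.isAddHaarMeasure_map volume
  have hcard : 0 < Fintype.card ι := Fintype.card_pos
  have hfr : Module.finrank ℝ E = 2 * Fintype.card ι := by
    rw [← e.toLinearEquiv.finrank_eq, Module.finrank_pi_fintype]
    simp [Complex.finrank_real_complex, mul_comm]
  have hnorm : ∀ z : ι → ℂ, ‖e z‖ ^ 2 = ∑ i, ‖z i‖ ^ 2 := fun z => by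
    rw [EuclideanSpace.norm_sq_eq]; rfl
  have : Nontrivial E := Module.nontrivial_of_finrank_pos (R := ℝ) (by omega)
  refine ⟨(Real.pi ^ Fintype.card ι)⁻¹ * ((2 * Fintype.card ι : ℕ) *
    μ.real (Metric.ball 0 1) / 2), fun g => ?_⟩
  have h1 := integral_fun_norm_addHaar μ fun r => Real.exp (-r ^ 2) * g (r ^ 2)
  have h2 : ∫ x, Real.exp (-‖x‖ ^ 2) * g (‖x‖ ^ 2) ∂μ =
      ∫ z : ι → ℂ, Real.exp (-∑ i, ‖z i‖ ^ 2) * g (∑ i, ‖z i‖ ^ 2) := by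
    have := (e.toHomeomorph.measurableEmbedding).integral_map (μ := volume)
      (fun x => Real.exp (-‖x‖ ^ 2) * g (‖x‖ ^ 2))
    refine this.trans (integral_congr_ae (.of_forall fun z => ?_))
    change Real.exp (-‖e z‖ ^ 2) * g (‖e z‖ ^ 2) = _
    rw [hnorm]
  have h3 := integral_comp_rpow_Ioi (fun s : ℝ => s ^ ((Fintype.card ι : ℝ) - 1) *
    Real.exp (-s) * g s) (two_ne_zero (α := ℝ))
  rw [stdC_eq, integral_withDensity_eq_integral_toReal_smul (by fun_prop) (by simp)]
  have h4 : ∀ z : ι → ℂ, (ENNReal.ofReal ((Real.pi ^ Fintype.card ι)⁻¹ *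
      Real.exp (-∑ i, ‖z i‖ ^ 2))).toReal • g (∑ i, ‖z i‖ ^ 2) =
      (Real.pi ^ Fintype.card ι)⁻¹ * (Real.exp (-∑ i, ‖z i‖ ^ 2) * g (∑ i, ‖z i‖ ^ 2)) := by
    intro z
    rw [ENNReal.toReal_ofReal (by positivity), smul_eq_mul, mul_assoc]
  simp_rw [h4]
  rw [integral_const_mul, ← h2, h1, hfr, ← h3, mul_assoc]
  congr 1
  rw [nsmul_eq_mul, smul_eq_mul, ← mul_assoc, div_mul_eq_mul_div, mul_div_assoc,
    ← integral_div]
  congr 1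
  refine setIntegral_congr_fun measurableSet_Ioi fun y hy => ?_
  have hy' : (0 : ℝ) < y := hy
  have h5 : y ^ (2 * Fintype.card ι - 1) = y * (y ^ 2) ^ ((Fintype.card ι : ℝ) - 1) := by
    rw [Real.rpow_sub_one (by positivity), Real.rpow_natCast, ← pow_mul,
      show 2 * Fintype.card ι = (2 * Fintype.card ι - 1) + 1 by omega, pow_succ]
    simp only [Nat.add_sub_cancel]
    field_simp
  have h6 : y ^ ((2 : ℝ) - 1) = y := by norm_num
  simp only [smul_eq_mul]
  rw [h5, h6, Real.rpow_two, abs_of_pos (by norm_num : (0 : ℝ) < 2)]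
  ring

/-- In `exists_integral_energy`, `g = 1` forces `C = 1 / Γ(card ι)`, and the indicator of `(-∞, x]`
then produces the incomplete gamma function. -/
theorem stdC_energy_le (ι : Type*) [Fintype ι] [Nonempty ι] (x : ℝ) :
    stdC ι {z | ∑ i, ‖z i‖ ^ 2 ≤ x} = ENNReal.ofReal (gammaRatio (Fintype.card ι) x) := by
  obtain ⟨C, hC⟩ := exists_integral_energy ι
  have hcard : (0 : ℝ) < Fintype.card ι := by exact_mod_cast Fintype.card_pos
  have h1 := hC fun _ => 1
  have hG : C * Real.Gamma (Fintype.card ι) = 1 := by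
    rw [Real.Gamma_eq_integral hcard]
    simp only [integral_const, probReal_univ, smul_eq_mul, mul_one] at h1
    conv_rhs => rw [h1]
    congr 2
    ext s
    ring
  have h2 := hC ((Set.Iic x).indicator 1)
  have hm : MeasurableSet {z : ι → ℂ | ∑ i, ‖z i‖ ^ 2 ≤ x} :=
    measurableSet_le (by fun_prop) measurable_const
  have h3 : ∫ z, (Set.Iic x).indicator (1 : ℝ → ℝ) (∑ i, ‖z i‖ ^ 2) ∂(stdC ι) =
      (stdC ι).real {z | ∑ i, ‖z i‖ ^ 2 ≤ x} := by
    rw [← integral_indicator_one hm]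
    rfl
  have h4 : ∫ s in Set.Ioi (0 : ℝ), s ^ ((Fintype.card ι : ℝ) - 1) * Real.exp (-s) *
      (Set.Iic x).indicator (1 : ℝ → ℝ) s = lowerGamma (Fintype.card ι) x := by
    rw [lowerGamma, ← Set.Ioi_inter_Iic, Set.inter_comm, ← Measure.restrict_restrict
      measurableSet_Iic, ← integral_indicator measurableSet_Iic]
    congr 1
    ext s
    by_cases hs : s ∈ Set.Iic x <;> simp [hs]
  rw [h3, h4] at h2
  rw [← ofReal_measureReal, h2, gammaRatio, div_eq_mul_inv, mul_comm (lowerGamma _ _)]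
  rw [eq_inv_of_mul_eq_one_left hG]

theorem stdC_energy_gt (ι : Type*) [Fintype ι] [Nonempty ι] (x : ℝ) :
    stdC ι {z | x < ∑ i, ‖z i‖ ^ 2} = ENNReal.ofReal (1 - gammaRatio (Fintype.card ι) x) := by
  have hm : MeasurableSet {z : ι → ℂ | ∑ i, ‖z i‖ ^ 2 ≤ x} :=
    measurableSet_le (by fun_prop) measurable_const
  have h := prob_compl_eq_one_sub (μ := stdC ι) hm
  have h' : {z : ι → ℂ | ∑ i, ‖z i‖ ^ 2 ≤ x}ᶜ = {z | x < ∑ i, ‖z i‖ ^ 2} := by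
    ext z; simp
  rw [h', stdC_energy_le] at h
  rw [h, ENNReal.ofReal_sub _ ?_, ENNReal.ofReal_one]
  refine div_nonneg (setIntegral_nonneg measurableSet_Ioc fun s hs => ?_)
    (Real.Gamma_nonneg_of_nonneg (Nat.cast_nonneg _))
  have : 0 < s := hs.1
  positivity

/-! ### Among the ellipsoids of a given volume, the ball has the largest Gaussian measure -/

/-- The bathtub principle: `E \ B` and `B \ E` have the same `μ`-measure, and the density is at most
`c` on the first and at least `c` on the second. Finiteness of `μ B` allows the common part to be
cancelled. -/
theorem measure_le_of_superlevel {α : Type*} [MeasurableSpace α] {μ : Measure α} {f : α → ℝ≥0∞}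
    {E B : Set α} (hE : MeasurableSet E) (hB : MeasurableSet B) (hvol : μ E = μ B)
    (hfin : μ B ≠ ∞) (c : ℝ≥0∞) (hin : ∀ x ∈ B, c ≤ f x) (hout : ∀ x ∉ B, f x ≤ c) :
    μ.withDensity f E ≤ μ.withDensity f B := by
  have h1 : μ (E \ B) = μ (B \ E) := by
    have h := measure_inter_add_sdiff (μ := μ) E hB
    have h' := measure_inter_add_sdiff (μ := μ) B hE
    rw [hvol, ← h', Set.inter_comm B E] at h
    exact (ENNReal.add_right_inj (ne_top_of_le_ne_top hfin
      (measure_mono Set.inter_subset_right))).1 h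
  rw [← measure_inter_add_sdiff E hB, ← measure_inter_add_sdiff B hE, Set.inter_comm B E]
  refine add_le_add le_rfl ?_
  rw [withDensity_apply _ (hE.diff hB), withDensity_apply _ (hB.diff hE)]
  calc ∫⁻ x in E \ B, f x ∂μ ≤ ∫⁻ _ in E \ B, c ∂μ :=
        setLIntegral_mono' (hE.diff hB) fun x hx => hout x hx.2
    _ = ∫⁻ _ in B \ E, c ∂μ := by simp [h1]
    _ ≤ ∫⁻ x in B \ E, f x ∂μ := setLIntegral_mono' (hB.diff hE) fun x hx => hin x hx.1

theorem volume_ellipsoid {ι : Type*} [Fintype ι] {d : ι → ℝ} (hd : ∀ i, 0 < d i) (x : ℝ) :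
    volume {z : ι → ℂ | ∑ i, d i * ‖z i‖ ^ 2 ≤ x} =
      ENNReal.ofReal (∏ i, d i)⁻¹ * volume {z : ι → ℂ | ∑ i, ‖z i‖ ^ 2 ≤ x} := by
  classical
  let N : Matrix ι ι ℂ := Matrix.diagonal fun i => ((√(d i) : ℝ) : ℂ)
  have hN : ‖N.det‖ ^ 2 = ∏ i, d i := by
    rw [Matrix.det_diagonal, norm_prod, ← Finset.prod_pow]
    refine Finset.prod_congr rfl fun i _ => ?_
    rw [Complex.norm_real, Real.norm_eq_abs, sq_abs, Real.sq_sqrt (hd i).le]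
  have hpos : 0 < ∏ i, d i := Finset.prod_pos fun i _ => hd i
  have hN0 : N.det ≠ 0 := by
    intro h; rw [h] at hN; simp at hN; exact hpos.ne hN
  have hm : MeasurableSet {z : ι → ℂ | ∑ i, ‖z i‖ ^ 2 ≤ x} :=
    measurableSet_le (by fun_prop) measurable_const
  have hm' : MeasurableSet {z : ι → ℂ | ∑ i, d i * ‖z i‖ ^ 2 ≤ x} :=
    measurableSet_le (by fun_prop) measurable_const
  have h := lintegral_comp_mulVec hN0
    (f := {z : ι → ℂ | ∑ i, ‖z i‖ ^ 2 ≤ x}.indicator 1) (measurable_one.indicator hm)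
  rw [hN, lintegral_indicator_one hm] at h
  rw [← h, ← lintegral_indicator_one hm']
  refine lintegral_congr fun z => ?_
  have : ∑ i, ‖(N *ᵥ z) i‖ ^ 2 = ∑ i, d i * ‖z i‖ ^ 2 := by
    refine Finset.sum_congr rfl fun i _ => ?_
    rw [Matrix.mulVec_diagonal, norm_mul, mul_pow, Complex.norm_real, Real.norm_eq_abs, sq_abs,
      Real.sq_sqrt (hd i).le]
  simp only [Set.indicator, Set.mem_ofPred_eq, this, Pi.one_apply]

/-- The ball `‖z‖² ≤ x / r`, with `r` the geometric mean of the weights, has the volume of the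
ellipsoid, and it is a superlevel set of the Gaussian density; the bathtub principle applies. -/
theorem stdC_ellipsoid_le {ι : Type*} [Fintype ι] [Nonempty ι] {d : ι → ℝ} (hd : ∀ i, 0 < d i)
    (x : ℝ) : stdC ι {z | ∑ i, d i * ‖z i‖ ^ 2 ≤ x} ≤ ENNReal.ofReal
      (gammaRatio (Fintype.card ι) (x / (∏ i, d i) ^ (1 / (Fintype.card ι : ℝ)))) := by
  have hpos : 0 < ∏ i, d i := Finset.prod_pos fun i _ => hd i
  set r : ℝ := (∏ i, d i) ^ (1 / (Fintype.card ι : ℝ)) with hr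
  have hr0 : 0 < r := Real.rpow_pos_of_pos hpos _
  have hcard : (Fintype.card ι : ℝ) ≠ 0 := by exact_mod_cast Fintype.card_ne_zero
  have hrp : ∏ _i : ι, r = ∏ i, d i := by
    rw [Finset.prod_const, Finset.card_univ, hr, ← Real.rpow_natCast, ← Real.rpow_mul hpos.le,
      one_div_mul_cancel hcard, Real.rpow_one]
  have hB : {z : ι → ℂ | ∑ i, r * ‖z i‖ ^ 2 ≤ x} = {z : ι → ℂ | ∑ i, ‖z i‖ ^ 2 ≤ x / r} := by
    ext z
    simp only [Set.mem_ofPred_eq]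
    rw [← Finset.mul_sum, le_div_iff₀ hr0, mul_comm]
  have hmB : MeasurableSet {z : ι → ℂ | ∑ i, ‖z i‖ ^ 2 ≤ x / r} :=
    measurableSet_le (by fun_prop) measurable_const
  have hmE : MeasurableSet {z : ι → ℂ | ∑ i, d i * ‖z i‖ ^ 2 ≤ x} :=
    measurableSet_le (by fun_prop) measurable_const
  rw [← stdC_energy_le, stdC_eq]
  refine measure_le_of_superlevel hmE hmB ?_ ?_ (ENNReal.ofReal
    ((Real.pi ^ Fintype.card ι)⁻¹ * Real.exp (-(x / r)))) ?_ ?_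
  · rw [← hB, volume_ellipsoid hd, volume_ellipsoid (fun _ => hr0), hrp]
  · refine ((Metric.isBounded_closedBall (x := (0 : ι → ℂ)) (r := √(x / r))).subset
      fun z hz => ?_).measure_lt_top.ne
    rw [mem_closedBall_zero_iff, pi_norm_le_iff_of_nonneg (Real.sqrt_nonneg _)]
    intro i
    refine Real.le_sqrt_of_sq_le (le_trans ?_ hz)
    exact Finset.single_le_sum (f := fun i => ‖z i‖ ^ 2) (fun i _ => by positivity)
      (Finset.mem_univ i)
  · intro z hz
    refine ENNReal.ofReal_le_ofReal (mul_le_mul_of_nonneg_left ?_ (by positivity))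
    exact Real.exp_le_exp.2 (neg_le_neg hz)
  · intro z hz
    refine ENNReal.ofReal_le_ofReal (mul_le_mul_of_nonneg_left ?_ (by positivity))
    exact Real.exp_le_exp.2 (neg_le_neg (not_le.1 hz).le)

/-! ### Unitary invariance -/

theorem measurePreserving_mulVec_unitary {ι : Type*} [Fintype ι] [DecidableEq ι]
    {U : Matrix ι ι ℂ} (hU : Uᴴ * U = 1) :
    MeasurePreserving (fun z : ι → ℂ => U *ᵥ z) (stdC ι) (stdC ι) := by
  have hm : Measurable fun z : ι → ℂ => U *ᵥ z := by
    unfold Matrix.mulVec dotProduct; fun_prop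
  have hdet : ‖U.det‖ ^ 2 = 1 := by
    have := congrArg Matrix.det hU
    rw [Matrix.det_mul, Matrix.det_conjTranspose, Matrix.det_one] at this
    have h2 := congrArg norm this
    rw [norm_mul, norm_star, norm_one] at h2
    rw [sq, h2]
  have h0 : U.det ≠ 0 := by intro h; rw [h] at hdet; simp at hdet
  refine ⟨hm, Measure.ext fun s hs => ?_⟩
  rw [Measure.map_apply hm hs, ← lintegral_indicator_one hs,
    ← lintegral_indicator_one (hm hs), lintegral_stdC (measurable_one.indicator (hm hs)),
    lintegral_stdC (measurable_one.indicator hs)]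
  have h := lintegral_comp_mulVec h0 (f := fun z => ENNReal.ofReal ((Real.pi ^ Fintype.card ι)⁻¹ *
      Real.exp (-∑ i, ‖z i‖ ^ 2)) * s.indicator 1 z)
      (Measurable.mul (by fun_prop) (measurable_one.indicator hs))
  rw [hdet, inv_one, ENNReal.ofReal_one, one_mul] at h
  rw [← h]
  refine lintegral_congr fun z => ?_
  rw [← quadForm_conjTranspose_mul_self, hU, quadForm_one]
  rfl

/-- The combination is the first coordinate of a rotation of `ℂ²`, which preserves the Gaussian law.
-/
theorem map_cGaussian_pair {a b : ℝ} (hab : a ^ 2 + b ^ 2 = 1) :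
    MeasurePreserving (fun p : ℂ × ℂ => (a : ℂ) * p.1 + (b : ℂ) * p.2)
      ((cGaussian 1).prod (cGaussian 1)) (cGaussian 1) := by
  let U : Matrix (Fin 2) (Fin 2) ℂ := !![(a : ℂ), b; -b, a]
  have hU : Uᴴ * U = 1 := by
    have h : (a : ℂ) ^ 2 + (b : ℂ) ^ 2 = 1 := by exact_mod_cast hab
    ext i j
    fin_cases i <;> fin_cases j <;>
      simp [U, Matrix.mul_apply, Matrix.conjTranspose_apply, Fin.sum_univ_two] <;>
      first | ring1 | linear_combination h
  have h1 := measurePreserving_mulVec_unitary hU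
  have h2 := (measurePreserving_finTwoArrow (cGaussian 1)).symm
  have h3 := measurePreserving_eval (fun _ : Fin 2 => cGaussian 1) 0
  convert h3.comp (h1.comp h2) using 1
  ext p
  simp [U, dotProduct, Fin.sum_univ_two, MeasurableEquiv.finTwoArrow]

/-! ### Subfamilies of i.i.d. families -/

section Iid

variable {ι κ E : Type*} [Fintype ι] [Fintype κ] [MeasurableSpace E]

theorem measurePreserving_comp_injective (μ : Measure E) [IsProbabilityMeasure μ] {e : κ → ι}
    (he : Function.Injective e) :
    MeasurePreserving (fun (x : ι → E) k => x (e k)) (Measure.pi fun _ => μ)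
      (Measure.pi fun _ => μ) := by
  classical
  have hm : Measurable fun (x : ι → E) k => x (e k) := by fun_prop
  refine ⟨hm, (Measure.pi_eq fun s hs => ?_).symm⟩
  rw [Measure.map_apply hm (MeasurableSet.univ_pi hs)]
  -- The preimage of a box is again a box: its side at `i` is `s k` if `i = e k`, for a single `k`
  -- by injectivity, and the whole space if `i` is not in the range of `e`.
  let t : ι → Set E := fun i => ⋂ (k : κ) (_ : e k = i), s k
  have ht : (fun (x : ι → E) k => x (e k)) ⁻¹' Set.univ.pi s = Set.univ.pi t := by
    ext x
    simp only [Set.mem_preimage, Set.mem_pi, Set.mem_univ, true_implies, t, Set.mem_iInter]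
    exact ⟨fun h i k hk => hk ▸ h k, fun h k => h (e k) k rfl⟩
  have hte : ∀ k, t (e k) = s k := fun k => by
    ext x
    simp only [t, Set.mem_iInter]
    exact ⟨fun h => h k rfl, fun h k' hk' => he hk' ▸ h⟩
  rw [ht, Measure.pi_pi, ← Finset.prod_subset (Finset.subset_univ (Finset.univ.image e)),
    Finset.prod_image fun a _ b _ h => he h]
  · simp [hte]
  · intro i _ hi
    have : t i = Set.univ := by
      refine Set.eq_univ_of_forall fun x => ?_
      simp only [t, Set.mem_iInter]
      intro k hk
      exact absurd (Finset.mem_image.2 ⟨k, Finset.mem_univ _, hk⟩) hi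
    rw [this, measure_univ]

/-- Injectivity of `Sum.elim e₁ e₂` says that each selection is without repetition and that the two
are disjoint; this gives the independence of the two subfamilies. -/
theorem measurePreserving_comp_pair {κ' : Type*} [Fintype κ'] (μ : Measure E)
    [IsProbabilityMeasure μ] {e₁ : κ → ι} {e₂ : κ' → ι}
    (he : Function.Injective (Sum.elim e₁ e₂)) :
    MeasurePreserving (fun x : ι → E => ((fun k => x (e₁ k) : κ → E), (fun k => x (e₂ k) : κ' → E)))
      (Measure.pi fun _ => μ) ((Measure.pi fun _ => μ).prod (Measure.pi fun _ => μ)) :=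
  (measurePreserving_sumPiEquivProdPi (fun _ : κ ⊕ κ' => μ)).comp
    (measurePreserving_comp_injective μ he)

theorem measurePreserving_curry (μ : Measure E) [IsProbabilityMeasure μ] :
    MeasurePreserving (fun (x : ι → κ → E) (p : ι × κ) => x p.1 p.2)
      (Measure.pi fun _ => Measure.pi fun _ => μ) (Measure.pi fun _ => μ) := by
  have hm : Measurable fun (x : ι → κ → E) (p : ι × κ) => x p.1 p.2 := by fun_prop
  refine ⟨hm, (Measure.pi_eq fun s hs => ?_).symm⟩
  rw [Measure.map_apply hm (MeasurableSet.univ_pi hs)]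
  have ht : (fun (x : ι → κ → E) (p : ι × κ) => x p.1 p.2) ⁻¹' Set.univ.pi s =
      Set.univ.pi fun i => Set.univ.pi fun k => s (i, k) := by
    ext x; simp
  rw [ht, Measure.pi_pi]
  simp_rw [Measure.pi_pi]
  rw [Fintype.prod_prod_type]

theorem measurePreserving_flip (μ : Measure E) [IsProbabilityMeasure μ] :
    MeasurePreserving (fun (x : ι → κ → E) k i => x i k)
      (Measure.pi fun _ => Measure.pi fun _ => μ) (Measure.pi fun _ => Measure.pi fun _ => μ) := by
  let e : (ι → κ → E) ≃ᵐ (ι × κ → E) :=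
    { toFun := fun x p => x p.1 p.2, invFun := fun y i k => y (i, k),
      left_inv := fun _ => rfl, right_inv := fun _ => rfl,
      measurable_toFun := by dsimp; fun_prop, measurable_invFun := by dsimp; fun_prop }
  let e' : (κ → ι → E) ≃ᵐ (κ × ι → E) :=
    { toFun := fun x p => x p.1 p.2, invFun := fun y i k => y (i, k),
      left_inv := fun _ => rfl, right_inv := fun _ => rfl,
      measurable_toFun := by dsimp; fun_prop, measurable_invFun := by dsimp; fun_prop }
  have h1 : MeasurePreserving e _ _ := measurePreserving_curry (ι := ι) (κ := κ) μ
  have h2 : MeasurePreserving e' _ _ := measurePreserving_curry (ι := κ) (κ := ι) μ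
  exact h2.symm.comp ((measurePreserving_comp_injective μ
    (Prod.swap_injective (α := κ) (β := ι))).comp h1)

end Iid

/-! ### Gaussian arrays: selections, scalings, rotations and energies. -/

section Arrays

variable {ι κ κ' : Type*} [Fintype ι] [Fintype κ] [Fintype κ']

instance isProbabilityMeasure_cGaussianArray (v : ℝ≥0) :
    IsProbabilityMeasure (cGaussianArray ι κ v) := by
  unfold cGaussianArray; infer_instance

theorem measurePreserving_array_flip (v : ℝ≥0) : MeasurePreserving
    (fun (x : ι → κ → ℂ) k i => x i k) (cGaussianArray ι κ v) (cGaussianArray κ ι v) :=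
  measurePreserving_flip _

theorem measurePreserving_array_columns (v : ℝ≥0) {e : κ' → κ} (he : Function.Injective e) :
    MeasurePreserving (fun (x : ι → κ → ℂ) i k => x i (e k)) (cGaussianArray ι κ v)
      (cGaussianArray ι κ' v) :=
  measurePreserving_pi _ _ fun _ => measurePreserving_comp_injective _ he

theorem measurePreserving_array_rows (v : ℝ≥0) {e : κ' → ι} (he : Function.Injective e) :
    MeasurePreserving (fun (x : ι → κ → ℂ) i k => x (e i) k) (cGaussianArray ι κ v)
      (cGaussianArray κ' κ v) :=
  measurePreserving_comp_injective _ he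

theorem measurePreserving_array_columns_pair (v : ℝ≥0) {κ'' : Type*} [Fintype κ'']
    {e₁ : κ' → κ} {e₂ : κ'' → κ} (he : Function.Injective (Sum.elim e₁ e₂)) :
    MeasurePreserving (fun x : ι → κ → ℂ =>
        ((fun i k => x i (e₁ k) : ι → κ' → ℂ), (fun i k => x i (e₂ k) : ι → κ'' → ℂ)))
      (cGaussianArray ι κ v) ((cGaussianArray ι κ' v).prod (cGaussianArray ι κ'' v)) :=
  (measurePreserving_arrowProdEquivProdArrow _ _ ι (fun _ => Measure.pi fun _ => cGaussian v)
    (fun _ => Measure.pi fun _ => cGaussian v)).comp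
    (measurePreserving_pi _ _ fun _ => measurePreserving_comp_pair (cGaussian v) he)

theorem measurePreserving_array_smul (v : ℝ≥0) : MeasurePreserving
    (fun (x : ι → κ → ℂ) i k => ((√(v : ℝ) : ℝ) : ℂ) * x i k)
      (cGaussianArray ι κ 1) (cGaussianArray ι κ v) := by
  have h : MeasurePreserving (fun z : ℂ => ((√(v : ℝ) : ℝ) : ℂ) * z) (cGaussian 1)
      (cGaussian v) := ⟨by fun_prop, (cGaussian_eq_map v).symm⟩
  exact measurePreserving_pi _ _ fun _ => measurePreserving_pi _ _ fun _ => h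

theorem measurePreserving_array_unitary [DecidableEq ι] {U : Matrix ι ι ℂ} (hU : Uᴴ * U = 1) :
    MeasurePreserving (fun (x : ι → κ → ℂ) i k => ∑ j, U i j * x j k)
      (cGaussianArray ι κ 1) (cGaussianArray ι κ 1) :=
  (measurePreserving_array_flip (ι := κ) (κ := ι) 1).comp
    ((measurePreserving_pi _ _ fun _ : κ => measurePreserving_mulVec_unitary hU).comp
      (measurePreserving_array_flip (ι := ι) (κ := κ) 1))

theorem measurePreserving_array_pair {a b : ι → ℝ} (hab : ∀ i, a i ^ 2 + b i ^ 2 = 1) :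
    MeasurePreserving (fun p : (ι → κ → ℂ) × (ι → κ → ℂ) =>
        (fun i k => (a i : ℂ) * p.1 i k + (b i : ℂ) * p.2 i k : ι → κ → ℂ))
      ((cGaussianArray ι κ 1).prod (cGaussianArray ι κ 1)) (cGaussianArray ι κ 1) := by
  have h1 := (measurePreserving_arrowProdEquivProdArrow (κ → ℂ) (κ → ℂ) ι
    (fun _ => Measure.pi fun _ => cGaussian 1) (fun _ => Measure.pi fun _ => cGaussian 1)).symm
  have h3 : ∀ i, MeasurePreserving (fun (p : (κ → ℂ) × (κ → ℂ)) (k : κ) =>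
      (a i : ℂ) * p.1 k + (b i : ℂ) * p.2 k)
      ((Measure.pi fun _ => cGaussian 1).prod (Measure.pi fun _ => cGaussian 1))
      (Measure.pi fun _ => cGaussian 1) := by
    intro i
    have h2 := (measurePreserving_arrowProdEquivProdArrow ℂ ℂ κ
      (fun _ => cGaussian 1) (fun _ => cGaussian 1)).symm
    exact (measurePreserving_pi (fun _ : κ => (cGaussian 1).prod (cGaussian 1))
      (fun _ => cGaussian 1) fun _ => map_cGaussian_pair (hab i)).comp h2
  exact (measurePreserving_pi (fun _ : ι => (Measure.pi fun _ : κ => cGaussian 1).prod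
    (Measure.pi fun _ : κ => cGaussian 1)) (fun _ => Measure.pi fun _ => cGaussian 1) h3).comp h1

theorem cGaussianArray_energy_le [Nonempty ι] [Nonempty κ] (x : ℝ) :
    cGaussianArray ι κ 1 {z | ∑ i, ∑ k, ‖z i k‖ ^ 2 ≤ x} =
      ENNReal.ofReal (gammaRatio (Fintype.card ι * Fintype.card κ) x) := by
  have h := (measurePreserving_curry (ι := ι) (κ := κ) (cGaussian 1)).measure_preimage
    (s := {z | ∑ i, ‖z i‖ ^ 2 ≤ x})
    (measurableSet_le (by fun_prop) measurable_const).nullMeasurableSet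
  rw [stdC_energy_le (ι × κ), Fintype.card_prod, Nat.cast_mul] at h
  rw [← h, cGaussianArray]
  congr 1
  ext z
  simp [Fintype.sum_prod_type]

theorem cGaussianArray_energy_gt [Nonempty ι] [Nonempty κ] (x : ℝ) :
    cGaussianArray ι κ 1 {z | x < ∑ i, ∑ k, ‖z i k‖ ^ 2} =
      ENNReal.ofReal (1 - gammaRatio (Fintype.card ι * Fintype.card κ) x) := by
  have h := (measurePreserving_curry (ι := ι) (κ := κ) (cGaussian 1)).measure_preimage
    (s := {z | x < ∑ i, ‖z i‖ ^ 2})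
    (measurableSet_lt measurable_const (by fun_prop)).nullMeasurableSet
  rw [stdC_energy_gt (ι × κ), Fintype.card_prod, Nat.cast_mul] at h
  rw [← h, cGaussianArray]
  congr 1
  ext z
  simp [Fintype.sum_prod_type]

theorem cGaussianArray_ellipsoid_le [Nonempty ι] [Nonempty κ] {d : ι → ℝ} (hd : ∀ i, 0 < d i)
    (x : ℝ) : cGaussianArray ι κ 1 {z | ∑ i, d i * ∑ k, ‖z i k‖ ^ 2 ≤ x} ≤
      ENNReal.ofReal (gammaRatio (Fintype.card ι * Fintype.card κ)
        (x / (∏ i, d i) ^ (1 / (Fintype.card ι : ℝ)))) := by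
  have h := (measurePreserving_curry (ι := ι) (κ := κ) (cGaussian 1)).measure_preimage
    (s := {z | ∑ i, d i.1 * ‖z i‖ ^ 2 ≤ x})
    (measurableSet_le (by fun_prop) measurable_const).nullMeasurableSet
  have h' := stdC_ellipsoid_le (ι := ι × κ) (d := fun p => d p.1) (fun p => hd p.1) x
  have hpos : 0 < ∏ i, d i := Finset.prod_pos fun i _ => hd i
  have hκ : (Fintype.card κ : ℝ) ≠ 0 := by exact_mod_cast Fintype.card_ne_zero
  have hι : (Fintype.card ι : ℝ) ≠ 0 := by exact_mod_cast Fintype.card_ne_zero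
  -- Every weight is repeated once for each column, which leaves the geometric mean unchanged.
  have hprod : (∏ p : ι × κ, d p.1) ^ (1 / (Fintype.card (ι × κ) : ℝ)) =
      (∏ i, d i) ^ (1 / (Fintype.card ι : ℝ)) := by
    rw [Fintype.prod_prod_type]
    simp only [Finset.prod_const, Finset.card_univ, Finset.prod_pow]
    rw [← Real.rpow_natCast, ← Real.rpow_mul hpos.le, Fintype.card_prod, Nat.cast_mul]
    congr 1
    field_simp
  rw [hprod, Fintype.card_prod, Nat.cast_mul, ← h] at h'
  refine le_trans (le_of_eq ?_) h'
  rw [cGaussianArray]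
  congr 1
  ext z
  simp [Fintype.sum_prod_type, Finset.mul_sum]

end Arrays

/-- Reordering the columns of an array is a measurable equivalence. -/
def columnEquiv (ι : Type*) {κ κ' : Type*} (e : κ' ≃ κ) : (ι → κ → ℂ) ≃ᵐ (ι → κ' → ℂ) where
  toFun x i k := x i (e k)
  invFun y i k := y i (e.symm k)
  left_inv x := by simp
  right_inv x := by simp
  measurable_toFun := by dsimp; fun_prop
  measurable_invFun := by dsimp; fun_prop

/-! ### Energy of an array -/

/-- The squared Frobenius norm. -/
def energy {ι κ : Type*} [Fintype ι] [Fintype κ] (X : Matrix ι κ ℂ) : ℝ :=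
  ∑ i, ∑ k, ‖X i k‖ ^ 2

theorem energy_eq_sum_quadForm {ι κ : Type*} [Fintype ι] [Fintype κ] [DecidableEq ι]
    (X : Matrix ι κ ℂ) : energy X = ∑ k, quadForm (1 : Matrix ι ι ℂ) fun i => X i k := by
  simp_rw [quadForm_one]
  exact Finset.sum_comm

theorem energy_unitary_mul {ι κ : Type*} [Fintype ι] [Fintype κ] [DecidableEq ι]
    {U : Matrix ι ι ℂ} (hU : Uᴴ * U = 1) (X : Matrix ι κ ℂ) : energy (U * X) = energy X := by
  rw [energy_eq_sum_quadForm, energy_eq_sum_quadForm]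
  refine Finset.sum_congr rfl fun k _ => ?_
  have h : (fun i => (U * X) i k) = U *ᵥ fun i => X i k := rfl
  rw [h, quadForm_one, ← quadForm_conjTranspose_mul_self, hU]

@[fun_prop]
theorem measurable_energy {ι κ : Type*} [Fintype ι] [Fintype κ] :
    Measurable fun X : ι → κ → ℂ => energy (Matrix.of X) := by
  simp only [energy, Matrix.of_apply]
  fun_prop

/-! ### Singular value decomposition -/

/-- The `n × m` matrix with the entries `√ s j` at the positions `(e j, j)`. -/
def singularMatrix {n m : Type*} [DecidableEq n] (e : m → n) (s : m → ℝ) : Matrix n m ℂ :=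
  Matrix.of fun i j => if i = e j then ((√(s j) : ℝ) : ℂ) else 0

/-- `V` diagonalizes `Aᴴ A`, so the columns of `A V` are orthogonal with squared norms `s j`. The
nonzero ones, normalized and placed at the positions `e j`, extend to an orthonormal basis, whose
vectors are the columns of `U`. Here `s` holds the squares of the singular values. -/
theorem exists_svd {n m : Type*} [Fintype n] [Fintype m] [DecidableEq n] [DecidableEq m]
    (e : m ↪ n) (A : Matrix n m ℂ) : ∃ (U : Matrix n n ℂ) (V : Matrix m m ℂ) (s : m → ℝ),
      Uᴴ * U = 1 ∧ Vᴴ * V = 1 ∧ (∀ j, 0 ≤ s j) ∧ A * V = U * singularMatrix e s := by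
  have hH : (Aᴴ * A).PosSemidef := Matrix.posSemidef_conjTranspose_mul_self A
  set s := hH.isHermitian.eigenvalues with hs
  have hs0 : ∀ j, 0 ≤ s j := hH.eigenvalues_nonneg
  let V : Matrix m m ℂ := hH.isHermitian.eigenvectorUnitary
  have hV : Vᴴ * V = 1 := Unitary.coe_star_mul_self hH.isHermitian.eigenvectorUnitary
  have hdiag : (A * V)ᴴ * (A * V) = Matrix.diagonal fun j => (s j : ℂ) := by
    have h := hH.isHermitian.spectral_theorem
    rw [Unitary.conjStarAlgAut_apply] at h
    rw [Matrix.conjTranspose_mul, Matrix.mul_assoc, ← Matrix.mul_assoc Aᴴ, h]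
    change Vᴴ * (V * _ * Vᴴ * V) = _
    rw [Matrix.mul_assoc, hV, Matrix.mul_one, ← Matrix.mul_assoc, hV, Matrix.one_mul]
    rfl
  let w : m → EuclideanSpace ℂ n := fun j => WithLp.toLp 2 fun i => (A * V) i j
  have hw : ∀ i j, inner ℂ (w i) (w j) = if i = j then (s i : ℂ) else 0 := by
    intro i j
    have := congrFun (congrFun hdiag i) j
    rw [Matrix.diagonal_apply, Matrix.mul_apply] at this
    rw [← this, PiLp.inner_apply]
    refine Finset.sum_congr rfl fun k _ => ?_
    simp [w, Matrix.conjTranspose_apply, mul_comm]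
  let v : n → EuclideanSpace ℂ n :=
    Function.extend e (fun j => (((√(s j))⁻¹ : ℝ) : ℂ) • w j) 0
  have hve : ∀ j, v (e j) = (((√(s j))⁻¹ : ℝ) : ℂ) • w j := fun j => e.injective.extend_apply _ _ j
  -- The positions with `s j = 0` are left out: there `w j` vanishes, and the basis may be completed
  -- arbitrarily.
  have hv : Orthonormal ℂ ((e '' {j | s j ≠ 0}).domRestrict v) := by
    rw [orthonormal_iff_ite]
    rintro ⟨_, i, hi, rfl⟩ ⟨_, j, hj, rfl⟩
    by_cases hij : i = j
    · subst hij
      rw [if_pos rfl]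
      simp only [Set.domRestrict_apply, hve, inner_smul_left, inner_smul_right, hw,
        Complex.conj_ofReal, if_true]
      rw [← Complex.ofReal_mul, ← Complex.ofReal_mul, ← Complex.ofReal_one]
      congr 1
      have h1 : √(s i) ≠ 0 := Real.sqrt_ne_zero'.2 (lt_of_le_of_ne (hs0 i) (Ne.symm hi))
      nth_rewrite 3 [← Real.mul_self_sqrt (hs0 i)]
      field_simp
    · rw [if_neg fun h => hij (e.injective (congrArg Subtype.val h))]
      simp [hve, inner_smul_left, inner_smul_right, hw, hij]
  obtain ⟨b, hb⟩ := hv.exists_orthonormalBasis_extension_of_card_eq (by simp)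
  refine ⟨Matrix.of fun i k => b k i, V, s, ?_, hV, hs0, ?_⟩
  · ext i j
    have := orthonormal_iff_ite.1 b.orthonormal i j
    rw [PiLp.inner_apply] at this
    rw [Matrix.one_apply, ← this, Matrix.mul_apply]
    refine Finset.sum_congr rfl fun k _ => ?_
    simp [Matrix.conjTranspose_apply, mul_comm]
  · ext i j
    have h1 : w j = ((√(s j) : ℝ) : ℂ) • b (e j) := by
      by_cases hj : s j = 0
      · have : w j = 0 := by
          rw [← inner_self_eq_zero (𝕜 := ℂ), hw, if_pos rfl, hj, Complex.ofReal_zero]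
        rw [this, hj]; simp
      · rw [hb (e j) ⟨j, hj, rfl⟩, hve, smul_smul, ← Complex.ofReal_mul, mul_inv_cancel₀
          (Real.sqrt_ne_zero'.2 (lt_of_le_of_ne (hs0 j) (Ne.symm hj))), Complex.ofReal_one, one_smul]
    have h2 : (A * V) i j = w j i := rfl
    rw [h2, h1, Matrix.mul_apply, Finset.sum_eq_single (e j)]
    · simp [singularMatrix, mul_comm]
    · intro k _ hk
      simp [singularMatrix, hk]
    · simp

theorem singularMatrix_conjTranspose_mul_self {n m : Type*} [Fintype n] [DecidableEq n]
    [DecidableEq m] (e : m ↪ n) {s : m → ℝ} (hs : ∀ j, 0 ≤ s j) :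
    (singularMatrix e s)ᴴ * singularMatrix e s = Matrix.diagonal fun j => (s j : ℂ) := by
  ext i j
  rw [Matrix.mul_apply, Finset.sum_eq_single (e i), Matrix.diagonal_apply]
  · by_cases hij : i = j
    · subst hij
      simp only [Matrix.conjTranspose_apply, singularMatrix, Matrix.of_apply, if_true]
      rw [Complex.star_def, Complex.conj_ofReal, ← Complex.ofReal_mul, Real.mul_self_sqrt (hs i)]
    · simp [singularMatrix, hij]
  · intro k _ hk
    simp [singularMatrix, hk]
  · simp

theorem det_one_add_smul_of_svd {n m : Type*} [Fintype n] [Fintype m] [DecidableEq n]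
    [DecidableEq m] {e : m ↪ n} {A : Matrix n m ℂ} {U : Matrix n n ℂ} {V : Matrix m m ℂ}
    {s : m → ℝ} (hU : Uᴴ * U = 1) (hV : Vᴴ * V = 1) (hs : ∀ j, 0 ≤ s j)
    (h : A * V = U * singularMatrix e s) (ω : ℝ) :
    (1 + ω • (Aᴴ * A)).det.re = ∏ j, (1 + ω * s j) := by
  have h1 : Vᴴ * (1 + ω • (Aᴴ * A)) * V = Matrix.diagonal fun j => ((1 + ω * s j : ℝ) : ℂ) := by
    have h2 : Vᴴ * (Aᴴ * A) * V = Matrix.diagonal fun j => (s j : ℂ) := by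
      calc Vᴴ * (Aᴴ * A) * V = (A * V)ᴴ * (A * V) := by
            simp only [Matrix.conjTranspose_mul, Matrix.mul_assoc]
        _ = (singularMatrix e s)ᴴ * (Uᴴ * U) * singularMatrix e s := by
            rw [h]; simp only [Matrix.conjTranspose_mul, Matrix.mul_assoc]
        _ = _ := by rw [hU, Matrix.mul_one, singularMatrix_conjTranspose_mul_self e hs]
    rw [Matrix.mul_add, Matrix.add_mul, Matrix.mul_one, hV, Matrix.mul_smul, Matrix.smul_mul, h2]
    ext i j
    by_cases hij : i = j
    · subst hij; simp
    · simp [hij]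
  have h3 := congrArg Matrix.det h1
  have h4 := congrArg Matrix.det hV
  rw [Matrix.det_mul, Matrix.det_one] at h4
  rw [Matrix.det_mul, Matrix.det_mul, Matrix.det_diagonal, mul_right_comm, h4, one_mul,
    ← Complex.ofReal_prod] at h3
  rw [h3, Complex.ofReal_re]

/-! ### A decomposition of a difference of energies -/

/-- For independent standard `z` and `g` the two combinations on the right have variances `1` and `1
+ ω s`. Comparing coefficients gives `β² - α² = ω s` and `c (β - α) = ω √s`, hence `β + α = c √s` if
`s ≠ 0`; so `α` and `β` are functions of `c`, and one equation for `c` is left. -/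
theorem exists_energy_difference {ω s : ℝ} (h0 : 0 < ω) (h1 : ω ≤ 1) (hs : 0 ≤ s) :
    ∃ c α β : ℝ, c ^ 2 + α ^ 2 = 1 ∧ c ^ 2 + β ^ 2 = 1 + ω * s ∧ ∀ z g : ℂ,
      ω * (‖z‖ ^ 2 - ‖z + ((√s : ℝ) : ℂ) * g‖ ^ 2) =
        ‖(c : ℂ) * z + (α : ℂ) * g‖ ^ 2 - ‖(c : ℂ) * z + (β : ℂ) * g‖ ^ 2 := by
  have hsq : √s ^ 2 = s := Real.sq_sqrt hs
  -- The equation `c² + α² = 1` is solved by the intermediate value theorem on `[√ω, 1]`: at `c =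
  -- √ω` one has `α = 0` and the left side is `ω ≤ 1`, while at `c = 1` it is at least `1`.
  have hcont : ContinuousOn (fun c : ℝ => c ^ 2 + ((c * √s - ω * √s / c) / 2) ^ 2)
      (Set.Icc (√ω) 1) := by
    refine ContinuousOn.add (by fun_prop) (ContinuousOn.pow (ContinuousOn.div_const
      (ContinuousOn.sub (by fun_prop) (ContinuousOn.div (by fun_prop) (by fun_prop) ?_)) _) _)
    intro c hc
    exact (lt_of_lt_of_le (Real.sqrt_pos.2 h0) hc.1).ne'
  have hω : √ω ≤ 1 := Real.sqrt_le_one.2 h1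
  have hωpos := Real.sqrt_pos.2 h0
  have hωsq : √ω ^ 2 = ω := Real.sq_sqrt h0.le
  have hl : √ω ^ 2 + ((√ω * √s - ω * √s / √ω) / 2) ^ 2 ≤ 1 := by
    have : ω * √s / √ω = √ω * √s := by
      rw [div_eq_iff hωpos.ne']; nth_rewrite 1 [← hωsq]; ring
    rw [this, sub_self, hωsq]; simpa using h1
  have hr : 1 ≤ (1 : ℝ) ^ 2 + (((1 : ℝ) * √s - ω * √s / 1) / 2) ^ 2 := by
    rw [one_pow]; exact le_add_of_nonneg_right (sq_nonneg _)
  obtain ⟨c, hc, hc1⟩ := intermediate_value_Icc hω hcont ⟨hl, hr⟩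
  have hc0 : c ≠ 0 := (lt_of_lt_of_le hωpos hc.1).ne'
  refine ⟨c, (c * √s - ω * √s / c) / 2, (c * √s + ω * √s / c) / 2, hc1, ?_, fun z g => ?_⟩
  · dsimp only at hc1
    have : ((c * √s + ω * √s / c) / 2) ^ 2 = ((c * √s - ω * √s / c) / 2) ^ 2 + ω * √s ^ 2 := by
      field_simp; ring
    rw [this, ← add_assoc, hc1, hsq]
  · set α := (c * √s - ω * √s / c) / 2 with hα
    set β := (c * √s + ω * √s / c) / 2 with hβ
    have e1 : β ^ 2 - α ^ 2 = ω * √s ^ 2 := by rw [hα, hβ]; field_simp; ring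
    have e2 : c * (β - α) = ω * √s := by rw [hα, hβ]; field_simp; ring
    simp only [← Complex.normSq_eq_norm_sq, Complex.normSq_apply, Complex.add_re, Complex.add_im,
      Complex.mul_re, Complex.mul_im, Complex.ofReal_re, Complex.ofReal_im, zero_mul, sub_zero,
      add_zero]
    linear_combination (g.re ^ 2 + g.im ^ 2) * e1 + 2 * (z.re * g.re + z.im * g.im) * e2

/-- The product of a matrix and an array. -/
def mulArray {ι κ κ' : Type*} [Fintype κ] (A : Matrix ι κ ℂ) (X : κ → κ' → ℂ) : ι → κ' → ℂ :=
  fun i k => (A * Matrix.of X) i k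

@[fun_prop]
theorem measurable_mulArray {ι κ κ' : Type*} [Fintype κ] (A : Matrix ι κ ℂ) :
    Measurable (mulArray (κ' := κ') A) := by
  refine measurable_pi_lambda _ fun i => measurable_pi_lambda _ fun k => ?_
  simp only [mulArray, Matrix.mul_apply, Matrix.of_apply]
  fun_prop

@[fun_prop]
theorem measurable_energy_add_mul {ι κ κ' : Type*} [Fintype ι] [Fintype κ] [Fintype κ']
    (A : Matrix ι κ ℂ) : Measurable fun p : (κ → κ' → ℂ) × (ι → κ' → ℂ) =>
      energy (Matrix.of p.2 + A * Matrix.of p.1) := by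
  have h : Measurable fun p : (κ → κ' → ℂ) × (ι → κ' → ℂ) => p.2 + mulArray A p.1 :=
    measurable_snd.add ((measurable_mulArray A).comp measurable_fst)
  exact measurable_energy.comp h

theorem measurePreserving_unitary_mul {ι κ : Type*} [Fintype ι] [Fintype κ] [DecidableEq ι]
    {U : Matrix ι ι ℂ} (hU : Uᴴ * U = 1) :
    MeasurePreserving (mulArray (κ' := κ) U)
      (cGaussianArray ι κ 1) (cGaussianArray ι κ 1) :=
  measurePreserving_array_unitary hU

/-- The energy of `Z + A H` has the law of the energy of an array with independent rows. -/
theorem energy_add_mul_le {n m l : Type*} [Fintype n] [Fintype m] [Fintype l] [Nonempty n]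
    [Nonempty l] [DecidableEq n] [DecidableEq m] (e : n ↪ m) (A : Matrix n m ℂ) (x : ℝ) :
    ((cGaussianArray m l 1).prod (cGaussianArray n l 1))
        {p | energy (Matrix.of p.2 + A * Matrix.of p.1) ≤ x} ≤
      ENNReal.ofReal (gammaRatio (Fintype.card n * Fintype.card l)
        (x / (1 + A * Aᴴ).det.re ^ (1 / (Fintype.card n : ℝ)))) := by
  -- The decomposition is applied to `Aᴴ`, because here the rows embed into the columns.
  obtain ⟨U, V, s, hU, hV, hs, hA⟩ := exists_svd e Aᴴ
  have hdet := det_one_add_smul_of_svd hU hV hs hA 1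
  rw [one_smul, Matrix.conjTranspose_conjTranspose] at hdet
  simp only [one_mul] at hdet
  have hV' := mul_eq_one_comm.1 hV
  have hAU : A * U = V * (singularMatrix e s)ᴴ := by
    have h := congrArg Matrix.conjTranspose hA
    rw [Matrix.conjTranspose_mul, Matrix.conjTranspose_mul, Matrix.conjTranspose_conjTranspose] at h
    calc A * U = V * (Vᴴ * A) * U := by rw [← Matrix.mul_assoc V, hV', Matrix.one_mul]
      _ = V * (singularMatrix e s)ᴴ * (Uᴴ * U) := by rw [h]; simp only [Matrix.mul_assoc]
      _ = _ := by rw [hU, Matrix.mul_one]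
  have hpos : ∀ i, 0 < 1 + s i := fun i => by have := hs i; linarith
  have hmp := (measurePreserving_unitary_mul (κ := l) hU).prod
    (measurePreserving_unitary_mul (κ := l) hV)
  have hmeas : MeasurableSet {p : (m → l → ℂ) × (n → l → ℂ) |
      energy (Matrix.of p.2 + A * Matrix.of p.1) ≤ x} :=
    measurableSet_le (by fun_prop) measurable_const
  rw [← hmp.measure_preimage hmeas.nullMeasurableSet]
  -- After rotation, row `i` is `z + √(s i) g`, that is `√(1 + s i)` times a standard Gaussian row.
  -- The event is thus an ellipsoid with weights `1 + s i`, whose product is the determinant.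
  let a : n → ℝ := fun i => (√(1 + s i))⁻¹
  let b : n → ℝ := fun i => √(s i) * (√(1 + s i))⁻¹
  have hab : ∀ i, a i ^ 2 + b i ^ 2 = 1 := fun i => by
    simp only [a, b, mul_pow, inv_pow, Real.sq_sqrt (hpos i).le, Real.sq_sqrt (hs i)]
    have := (hpos i).ne'
    field_simp
  have hmp2 := (measurePreserving_array_pair (κ := l) hab).comp
    ((Measure.measurePreserving_swap (μ := cGaussianArray n l 1)
        (ν := cGaussianArray n l 1)).comp ((measurePreserving_array_rows (κ := l) 1
          e.injective).prod (MeasurePreserving.id (cGaussianArray n l 1))))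
  have hell := cGaussianArray_ellipsoid_le (κ := l) hpos x
  have hmeas2 : MeasurableSet {z : n → l → ℂ | ∑ i, (1 + s i) * ∑ k, ‖z i k‖ ^ 2 ≤ x} :=
    measurableSet_le (by fun_prop) measurable_const
  rw [← hmp2.measure_preimage hmeas2.nullMeasurableSet] at hell
  rw [hdet]
  refine le_trans (le_of_eq (congrArg _ ?_)) hell
  ext p
  simp only [Set.mem_preimage, Set.mem_ofPred_eq, Prod.map, Function.comp, Prod.swap, id]
  have h1 : (Matrix.of (mulArray V p.2) : Matrix n l ℂ) +
      A * Matrix.of (mulArray U p.1) =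
      V * (Matrix.of p.2 + (singularMatrix e s)ᴴ * Matrix.of p.1) := by
    change V * Matrix.of p.2 + A * (U * Matrix.of p.1) = _
    rw [← Matrix.mul_assoc, hAU, Matrix.mul_add, Matrix.mul_assoc]
  rw [h1, energy_unitary_mul hV, energy]
  refine Iff.of_eq (congrArg (· ≤ x) ?_)
  refine Finset.sum_congr rfl fun i _ => ?_
  rw [Finset.mul_sum]
  refine Finset.sum_congr rfl fun k _ => ?_
  have h2 : ((singularMatrix e s)ᴴ * Matrix.of p.1) i k = ((√(s i) : ℝ) : ℂ) * p.1 (e i) k := by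
    rw [Matrix.mul_apply, Finset.sum_eq_single (e i)]
    · simp [singularMatrix, Matrix.conjTranspose_apply]
    · intro j _ hj; simp [singularMatrix, Matrix.conjTranspose_apply, hj]
    · simp
  have h3 : ((a i : ℝ) : ℂ) * p.2 i k + ((b i : ℝ) : ℂ) * p.1 (e i) k =
      (((√(1 + s i))⁻¹ : ℝ) : ℂ) * (p.2 i k + ((√(s i) : ℝ) : ℂ) * p.1 (e i) k) := by
    simp only [a, b]; push_cast; ring
  rw [Matrix.add_apply, h2, h3, norm_mul, mul_pow, Complex.norm_real, Real.norm_eq_abs, sq_abs,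
    inv_pow, Real.sq_sqrt (hpos i).le, mul_inv_cancel_left₀ (hpos i).ne']
  rfl

/-- The probability of the bad region when there are fewer users in error than channel uses. -/
theorem badRegion_le {n m l : Type*} [Fintype n] [Fintype m] [Fintype l] [Nonempty n] [Nonempty m]
    [Nonempty l] [DecidableEq n] [DecidableEq m] (e : m ↪ n) (A : Matrix n m ℂ) {ω : ℝ}
    (hω : 0 < ω) (hω1 : ω ≤ 1) (x y c : ℝ) :
    ((cGaussianArray m l 1).prod (cGaussianArray n l 1))
        {p | ω * energy (Matrix.of p.2 + A * Matrix.of p.1) + c < energy (Matrix.of p.2)} ≤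
      ENNReal.ofReal (gammaRatio (Fintype.card m * Fintype.card l)
        ((x + (1 - ω) * y - c) / (1 + ω • (A * Aᴴ)).det.re ^ (1 / (Fintype.card m : ℝ)))) +
      ENNReal.ofReal (1 - gammaRatio (Fintype.card m * Fintype.card l) x) +
      ENNReal.ofReal (1 - gammaRatio (Fintype.card n * Fintype.card l) y) := by
  obtain ⟨U, V, s, hU, hV, hs, hA⟩ := exists_svd e A
  have hdet := det_one_add_smul_of_svd hU hV hs hA ω
  rw [← Matrix.smul_mul, Matrix.det_one_add_mul_comm, Matrix.mul_smul] at hdet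
  have hpos : ∀ i, 0 < 1 + ω * s i := fun i => by have := mul_nonneg hω.le (hs i); linarith
  have hmp := (measurePreserving_unitary_mul (κ := l) hV).prod
    (measurePreserving_unitary_mul (κ := l) hU)
  have hmeas : MeasurableSet {p : (m → l → ℂ) × (n → l → ℂ) |
      ω * energy (Matrix.of p.2 + A * Matrix.of p.1) + c < energy (Matrix.of p.2)} :=
    measurableSet_lt (by fun_prop) (measurable_energy.comp measurable_snd)
  rw [← hmp.measure_preimage hmeas.nullMeasurableSet, hdet]
  -- Each singular direction `j` pairs the fading row `j` with the noise row `e j`. The noise rows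
  -- outside the range of `e` carry no signal and drop out of the difference of energies.
  choose γ α β h1 h2 h3 using fun i => exists_energy_difference hω hω1 (hs i)
  let b : m → ℝ := fun i => β i * (√(1 + ω * s i))⁻¹
  let a : m → ℝ := fun i => γ i * (√(1 + ω * s i))⁻¹
  have hab : ∀ i, a i ^ 2 + b i ^ 2 = 1 := fun i => by
    simp only [a, b, mul_pow, inv_pow, Real.sq_sqrt (hpos i).le]
    rw [← add_mul, h2, mul_inv_cancel₀ (hpos i).ne']
  have hsel := (Measure.measurePreserving_swap (μ := cGaussianArray m l 1)
        (ν := cGaussianArray m l 1)).comp ((MeasurePreserving.id (cGaussianArray m l 1)).prod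
          (measurePreserving_array_rows (κ := l) 1 e.injective))
  have hmpa := (measurePreserving_array_pair (κ := l) h1).comp hsel
  have hmpb := (measurePreserving_array_pair (κ := l) hab).comp hsel
  have hell := cGaussianArray_ellipsoid_le (κ := l) hpos (x + (1 - ω) * y - c)
  have hmb : MeasurableSet {z : m → l → ℂ |
      ∑ i, (1 + ω * s i) * ∑ k, ‖z i k‖ ^ 2 ≤ x + (1 - ω) * y - c} :=
    measurableSet_le (by fun_prop) measurable_const
  have hena := cGaussianArray_energy_gt (ι := m) (κ := l) x
  have hma : MeasurableSet {z : m → l → ℂ | x < ∑ i, ∑ k, ‖z i k‖ ^ 2} :=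
    measurableSet_lt measurable_const (by fun_prop)
  have henz := cGaussianArray_energy_gt (ι := n) (κ := l) y
  have hmz : MeasurableSet {z : n → l → ℂ | y < ∑ i, ∑ k, ‖z i k‖ ^ 2} :=
    measurableSet_lt measurable_const (by fun_prop)
  have hsnd := measurePreserving_snd (μ := cGaussianArray m l 1) (ν := cGaussianArray n l 1)
  rw [← hmpb.measure_preimage hmb.nullMeasurableSet] at hell
  rw [← hmpa.measure_preimage hma.nullMeasurableSet] at hena
  rw [← hsnd.measure_preimage hmz.nullMeasurableSet] at henz
  rw [← hena, ← henz]
  -- The event reads `ω (‖Z‖² - ‖Z + A H‖²) + (1 - ω) ‖Z‖² > c`, and its first term is `X - Y` with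
  -- `X` of unit variances and `Y` of variances `1 + ω s j`. If `X ≤ x` and `‖Z‖² ≤ y`, then `Y < x
  -- + (1 - ω) y - c`, an ellipsoid event.
  refine le_trans (le_trans (measure_mono ?_) (measure_union_le _ _))
    (add_le_add (le_trans (measure_union_le _ _) (add_le_add hell le_rfl)) le_rfl)
  intro p hp
  simp only [Set.mem_preimage, Set.mem_ofPred_eq, Prod.map] at hp
  simp only [Set.mem_union, Set.mem_preimage, Set.mem_ofPred_eq, Prod.map, Function.comp, Prod.swap,
    id]
  have h4 : (Matrix.of (mulArray U p.2) : Matrix n l ℂ) +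
      A * Matrix.of (mulArray V p.1) =
      U * (Matrix.of p.2 + singularMatrix e s * Matrix.of p.1) := by
    change U * Matrix.of p.2 + A * (V * Matrix.of p.1) = _
    rw [← Matrix.mul_assoc, hA, Matrix.mul_add, Matrix.mul_assoc]
  have h5 : energy (Matrix.of (mulArray U p.2)) = energy (Matrix.of p.2) :=
    energy_unitary_mul hU _
  rw [h4, h5, energy_unitary_mul hU] at hp
  have h6 : ∀ j k, (singularMatrix e s * Matrix.of p.1) (e j) k =
      ((√(s j) : ℝ) : ℂ) * p.1 j k := by
    intro j k
    rw [Matrix.mul_apply, Finset.sum_eq_single j]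
    · simp [singularMatrix]
    · intro i _ hi; simp [singularMatrix, hi.symm]
    · simp
  have h7 : ∀ i k, i ∉ Set.range e → (singularMatrix e s * Matrix.of p.1) i k = 0 := by
    intro i k hi
    rw [Matrix.mul_apply]
    refine Finset.sum_eq_zero fun j _ => ?_
    have : i ≠ e j := fun h => hi ⟨j, h.symm⟩
    simp [singularMatrix, this]
  have h8 : ω * (energy (Matrix.of p.2) -
      energy (Matrix.of p.2 + singularMatrix e s * Matrix.of p.1)) =
      ∑ j, ∑ k, ‖(γ j : ℂ) * p.2 (e j) k + (α j : ℂ) * p.1 j k‖ ^ 2 -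
      ∑ j, ∑ k, ‖(γ j : ℂ) * p.2 (e j) k + (β j : ℂ) * p.1 j k‖ ^ 2 := by
    simp only [energy, ← Finset.sum_sub_distrib, Finset.mul_sum, Matrix.of_apply, Matrix.add_apply]
    rw [← Finset.sum_subset (Finset.subset_univ (Finset.univ.map e)), Finset.sum_map]
    · refine Finset.sum_congr rfl fun j _ => Finset.sum_congr rfl fun k _ => ?_
      rw [h6, h3]
    · intro i _ hi
      refine Finset.sum_eq_zero fun k _ => ?_
      rw [h7 i k (by simpa using hi)]
      simp
  have h9 : ∑ j, (1 + ω * s j) * ∑ k, ‖((a j : ℝ) : ℂ) * p.2 (e j) k +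
      ((b j : ℝ) : ℂ) * p.1 j k‖ ^ 2 =
      ∑ j, ∑ k, ‖(γ j : ℂ) * p.2 (e j) k + (β j : ℂ) * p.1 j k‖ ^ 2 := by
    refine Finset.sum_congr rfl fun j _ => ?_
    rw [Finset.mul_sum]
    refine Finset.sum_congr rfl fun k _ => ?_
    have : ((a j : ℝ) : ℂ) * p.2 (e j) k + ((b j : ℝ) : ℂ) * p.1 j k =
        (((√(1 + ω * s j))⁻¹ : ℝ) : ℂ) * ((γ j : ℂ) * p.2 (e j) k + (β j : ℂ) * p.1 j k) := by
      simp only [a, b]; push_cast; ring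
    rw [this, norm_mul, mul_pow, Complex.norm_real, Real.norm_eq_abs, sq_abs,
      inv_pow, Real.sq_sqrt (hpos j).le, mul_inv_cancel_left₀ (hpos j).ne']
  by_contra! hcon
  obtain ⟨⟨hc1, hc2⟩, hc3⟩ := hcon
  rw [h9] at hc1
  have h10 : energy (Matrix.of p.2) ≤ y := hc3
  have : (1 - ω) * energy (Matrix.of p.2) ≤ (1 - ω) * y :=
    mul_le_mul_of_nonneg_left h10 (by linarith)
  linarith

/-! ### Chernoff's bound for the pairwise error in the good region -/

theorem lintegral_arrays_prod {n m l : Type*} [Fintype n] [Fintype m] [Fintype l]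
    {g : (m → ℂ) → (n → ℂ) → ℝ≥0∞} (hg : Measurable (Function.uncurry g)) :
    ∫⁻ H, ∫⁻ Z, ∏ k : l, g (fun i => H i k) (fun i => Z i k) ∂(cGaussianArray n l 1)
        ∂(cGaussianArray m l 1) =
      (∫⁻ h, ∫⁻ z, g h z ∂(stdC n) ∂(stdC m)) ^ Fintype.card l := by
  have h1 : ∀ H : m → l → ℂ, ∫⁻ Z, ∏ k : l, g (fun i => H i k) (fun i => Z i k)
      ∂(cGaussianArray n l 1) = ∏ k, ∫⁻ z, g (fun i => H i k) z ∂(stdC n) := by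
    intro H
    have hm : ∀ k, Measurable fun z => g (fun i => H i k) z := fun k =>
      hg.comp (measurable_const.prodMk measurable_id)
    rw [← lintegral_fintype_prod _ hm]
    have hmp := measurePreserving_array_flip (ι := n) (κ := l) 1
    exact hmp.lintegral_comp (f := fun Z => ∏ k : l, g (fun i => H i k) (Z k))
      (Finset.measurable_prod _ fun k _ => (hm k).comp (measurable_pi_apply k))
  have hm : Measurable fun h => ∫⁻ z, g h z ∂(stdC n) := hg.lintegral_prod_right
  simp_rw [h1]
  have hmp := measurePreserving_array_flip (ι := m) (κ := l) 1
  refine (hmp.lintegral_comp (f := fun H => ∏ k : l, ∫⁻ z, g (H k) z ∂(stdC n))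
      (Finset.measurable_prod _ fun k _ => hm.comp (measurable_pi_apply k))).trans ?_
  rw [cGaussianArray, lintegral_fintype_prod _ fun _ : l => hm]
  simp

theorem matB_isHermitian {n K : ℕ} (ω u r : ℝ) (A₁ A₂ : Matrix (Fin n) (Fin K) ℂ) :
    (matB ω u r A₁ A₂).IsHermitian := by
  have h : ∀ (c : ℝ) (A : Matrix (Fin n) (Fin K) ℂ), (c • (Aᴴ * A)).IsHermitian := fun c A => by
    rw [Matrix.IsHermitian, Matrix.conjTranspose_smul, star_trivial,
      (Matrix.isHermitian_conjTranspose_mul_self A).eq]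
  exact (h _ _).sub (h _ _)

theorem posDef_one_add_of_spectrum {ι : Type*} [Fintype ι] [DecidableEq ι] {B : Matrix ι ι ℂ}
    (hB : B.IsHermitian) (h : ∀ x ∈ spectrum ℝ B, -1 < x) : (1 + B).PosDef := by
  have h1 : (1 + B).IsHermitian := Matrix.isHermitian_one.add hB
  rw [h1.posDef_iff_eigenvalues_pos]
  intro i
  have h2 := h1.eigenvalues_mem_spectrum_real i
  have h3 : h1.eigenvalues i - 1 ∈ spectrum ℝ B := by
    rw [← spectrum.add_mem_add_iff (s := (1 : ℝ)), map_one, sub_add_cancel]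
    exact h2
  have := h _ h3
  linarith

/-- The right side is minus the exponent left after the noise has been integrated out: two constant
terms and the square that completes the linear term. `matB` is therefore the quadratic form in the
fading vector for the second integration. -/
theorem quadForm_matB {n K : ℕ} {ω u r : ℝ} (ha : 1 + r * (1 - ω) ≠ 0) (hs : u - r * ω ≠ 0)
    (A₁ A₂ : Matrix (Fin n) (Fin K) ℂ) (h : Fin K → ℂ) :
    quadForm (matB ω u r A₁ A₂) h =
      ∑ i, (u * ‖(A₁ *ᵥ h) i - (A₂ *ᵥ h) i‖ ^ 2 - r * ω * ‖(A₁ *ᵥ h) i‖ ^ 2 -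
        (1 + r * (1 - ω))⁻¹ *
          ‖((u - r * ω : ℝ) : ℂ) * (A₁ *ᵥ h) i - (u : ℂ) * (A₂ *ᵥ h) i‖ ^ 2) := by
  rw [matB, quadForm_sub, quadForm_smul, quadForm_smul, quadForm_conjTranspose_mul_self,
    quadForm_conjTranspose_mul_self, Finset.mul_sum, Finset.mul_sum, ← Finset.sum_sub_distrib]
  refine Finset.sum_congr rfl fun i _ => ?_
  rw [Matrix.sub_mulVec, Matrix.smul_mulVec, Pi.sub_apply, Pi.smul_apply]
  generalize (A₁ *ᵥ h) i = x
  generalize (A₂ *ᵥ h) i = y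
  simp only [← Complex.normSq_eq_norm_sq, Complex.normSq_apply, Complex.sub_re, Complex.sub_im,
    Complex.mul_re, Complex.mul_im, Complex.ofReal_re, Complex.ofReal_im, zero_mul, sub_zero,
    add_zero, Complex.real_smul]
  field_simp
  ring

/-- The `u`-terms in `‖z‖²` cancel, so the exponent is quadratic in the noise with coefficient `-r
(1 - ω)`. The noise integral contributes `(1 + r (1 - ω))⁻ⁿ` and the Gaussian weight `exp (-hᴴ B̃
h)` in the fading, whose integral is `det (1 + B̃)⁻¹`. -/
theorem lintegral_chernoff_column {n K : ℕ} {ω u r : ℝ} (hω : ω ≤ 1) (hr : 0 ≤ r)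
    (hs : u ≠ r * ω) {A₁ A₂ : Matrix (Fin n) (Fin K) ℂ}
    (hB : (1 + matB ω u r A₁ A₂).PosDef) :
    ∫⁻ h, ∫⁻ z, ENNReal.ofReal (Real.exp (u * (∑ i, ‖z i‖ ^ 2 - ∑ i, ‖z i + ((A₁ *ᵥ h) i -
        (A₂ *ᵥ h) i)‖ ^ 2) + r * (ω * ∑ i, ‖z i + (A₁ *ᵥ h) i‖ ^ 2 - ∑ i, ‖z i‖ ^ 2)))
          ∂(stdC (Fin n)) ∂(stdC (Fin K)) =
      ENNReal.ofReal (((1 + r * (1 - ω)) ^ n * (1 + matB ω u r A₁ A₂).det.re)⁻¹) := by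
  have ha : 0 < 1 + r * (1 - ω) := by
    have := mul_nonneg hr (sub_nonneg.2 hω); linarith
  have hs' : u - r * ω ≠ 0 := sub_ne_zero.2 hs
  have hone : (1 : Matrix (Fin n) (Fin n) ℂ) + (r * (1 - ω)) • 1 = (1 + r * (1 - ω)) • 1 := by
    rw [add_smul, one_smul]
  have hM : ((1 : Matrix (Fin n) (Fin n) ℂ) + (r * (1 - ω)) • 1).PosDef := by
    rw [hone]; exact Matrix.PosDef.one.smul ha
  have hinner : ∀ h : Fin K → ℂ, ∫⁻ z, ENNReal.ofReal (Real.exp (u * (∑ i, ‖z i‖ ^ 2 -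
      ∑ i, ‖z i + ((A₁ *ᵥ h) i - (A₂ *ᵥ h) i)‖ ^ 2) + r * (ω * ∑ i, ‖z i + (A₁ *ᵥ h) i‖ ^ 2 -
      ∑ i, ‖z i‖ ^ 2))) ∂(stdC (Fin n)) =
      ENNReal.ofReal (((1 + r * (1 - ω)) ^ n)⁻¹) *
        ENNReal.ofReal (Real.exp (-quadForm (matB ω u r A₁ A₂) h)) := by
    intro h
    -- The coefficient of the term linear in `z`: `-u (A₁ h - A₂ h)` from the confusion event plus
    -- `r ω A₁ h` from the good region.
    set b : Fin n → ℂ := fun i => -(((u - r * ω : ℝ) : ℂ) * (A₁ *ᵥ h) i - (u : ℂ) * (A₂ *ᵥ h) i)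
      with hb
    have hc : ∀ z : Fin n → ℂ, u * (∑ i, ‖z i‖ ^ 2 -
        ∑ i, ‖z i + ((A₁ *ᵥ h) i - (A₂ *ᵥ h) i)‖ ^ 2) + r * (ω * ∑ i, ‖z i + (A₁ *ᵥ h) i‖ ^ 2 -
        ∑ i, ‖z i‖ ^ 2) =
        (∑ i, (r * ω * ‖(A₁ *ᵥ h) i‖ ^ 2 - u * ‖(A₁ *ᵥ h) i - (A₂ *ᵥ h) i‖ ^ 2)) +
        (-quadForm ((r * (1 - ω)) • (1 : Matrix (Fin n) (Fin n) ℂ)) z + 2 * (star b ⬝ᵥ z).re) := by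
      intro z
      rw [quadForm_smul, quadForm_one, dotProduct, Complex.re_sum]
      simp only [Finset.mul_sum, ← Finset.sum_sub_distrib, ← Finset.sum_add_distrib,
        ← Finset.sum_neg_distrib, Pi.star_apply, hb]
      refine Finset.sum_congr rfl fun i _ => ?_
      generalize (A₁ *ᵥ h) i = x
      generalize (A₂ *ᵥ h) i = y
      generalize z i = w
      simp only [← Complex.normSq_eq_norm_sq, Complex.normSq_apply, Complex.sub_re, Complex.sub_im,
        Complex.mul_re, Complex.mul_im, Complex.ofReal_re, Complex.ofReal_im, zero_mul, sub_zero,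
        add_zero, Complex.add_re, Complex.add_im, Complex.star_def, Complex.conj_re,
        Complex.conj_im, Complex.neg_re, Complex.neg_im]
      ring
    have hdm : Measurable fun z : Fin n → ℂ => (star b ⬝ᵥ z).re := by
      unfold dotProduct; fun_prop
    simp_rw [hc, Real.exp_add (∑ i, (r * ω * ‖(A₁ *ᵥ h) i‖ ^ 2 -
      u * ‖(A₁ *ᵥ h) i - (A₂ *ᵥ h) i‖ ^ 2)), ENNReal.ofReal_mul (Real.exp_nonneg _)]
    rw [lintegral_const_mul _ (by fun_prop), lintegral_stdC_exp_quadForm hM,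
      ← ENNReal.ofReal_mul (Real.exp_nonneg _), ← ENNReal.ofReal_mul (by positivity), hone]
    have hdet : (((1 + r * (1 - ω)) • (1 : Matrix (Fin n) (Fin n) ℂ)).det).re =
        (1 + r * (1 - ω)) ^ n := by
      have : (1 + r * (1 - ω)) • (1 : Matrix (Fin n) (Fin n) ℂ) =
          ((1 + r * (1 - ω) : ℝ) : ℂ) • 1 := by
        ext i j; simp
      rw [this, Matrix.det_smul, Matrix.det_one, mul_one, Fintype.card_fin, ← Complex.ofReal_pow,
        Complex.ofReal_re]
    have hinv : ((1 + r * (1 - ω)) • (1 : Matrix (Fin n) (Fin n) ℂ))⁻¹ =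
        (1 + r * (1 - ω))⁻¹ • 1 := by
      refine Matrix.inv_eq_right_inv ?_
      rw [Matrix.smul_mul, Matrix.one_mul, smul_smul, mul_inv_cancel₀ ha.ne', one_smul]
    rw [hdet, hinv, quadForm_smul, quadForm_one, quadForm_matB ha.ne' hs', div_eq_mul_inv,
      ← mul_assoc, ← Real.exp_add, mul_comm (Real.exp _)]
    congr 3
    rw [Finset.mul_sum, ← Finset.sum_add_distrib, ← Finset.sum_neg_distrib]
    refine Finset.sum_congr rfl fun i _ => ?_
    rw [hb, norm_neg]
    ring
  simp_rw [hinner]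
  rw [lintegral_const_mul _ (by fun_prop), lintegral_stdC_exp_neg_quadForm hB,
    ← ENNReal.ofReal_mul (by positivity), mul_inv]

theorem energy_of_columns {ι κ : Type*} [Fintype ι] [Fintype κ] (X : Matrix ι κ ℂ) :
    energy X = ∑ k, ∑ i, ‖X i k‖ ^ 2 := Finset.sum_comm

/-- Both inequalities of the event have nonnegative slack; multiplied by `u` and `r`, added and
exponentiated, they give a function that is at least `1` on the event. Its expectation is a product
over the antennas, hence an `L`-th power. -/
theorem goodRegion_le_chernoffMin {n K : ℕ} (L : ℕ) {ω : ℝ} (hω : ω ≤ 1) (ν : ℝ)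
    (A₁ A₂ : Matrix (Fin n) (Fin K) ℂ) :
    ((cGaussianArray (Fin K) (Fin L) 1).prod (cGaussianArray (Fin n) (Fin L) 1))
        {p | energy (Matrix.of p.2 + (A₁ - A₂) * Matrix.of p.1) ≤ energy (Matrix.of p.2) ∧
          energy (Matrix.of p.2) ≤ ω * energy (Matrix.of p.2 + A₁ * Matrix.of p.1) + n * L * ν} ≤
      chernoffMin L ω ν A₁ A₂ := by
  refine le_iInf fun u => le_iInf fun r => le_iInf fun ⟨hu, hr, hs, hspec⟩ => ?_
  have hB := posDef_one_add_of_spectrum (matB_isHermitian ω u r A₁ A₂) hspec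
  have ha : 0 < 1 + r * (1 - ω) := by
    have := mul_nonneg hr (sub_nonneg.2 hω); linarith
  have hdet := hB.det_re_pos.1
  let g : (Fin K → ℂ) → (Fin n → ℂ) → ℝ≥0∞ := fun h z =>
    ENNReal.ofReal (Real.exp (u * (∑ i, ‖z i‖ ^ 2 - ∑ i, ‖z i + ((A₁ *ᵥ h) i -
        (A₂ *ᵥ h) i)‖ ^ 2) + r * (ω * ∑ i, ‖z i + (A₁ *ᵥ h) i‖ ^ 2 - ∑ i, ‖z i‖ ^ 2)))
  have hg : Measurable (Function.uncurry g) := by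
    have h1 : ∀ (A : Matrix (Fin n) (Fin K) ℂ) i, Measurable fun p : (Fin K → ℂ) × (Fin n → ℂ) =>
        (A *ᵥ p.1) i := fun A i => by
      unfold Matrix.mulVec dotProduct; fun_prop
    have h2 := h1 A₁
    have h3 := h1 A₂
    simp only [g, Function.uncurry_def]
    fun_prop
  let f : (Fin K → Fin L → ℂ) × (Fin n → Fin L → ℂ) → ℝ≥0∞ := fun p =>
    ENNReal.ofReal (Real.exp (r * (n * L * ν))) * ∏ k : Fin L, g (fun i => p.1 i k) fun i => p.2 i k
  have hgm : Measurable fun p : (Fin K → Fin L → ℂ) × (Fin n → Fin L → ℂ) =>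
      ∏ k : Fin L, g (fun i => p.1 i k) fun i => p.2 i k :=
    Finset.measurable_prod _ fun k _ => hg.comp (f := fun p : (Fin K → Fin L → ℂ) ×
      (Fin n → Fin L → ℂ) => ((fun i => p.1 i k : Fin K → ℂ), (fun i => p.2 i k : Fin n → ℂ)))
      (by fun_prop)
  have hf : Measurable f := hgm.const_mul _
  have hprod : ∀ p, f p = ENNReal.ofReal (Real.exp (
      u * (energy (Matrix.of p.2) - energy (Matrix.of p.2 + (A₁ - A₂) * Matrix.of p.1)) +
      r * (ω * energy (Matrix.of p.2 + A₁ * Matrix.of p.1) + n * L * ν -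
        energy (Matrix.of p.2)))) := by
    intro p
    simp only [f, g]
    rw [← ENNReal.ofReal_prod_of_nonneg fun i _ => Real.exp_nonneg _, ← Real.exp_sum,
      ← ENNReal.ofReal_mul (Real.exp_nonneg _), ← Real.exp_add]
    congr 2
    simp only [energy_of_columns]
    rw [Finset.sum_add_distrib, ← Finset.mul_sum, ← Finset.mul_sum, Finset.sum_sub_distrib,
      Finset.sum_sub_distrib, ← Finset.mul_sum]
    have e1 : ∀ i k, (Matrix.of p.2 + (A₁ - A₂) * Matrix.of p.1) i k =
        p.2 i k + ((A₁ *ᵥ fun j => p.1 j k) i - (A₂ *ᵥ fun j => p.1 j k) i) := fun i k => by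
      rw [Matrix.add_apply, Matrix.sub_mul]; rfl
    have e2 : ∀ i k, (Matrix.of p.2 + A₁ * Matrix.of p.1) i k =
        p.2 i k + (A₁ *ᵥ fun j => p.1 j k) i := fun i k => rfl
    simp only [e1, e2, Matrix.of_apply]
    ring
  calc _ ≤ ∫⁻ p, f p ∂((cGaussianArray (Fin K) (Fin L) 1).prod
        (cGaussianArray (Fin n) (Fin L) 1)) := by
        refine (measure_mono ?_).trans (meas_ge_le_lintegral_div hf.aemeasurable
          one_ne_zero ENNReal.one_ne_top |>.trans (by rw [div_one]))
        intro p hp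
        change 1 ≤ f p
        rw [hprod, ENNReal.one_le_ofReal, Real.one_le_exp_iff]
        exact add_nonneg (mul_nonneg hu (sub_nonneg.2 hp.1)) (mul_nonneg hr (sub_nonneg.2 hp.2))
    _ = ENNReal.ofReal (Real.exp (r * (n * L * ν))) * ENNReal.ofReal
          (((1 + r * (1 - ω)) ^ n * (1 + matB ω u r A₁ A₂).det.re)⁻¹) ^ L := by
        rw [lintegral_const_mul _ hgm, lintegral_prod _ hgm.aemeasurable,
          lintegral_arrays_prod hg, lintegral_chernoff_column hω hr hs hB, Fintype.card_fin]
    _ = _ := by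
        rw [← ENNReal.ofReal_pow (by positivity), ← ENNReal.ofReal_mul (Real.exp_nonneg _)]
        congr 1
        rw [← Real.exp_log (show 0 < ((1 + r * (1 - ω)) ^ n *
          (1 + matB ω u r A₁ A₂).det.re)⁻¹ by positivity), ← Real.exp_nat_mul, ← Real.exp_add,
          Real.log_inv, Real.log_mul (by positivity) hdet.ne', Real.log_pow]
        congr 1
        ring

/-! ### Gaussian integrals for Gallager's bound -/

section Gallager

variable {l m m' : Type*} [Fintype l] [Fintype m] [Fintype m'] [DecidableEq l]

theorem posDef_one_add_smul_mul_conjTranspose (T : Matrix l m ℂ) {β : ℝ} (hβ : 0 ≤ β) :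
    (1 + β • (T * Tᴴ)).PosDef :=
  Matrix.PosDef.one.add_posSemidef ((Matrix.posSemidef_self_mul_conjTranspose T).smul hβ)

/-- This is the determinant that `lintegral_exp_joint` produces for `c = 1 - ρ β` and `Q = ρ β (1 +
β T₂ T₂ᴴ)⁻¹`. It factors because `(1 + β T₂ T₂ᴴ)⁻¹` can be pulled out on the left. -/
theorem det_gallager (T₁ : Matrix l m ℂ) (T₂ : Matrix l m' ℂ) {ρ β : ℝ}
    (hρ : 0 ≤ ρ) (hβ : 0 ≤ β) (hρβ : ρ * β < 1) :
    0 < (1 + (β * (1 - ρ * β)) • (ρ • (T₁ * T₁ᴴ) + T₂ * T₂ᴴ)).det.re ∧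
    ((1 - ρ * β) • (1 : Matrix l l ℂ) + (ρ * β) • (1 + β • (T₂ * T₂ᴴ))⁻¹ +
      (1 - ρ * β) • (((ρ * β) • (1 + β • (T₂ * T₂ᴴ))⁻¹) * (T₁ * T₁ᴴ))).det.re =
      (1 + β • (T₂ * T₂ᴴ)).det.re⁻¹ *
        (1 + (β * (1 - ρ * β)) • (ρ • (T₁ * T₁ᴴ) + T₂ * T₂ᴴ)).det.re := by
  have hP := posDef_one_add_smul_mul_conjTranspose T₂ hβ
  have hd := hP.det_re_pos
  have hu := (Matrix.isUnit_iff_isUnit_det _).1 hP.isUnit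
  have hc : 0 < 1 - ρ * β := by linarith
  have hR : (1 + (β * (1 - ρ * β)) • (ρ • (T₁ * T₁ᴴ) + T₂ * T₂ᴴ)).PosDef :=
    Matrix.PosDef.one.add_posSemidef ((((Matrix.posSemidef_self_mul_conjTranspose T₁).smul hρ).add
      (Matrix.posSemidef_self_mul_conjTranspose T₂)).smul (mul_nonneg hβ hc.le))
  have hRd := hR.det_re_pos
  refine ⟨hRd.1, ?_⟩
  have hkey : (1 - ρ * β) • (1 : Matrix l l ℂ) + (ρ * β) • (1 + β • (T₂ * T₂ᴴ))⁻¹ +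
      (1 - ρ * β) • (((ρ * β) • (1 + β • (T₂ * T₂ᴴ))⁻¹) * (T₁ * T₁ᴴ)) =
      (1 + β • (T₂ * T₂ᴴ))⁻¹ * (1 + (β * (1 - ρ * β)) • (ρ • (T₁ * T₁ᴴ) + T₂ * T₂ᴴ)) := by
    have h3 : (1 : Matrix l l ℂ) + (β * (1 - ρ * β)) • (ρ • (T₁ * T₁ᴴ) + T₂ * T₂ᴴ) =
        (1 - ρ * β) • (1 + β • (T₂ * T₂ᴴ)) + (ρ * β) • 1 +
          ((1 - ρ * β) * (ρ * β)) • (T₁ * T₁ᴴ) := by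
      generalize T₁ * T₁ᴴ = X
      generalize T₂ * T₂ᴴ = Y
      module
    rw [h3, Matrix.mul_add, Matrix.mul_add, Matrix.mul_smul, Matrix.mul_smul, Matrix.mul_smul,
      Matrix.nonsing_inv_mul _ hu, Matrix.mul_one, Matrix.smul_mul, smul_smul]
  rw [hkey, Matrix.det_mul, Matrix.det_nonsing_inv, Ring.inverse_eq_inv', ← hd.2, ← hRd.2,
    ← Complex.ofReal_inv, ← Complex.ofReal_mul, Complex.ofReal_re, Complex.ofReal_re,
    Complex.ofReal_re]

variable [DecidableEq m]

/-- Woodbury's identity, from the push-through relation `(1 + β T Tᴴ) T = T (1 + β Tᴴ T)`. -/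
theorem inv_one_add_smul_mul_conjTranspose (T : Matrix l m ℂ) {β : ℝ} (hβ : 0 ≤ β) :
    (1 + β • (T * Tᴴ))⁻¹ = 1 - β • (T * (1 + β • (Tᴴ * T))⁻¹ * Tᴴ) := by
  have hM : (1 + β • (Tᴴ * T)).PosDef := by
    simpa using posDef_one_add_smul_mul_conjTranspose Tᴴ hβ
  have hu := (Matrix.isUnit_iff_isUnit_det _).1 hM.isUnit
  refine Matrix.inv_eq_right_inv ?_
  have h : (1 + β • (T * Tᴴ)) * T = T * (1 + β • (Tᴴ * T)) := by
    rw [Matrix.add_mul, Matrix.mul_add, Matrix.one_mul, Matrix.mul_one, Matrix.smul_mul,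
      Matrix.mul_smul, Matrix.mul_assoc]
  rw [Matrix.mul_sub, Matrix.mul_one, Matrix.mul_smul, ← Matrix.mul_assoc, ← Matrix.mul_assoc, h,
    Matrix.mul_assoc T, Matrix.mul_nonsing_inv _ hu, Matrix.mul_one]
  abel

/-- The average over one row of a false codeword. Completing the square in `a` gives the inverse and
the determinant of `1 + β Tᴴ T`; Woodbury's and Sylvester's identities transfer both to the antenna
side. -/
theorem lintegral_exp_neg_dist_sq (T : Matrix l m ℂ) {β : ℝ} (hβ : 0 ≤ β) (y : l → ℂ) :
    ∫⁻ a, ENNReal.ofReal (Real.exp (-(β * ∑ k, ‖y k - (T *ᵥ a) k‖ ^ 2))) ∂(stdC m) =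
      ENNReal.ofReal (Real.exp (-(β * quadForm (1 + β • (T * Tᴴ))⁻¹ y)) /
        (1 + β • (T * Tᴴ)).det.re) := by
  have hM : (1 + β • (Tᴴ * T)).PosDef := by
    simpa using posDef_one_add_smul_mul_conjTranspose Tᴴ hβ
  set b : m → ℂ := (β : ℂ) • (Tᴴ *ᵥ y) with hb
  have hc : ∀ a : m → ℂ, -(β * ∑ k, ‖y k - (T *ᵥ a) k‖ ^ 2) = -(β * quadForm 1 y) +
      (-quadForm (β • (Tᴴ * T)) a + 2 * (star b ⬝ᵥ a).re) := by
    intro a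
    have h1 : star b ⬝ᵥ a = (β : ℂ) * (star y ⬝ᵥ (T *ᵥ a)) := by
      rw [hb, star_smul, smul_dotProduct, Matrix.star_mulVec, Matrix.conjTranspose_conjTranspose,
        ← Matrix.dotProduct_mulVec, Complex.star_def, Complex.conj_ofReal, smul_eq_mul]
    rw [h1, quadForm_smul, quadForm_conjTranspose_mul_self, quadForm_one, dotProduct,
      Complex.re_ofReal_mul, Complex.re_sum]
    simp only [Finset.mul_sum, ← Finset.sum_add_distrib,
        ← Finset.sum_neg_distrib, Pi.star_apply]
    refine Finset.sum_congr rfl fun i _ => ?_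
    generalize (T *ᵥ a) i = x
    generalize y i = w
    simp only [← Complex.normSq_eq_norm_sq, Complex.normSq_apply, Complex.sub_re, Complex.sub_im,
        Complex.mul_re, Complex.star_def, Complex.conj_re, Complex.conj_im]
    ring
  have hdm : Measurable fun z : m → ℂ => (star b ⬝ᵥ z).re := by
    unfold dotProduct; fun_prop
  simp_rw [hc, Real.exp_add (-(β * quadForm 1 y)), ENNReal.ofReal_mul (Real.exp_nonneg _)]
  rw [lintegral_const_mul _ (by fun_prop), lintegral_stdC_exp_quadForm hM,
    ← ENNReal.ofReal_mul (Real.exp_nonneg _), ← mul_div_assoc, ← Real.exp_add]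
  have hdet : (1 + β • (Tᴴ * T)).det = (1 + β • (T * Tᴴ)).det := by
    rw [← Matrix.smul_mul, Matrix.det_one_add_mul_comm, Matrix.mul_smul]
  have hq : quadForm (1 + β • (Tᴴ * T))⁻¹ b =
      β ^ 2 * quadForm (T * (1 + β • (Tᴴ * T))⁻¹ * Tᴴ) y := by
    have h2 := quadForm_conjTranspose_mul_mul (1 + β • (Tᴴ * T))⁻¹ Tᴴ y
    rw [Matrix.conjTranspose_conjTranspose] at h2
    rw [h2, hb]
    simp only [quadForm, Matrix.mulVec_smul, star_smul, smul_dotProduct, dotProduct_smul,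
      smul_eq_mul, Complex.star_def, Complex.conj_ofReal, Complex.re_ofReal_mul]
    ring
  rw [hdet, inv_one_add_smul_mul_conjTranspose T hβ, quadForm_sub, quadForm_smul, hq]
  congr 3
  ring

/-- The pair `(z, a)` is one Gaussian vector `x` on `l ⊕ m`, with `z + T a = V x` for `V = [1 T]`.
Together with the density the exponent is `-xᴴ (D + Vᴴ Q V) x` with `D = diag(c, 1)`, positive
definite because `c > 0`, and Sylvester's identity reduces the determinant to size `l`. -/
theorem lintegral_exp_joint (T : Matrix l m ℂ) {c : ℝ} (hc : 0 < c) {Q : Matrix l l ℂ}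
    (hQ : Q.PosSemidef) :
    ∫⁻ z, ∫⁻ a, ENNReal.ofReal (Real.exp ((1 - c) * ∑ k, ‖z k‖ ^ 2 -
        quadForm Q (fun k => z k + (T *ᵥ a) k))) ∂(stdC m) ∂(stdC l) =
      ENNReal.ofReal ((c • (1 : Matrix l l ℂ) + Q + c • (Q * (T * Tᴴ))).det.re)⁻¹ := by
  let V : Matrix l (l ⊕ m) ℂ := Matrix.fromCols 1 T
  let D : Matrix (l ⊕ m) (l ⊕ m) ℂ := Matrix.fromBlocks (c • 1) 0 0 1
  let D' : Matrix (l ⊕ m) (l ⊕ m) ℂ := Matrix.fromBlocks (c⁻¹ • 1) 0 0 1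
  have hDdiag : D = Matrix.diagonal (Sum.elim (fun _ => (c : ℂ)) fun _ => 1) := by
    rw [← Matrix.fromBlocks_diagonal]
    simp only [D]
    congr 1
    ext i j; by_cases h : i = j <;> simp [h]
  have hDpos : D.PosDef := by
    rw [hDdiag]
    refine Matrix.PosDef.diagonal fun i => ?_
    cases i
    · simpa using hc
    · simp
  have hDD : D * D' = 1 := by
    simp only [D, D', Matrix.fromBlocks_multiply, Matrix.smul_mul, Matrix.one_mul, Matrix.mul_zero,
      Matrix.zero_mul, add_zero, zero_add, smul_smul, mul_inv_cancel₀ hc.ne', one_smul]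
    exact Matrix.fromBlocks_one
  have hpos : (D + Vᴴ * Q * V).PosDef := hDpos.add_posSemidef (hQ.conjTranspose_mul_mul_same V)
  have hM : (1 + (D + Vᴴ * Q * V - 1)).PosDef := by rwa [add_sub_cancel]
  have hVDV : V * D' * Vᴴ = c⁻¹ • 1 + T * Tᴴ := by
    simp only [V, D', Matrix.conjTranspose_fromCols_eq_fromRows_conjTranspose,
      Matrix.fromCols_mul_fromBlocks, Matrix.fromCols_mul_fromRows]
    simp
  have hdet : (D + Vᴴ * Q * V).det = (c • (1 : Matrix l l ℂ) + Q + c • (Q * (T * Tᴴ))).det := by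
    have h1 : D + Vᴴ * Q * V = D * (1 + (D' * Vᴴ) * (Q * V)) := by
      rw [Matrix.mul_add, Matrix.mul_one, ← Matrix.mul_assoc D, ← Matrix.mul_assoc D, hDD,
        Matrix.one_mul, Matrix.mul_assoc]
    have h2 : D.det = (c : ℂ) ^ Fintype.card l := by
      rw [hDdiag, Matrix.det_diagonal]; simp
    have h3 : (Q * V) * (D' * Vᴴ) = Q * (c⁻¹ • 1 + T * Tᴴ) := by
      rw [← hVDV]; simp only [Matrix.mul_assoc]
    rw [h1, Matrix.det_mul, Matrix.det_one_add_mul_comm, h2, h3, ← Matrix.det_smul]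
    congr 1
    have h4 : ∀ X : Matrix l l ℂ, (c : ℂ) • X = c • X := fun X => by ext i j; simp
    rw [h4, Matrix.mul_add, Matrix.mul_smul, Matrix.mul_one, smul_add, smul_add, smul_smul,
      mul_inv_cancel₀ hc.ne', one_smul, add_assoc]
  have hmp := (measurePreserving_sumPiEquivProdPi (fun _ : l ⊕ m => cGaussian 1))
  have hTm : ∀ k, Measurable fun p : (l → ℂ) × (m → ℂ) => (T *ᵥ p.2) k := fun k => by
    unfold Matrix.mulVec dotProduct; fun_prop
  have hmeas : Measurable fun p : (l → ℂ) × (m → ℂ) => ENNReal.ofReal (Real.exp ((1 - c) *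
      ∑ k, ‖p.1 k‖ ^ 2 - quadForm Q (fun k => p.1 k + (T *ᵥ p.2) k))) := by
    have : Measurable fun p : (l → ℂ) × (m → ℂ) => quadForm Q fun k => p.1 k + (T *ᵥ p.2) k :=
      (measurable_quadForm Q).comp (by fun_prop)
    fun_prop
  rw [← lintegral_prod _ hmeas.aemeasurable, ← hmp.lintegral_comp hmeas, ← hdet]
  have h := lintegral_stdC_exp_neg_quadForm hM
  rw [add_sub_cancel] at h
  rw [← h]
  refine lintegral_congr fun x => ?_
  congr 2
  have hVx : V *ᵥ x = fun k => x (Sum.inl k) + (T *ᵥ fun j => x (Sum.inr j)) k := by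
    simp only [V]
    rw [Matrix.fromCols_mulVec, Matrix.one_mulVec]
    rfl
  have hDx : quadForm D x = c * ∑ k, ‖x (Sum.inl k)‖ ^ 2 + ∑ j, ‖x (Sum.inr j)‖ ^ 2 := by
    rw [hDdiag]
    simp only [quadForm, dotProduct, Matrix.mulVec_diagonal, Fintype.sum_sum_type,
      Finset.mul_sum, Complex.add_re, Complex.re_sum]
    congr 1 <;> refine Finset.sum_congr rfl fun i _ => ?_ <;>
      simp only [← Complex.normSq_eq_norm_sq, Complex.normSq_apply, Complex.mul_re, Complex.mul_im,
        Sum.elim_inl, Sum.elim_inr, Pi.star_apply, Complex.star_def, Complex.conj_re,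
        Complex.conj_im, Complex.ofReal_re, Complex.ofReal_im, Complex.one_re, Complex.one_im] <;>
      ring
  rw [quadForm_sub, quadForm_add, quadForm_conjTranspose_mul_mul, hVx, hDx, quadForm_one,
    Fintype.sum_sum_type]
  simp only [MeasurableEquiv.sumPiEquivProdPi, MeasurableEquiv.coe_mk, Equiv.sumPiEquivProdPi,
    Equiv.coe_fn_mk]
  ring

/-- One channel use. The average over the false codeword, raised to the power `ρ`, is again the
exponential of a quadratic form, with factor `det N ^ (-ρ)`. The joint integral over noise and sent
codeword, controlled by `ρ β < 1`, supplies another `det N`, whence the exponent `1 - ρ`. -/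
theorem lintegral_gallager_row [DecidableEq m'] (T₁ : Matrix l m ℂ) (T₂ : Matrix l m' ℂ) {ρ β : ℝ}
    (hρ : 0 ≤ ρ) (hβ : 0 ≤ β) (hρβ : ρ * β < 1) :
    ∫⁻ z, ∫⁻ a, (ENNReal.ofReal (Real.exp (β * ∑ k, ‖z k‖ ^ 2)) *
        ∫⁻ a', ENNReal.ofReal (Real.exp (-(β * ∑ k, ‖z k + (T₁ *ᵥ a) k - (T₂ *ᵥ a') k‖ ^ 2)))
          ∂(stdC m')) ^ ρ ∂(stdC m) ∂(stdC l) =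
      ENNReal.ofReal (Real.exp ((1 - ρ) * Real.log (1 + β • (T₂ * T₂ᴴ)).det.re -
        Real.log (1 + (β * (1 - ρ * β)) • (ρ • (T₁ * T₁ᴴ) + T₂ * T₂ᴴ)).det.re)) := by
  have hP := posDef_one_add_smul_mul_conjTranspose T₂ hβ
  obtain ⟨N, hN⟩ : ∃ N, N = 1 + β • (T₂ * T₂ᴴ) := ⟨_, rfl⟩
  obtain ⟨hRd, hdet⟩ := det_gallager T₁ T₂ hρ hβ hρβ
  rw [← hN] at hP hdet ⊢
  have hd := hP.det_re_pos
  have hd1 := hd.1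
  have hc : 0 < 1 - ρ * β := by linarith
  have hQ : ((ρ * β) • N⁻¹).PosSemidef := hP.inv.posSemidef.smul (mul_nonneg hρ hβ)
  have h1 : ∀ (z : l → ℂ) (a : m → ℂ), (ENNReal.ofReal (Real.exp (β * ∑ k, ‖z k‖ ^ 2)) *
        ∫⁻ a', ENNReal.ofReal (Real.exp (-(β * ∑ k, ‖z k + (T₁ *ᵥ a) k - (T₂ *ᵥ a') k‖ ^ 2)))
          ∂(stdC m')) ^ ρ = ENNReal.ofReal (N.det.re ^ (-ρ)) *
        ENNReal.ofReal (Real.exp ((1 - (1 - ρ * β)) * ∑ k, ‖z k‖ ^ 2 -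
          quadForm ((ρ * β) • N⁻¹) (fun k => z k + (T₁ *ᵥ a) k))) := by
    intro z a
    rw [lintegral_exp_neg_dist_sq T₂ hβ (fun k => z k + (T₁ *ᵥ a) k), ← hN,
      ← ENNReal.ofReal_mul (Real.exp_nonneg _), ← mul_div_assoc, ← Real.exp_add,
      ENNReal.ofReal_rpow_of_nonneg (by positivity) hρ,
      Real.div_rpow (Real.exp_nonneg _) hd.1.le, ← Real.exp_mul, Real.rpow_neg hd.1.le,
      ← ENNReal.ofReal_mul (by positivity), quadForm_smul, div_eq_inv_mul]
    congr 3
    ring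
  simp_rw [h1]
  have hmeas : Measurable fun p : (l → ℂ) × (m → ℂ) => ENNReal.ofReal (Real.exp
      ((1 - (1 - ρ * β)) * ∑ k, ‖p.1 k‖ ^ 2 -
        quadForm ((ρ * β) • N⁻¹) (fun k => p.1 k + (T₁ *ᵥ p.2) k))) := by
    have hTm : ∀ k, Measurable fun p : (l → ℂ) × (m → ℂ) => (T₁ *ᵥ p.2) k := fun k => by
      unfold Matrix.mulVec dotProduct; fun_prop
    have : Measurable fun p : (l → ℂ) × (m → ℂ) =>
        quadForm ((ρ * β) • N⁻¹) fun k => p.1 k + (T₁ *ᵥ p.2) k :=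
      (measurable_quadForm _).comp (by fun_prop)
    fun_prop
  have h2 : ∀ z : l → ℂ, ∫⁻ a, ENNReal.ofReal (N.det.re ^ (-ρ)) *
        ENNReal.ofReal (Real.exp ((1 - (1 - ρ * β)) * ∑ k, ‖z k‖ ^ 2 -
          quadForm ((ρ * β) • N⁻¹) (fun k => z k + (T₁ *ᵥ a) k))) ∂(stdC m) =
      ENNReal.ofReal (N.det.re ^ (-ρ)) * ∫⁻ a,
        ENNReal.ofReal (Real.exp ((1 - (1 - ρ * β)) * ∑ k, ‖z k‖ ^ 2 -
          quadForm ((ρ * β) • N⁻¹) (fun k => z k + (T₁ *ᵥ a) k))) ∂(stdC m) := fun z => by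
    have h3 := hmeas.comp (measurable_prodMk_left (x := z))
    exact lintegral_const_mul _ h3
  simp_rw [h2]
  rw [lintegral_const_mul _ hmeas.lintegral_prod_right', lintegral_exp_joint T₁ hc hQ]
  rw [hdet, ← ENNReal.ofReal_mul (by positivity)]
  congr 1
  rw [Real.exp_sub, Real.exp_log hRd, mul_comm (1 - ρ), ← Real.rpow_def_of_pos hd.1, mul_inv,
    inv_inv, ← mul_assoc, ← Real.rpow_add_one hd.1.ne', div_eq_mul_inv]
  congr 2
  ring

end Gallager

/-! ### Gallager's union bound -/

/-- A number in `[0, 1]` is at most its `ρ`-th power, and the union bound is then applied inside the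
power. -/
theorem measure_biUnion_le_rpow {α ι : Type*} [MeasurableSpace α] (μ : Measure α)
    [IsProbabilityMeasure μ] (s : Finset ι) (E : ι → Set α) {c : ℝ≥0∞} (hE : ∀ i ∈ s, μ (E i) ≤ c)
    {ρ : ℝ} (h0 : 0 ≤ ρ) (h1 : ρ ≤ 1) : μ (⋃ i ∈ s, E i) ≤ (s.card * c) ^ ρ := by
  have h2 : μ (⋃ i ∈ s, E i) ≤ s.card * c := by
    refine (measure_biUnion_finset_le s E).trans ((Finset.sum_le_sum hE).trans ?_)
    simp
  calc μ (⋃ i ∈ s, E i) = μ (⋃ i ∈ s, E i) ^ (1 : ℝ) := (ENNReal.rpow_one _).symm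
    _ ≤ μ (⋃ i ∈ s, E i) ^ ρ := ENNReal.rpow_le_rpow_of_exponent_ge prob_le_one h1
    _ ≤ _ := ENNReal.rpow_le_rpow h2 h0

section GallagerArray

theorem measurable_mulVec_apply {l m : Type*} [Fintype m] (T : Matrix l m ℂ) (k : l) :
    Measurable fun a : m → ℂ => (T *ᵥ a) k := by
  unfold Matrix.mulVec dotProduct; fun_prop

theorem residual_row {n l m m' : Type*} [Fintype m] [Fintype m'] (v : ℝ≥0) (H₁ : Matrix m l ℂ) (H₂ : Matrix m' l ℂ) (Z : n → l → ℂ)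
    (A : n → m → ℂ) (R : n → m' → ℂ) (i : n) (k : l) :
    (Matrix.of Z + Matrix.of (fun i j => ((√(v : ℝ) : ℝ) : ℂ) * A i j) * H₁ -
      (Matrix.of fun i j => ((√(v : ℝ) : ℝ) : ℂ) * R i j) * H₂) i k =
      Z i k + ((((√(v : ℝ) : ℝ) : ℂ) • H₁ᵀ) *ᵥ A i) k -
        ((((√(v : ℝ) : ℝ) : ℂ) • H₂ᵀ) *ᵥ R i) k := by
  simp only [Matrix.sub_apply, Matrix.add_apply, Matrix.mul_apply, Matrix.of_apply,
    Matrix.mulVec, dotProduct, Matrix.smul_apply, Matrix.transpose_apply, smul_eq_mul]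
  have h1 : ∑ j, ((√(v : ℝ) : ℝ) : ℂ) * A i j * H₁ j k =
      ∑ j, ((√(v : ℝ) : ℝ) : ℂ) * H₁ j k * A i j := Finset.sum_congr rfl fun j _ => by ring
  have h2 : ∑ j, ((√(v : ℝ) : ℝ) : ℂ) * R i j * H₂ j k =
      ∑ j, ((√(v : ℝ) : ℝ) : ℂ) * H₂ j k * R i j := Finset.sum_congr rfl fun j _ => by ring
  rw [h1, h2]

theorem smul_transpose_mul_conjTranspose {m l : Type*} [Fintype m] (v : ℝ≥0) (H : Matrix m l ℂ) :
    (((√(v : ℝ) : ℝ) : ℂ) • Hᵀ) * (((√(v : ℝ) : ℝ) : ℂ) • Hᵀ)ᴴ = (v : ℝ) • (Hᴴ * H)ᵀ := by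
  rw [Matrix.conjTranspose_smul, Matrix.smul_mul, Matrix.mul_smul, smul_smul, Complex.star_def,
    Complex.conj_ofReal, ← Complex.ofReal_mul, Real.mul_self_sqrt v.coe_nonneg, Matrix.transpose_mul]
  ext i j
  rw [Matrix.smul_apply, Matrix.smul_apply, Complex.real_smul, smul_eq_mul]
  rfl

variable {n l m m' κ : Type*} [Fintype n] [Fintype l] [Fintype m] [Fintype m']

/-- The received signal minus the contribution of a wrong estimate. -/
def residual (H₁ : Matrix m l ℂ) (H₂ : Matrix m' l ℂ) (e : m' → κ)
    (p : ((n → l → ℂ) × (n → m → ℂ)) × (n → κ → ℂ)) : Matrix n l ℂ :=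
  Matrix.of p.1.1 + Matrix.of p.1.2 * H₁ - (Matrix.of fun i k => p.2 i (e k)) * H₂

theorem measurable_energy_residual (H₁ : Matrix m l ℂ) (H₂ : Matrix m' l ℂ) (e : m' → κ) :
    Measurable fun p : ((n → l → ℂ) × (n → m → ℂ)) × (n → κ → ℂ) =>
      energy (residual H₁ H₂ e p) := by
  simp only [energy, residual, Matrix.sub_apply, Matrix.add_apply, Matrix.mul_apply,
    Matrix.of_apply]
  fun_prop

variable [DecidableEq l] [Fintype κ]

/-- Given noise and sent codewords, each `e i` selects distinct columns of an independent i.i.d.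
array, so one Chernoff bound serves all `i`. It is a product over the channel uses, and so is its
`ρ`-th power; integrating over the remaining randomness gives an `n`-th power. -/
theorem gallager_union_le {ι : Type*} (v : ℝ≥0) (H₁ : Matrix m l ℂ) (H₂ : Matrix m' l ℂ)
    (s : Finset ι) (e : ι → m' → κ) (he : ∀ i ∈ s, Function.Injective (e i)) {ρ β : ℝ}
    (hρ : 0 ≤ ρ) (hρ1 : ρ ≤ 1) (hβ : 0 ≤ β) (hρβ : ρ * β < 1) :
    (((cGaussianArray n l 1).prod (cGaussianArray n m v)).prod (cGaussianArray n κ v))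
        {p | ∃ i ∈ s, energy (residual H₁ H₂ (e i) p) ≤ energy (Matrix.of p.1.1)} ≤
      ENNReal.ofReal ((s.card : ℝ) ^ ρ) * ENNReal.ofReal (Real.exp (
        (1 - ρ) * Fintype.card n * Real.log (1 + (β * v) • (H₂ᴴ * H₂)).det.re -
        Fintype.card n * Real.log
          (1 + (β * (1 - ρ * β) * v) • (ρ • (H₁ᴴ * H₁) + H₂ᴴ * H₂)).det.re)) := by
  classical
  set T₁ : Matrix l m ℂ := ((√(v : ℝ) : ℝ) : ℂ) • H₁ᵀ with hT₁
  set T₂ : Matrix l m' ℂ := ((√(v : ℝ) : ℝ) : ℂ) • H₂ᵀ with hT₂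
  have hset : {p : ((n → l → ℂ) × (n → m → ℂ)) × (n → κ → ℂ) | ∃ i ∈ s,
      energy (residual H₁ H₂ (e i) p) ≤ energy (Matrix.of p.1.1)} =
      ⋃ i ∈ s, {p | energy (residual H₁ H₂ (e i) p) ≤ energy (Matrix.of p.1.1)} := by
    ext p; simp
  have hmE : ∀ i, MeasurableSet {p : ((n → l → ℂ) × (n → m → ℂ)) × (n → κ → ℂ) |
      energy (residual H₁ H₂ (e i) p) ≤ energy (Matrix.of p.1.1)} := fun i =>
    measurableSet_le (measurable_energy_residual H₁ H₂ (e i))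
      (measurable_energy.comp (measurable_fst.comp measurable_fst))
  have hm := Finset.measurableSet_biUnion s fun i _ => hmE i
  rw [hset, Measure.prod_apply hm]
  let φ : (l → ℂ) → (m → ℂ) → ℝ≥0∞ := fun z a =>
    ENNReal.ofReal (Real.exp (β * ∑ k, ‖z k‖ ^ 2)) *
      ∫⁻ a', ENNReal.ofReal (Real.exp (-(β * ∑ k, ‖z k + (T₁ *ᵥ a) k - (T₂ *ᵥ a') k‖ ^ 2)))
        ∂(stdC m')
  have hφ : Measurable (Function.uncurry φ) := by
    refine Measurable.mul (by fun_prop) (Measurable.lintegral_prod_right' (f := fun q :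
      ((l → ℂ) × (m → ℂ)) × (m' → ℂ) => ENNReal.ofReal (Real.exp (-(β *
        ∑ k, ‖q.1.1 k + (T₁ *ᵥ q.1.2) k - (T₂ *ᵥ q.2) k‖ ^ 2)))) ?_)
    have h1 : ∀ k, Measurable fun q : ((l → ℂ) × (m → ℂ)) × (m' → ℂ) => (T₁ *ᵥ q.1.2) k :=
      fun k => (measurable_mulVec_apply T₁ k).comp (measurable_snd.comp measurable_fst)
    have h2 : ∀ k, Measurable fun q : ((l → ℂ) × (m → ℂ)) × (m' → ℂ) => (T₂ *ᵥ q.2) k :=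
      fun k => (measurable_mulVec_apply T₂ k).comp measurable_snd
    fun_prop
  have hsmulm := measurePreserving_array_smul (ι := n) (κ := m) v
  have hsmulm' := measurePreserving_array_smul (ι := n) (κ := m') v
  have hsec : ∀ (Z : n → l → ℂ) (A : n → m → ℂ), cGaussianArray n κ v (Prod.mk
      (Z, fun i j => ((√(v : ℝ) : ℝ) : ℂ) * A i j) ⁻¹' ⋃ i ∈ s,
      {p : ((n → l → ℂ) × (n → m → ℂ)) × (n → κ → ℂ) |
        energy (residual H₁ H₂ (e i) p) ≤ energy (Matrix.of p.1.1)}) ≤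
      ENNReal.ofReal ((s.card : ℝ) ^ ρ) * ∏ i, φ (Z i) (A i) ^ ρ := by
    intro Z A
    rw [Set.preimage_iUnion₂]
    refine (measure_biUnion_le_rpow _ s _ (c := ∏ i, φ (Z i) (A i)) ?_ hρ hρ1).trans ?_
    · intro i hi
      let f : (n → m' → ℂ) → ℝ≥0∞ := fun R => ENNReal.ofReal (Real.exp (β * (energy (Matrix.of Z) -
        energy (Matrix.of Z + Matrix.of (fun i j => ((√(v : ℝ) : ℝ) : ℂ) * A i j) * H₁ -
          Matrix.of R * H₂))))
      have hf : Measurable f := by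
        simp only [f, energy, Matrix.sub_apply, Matrix.add_apply, Matrix.mul_apply,
          Matrix.of_apply]
        fun_prop
      have hcol := measurePreserving_array_columns (ι := n) v (he i hi)
      calc _ ≤ cGaussianArray n κ v {R | 1 ≤ f fun a b => R a (e i b)} := by
            refine measure_mono fun R hR => ?_
            change energy (residual H₁ H₂ (e i) ((Z, _), R)) ≤ energy (Matrix.of Z) at hR
            change 1 ≤ f _
            rw [ENNReal.one_le_ofReal, Real.one_le_exp_iff]
            exact mul_nonneg hβ (sub_nonneg.2 hR)
        _ ≤ ∫⁻ R, f (fun a b => R a (e i b)) ∂(cGaussianArray n κ v) := by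
            have := meas_ge_le_lintegral_div (μ := cGaussianArray n κ v)
              (hf.comp hcol.measurable).aemeasurable one_ne_zero ENNReal.one_ne_top
            rwa [div_one] at this
        _ = ∫⁻ R, f R ∂(cGaussianArray n m' v) := hcol.lintegral_comp hf
        _ = ∫⁻ R, f (fun i j => ((√(v : ℝ) : ℝ) : ℂ) * R i j) ∂(cGaussianArray n m' 1) :=
            (hsmulm'.lintegral_comp hf).symm
        _ = ∫⁻ R, ∏ i, (ENNReal.ofReal (Real.exp (β * ∑ k, ‖Z i k‖ ^ 2)) * ENNReal.ofReal
              (Real.exp (-(β * ∑ k, ‖Z i k + (T₁ *ᵥ A i) k - (T₂ *ᵥ R i) k‖ ^ 2))))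
                ∂(cGaussianArray n m' 1) := by
            refine lintegral_congr fun R => ?_
            simp only [f]
            simp_rw [← ENNReal.ofReal_mul (Real.exp_nonneg _), ← Real.exp_add]
            rw [← ENNReal.ofReal_prod_of_nonneg fun i _ => Real.exp_nonneg _, ← Real.exp_sum]
            congr 2
            simp only [energy, residual_row]
            rw [mul_sub, Finset.mul_sum, Finset.mul_sum, ← Finset.sum_sub_distrib]
            rfl
        _ = ∏ i, φ (Z i) (A i) := by
            have hm : ∀ i, Measurable fun a' : m' → ℂ => ENNReal.ofReal
              (Real.exp (-(β * ∑ k, ‖Z i k + (T₁ *ᵥ A i) k - (T₂ *ᵥ a') k‖ ^ 2))) := fun i => by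
              have h2 := measurable_mulVec_apply T₂
              fun_prop
            rw [cGaussianArray, lintegral_fintype_prod _ fun i => (hm i).const_mul _]
            exact Finset.prod_congr rfl fun i _ => lintegral_const_mul _ (hm i)
    · rw [ENNReal.mul_rpow_of_nonneg _ _ hρ, ENNReal.prod_rpow_of_nonneg hρ,
        ← ENNReal.ofReal_natCast, ENNReal.ofReal_rpow_of_nonneg (Nat.cast_nonneg _) hρ]
  have hG : Measurable fun q : (n → l → ℂ) × (n → m → ℂ) => cGaussianArray n κ v (Prod.mk
      q ⁻¹' ⋃ i ∈ s, {p : ((n → l → ℂ) × (n → m → ℂ)) × (n → κ → ℂ) |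
        energy (residual H₁ H₂ (e i) p) ≤ energy (Matrix.of p.1.1)}) :=
    measurable_measure_prodMk_left hm
  have hφρ : Measurable fun q : (l → ℂ) × (m → ℂ) => φ q.1 q.2 ^ ρ := hφ.pow_const ρ
  have hrow : ∀ Z : n → l → ℂ, ∫⁻ A, ∏ i, φ (Z i) (A i) ^ ρ ∂(cGaussianArray n m 1) =
      ∏ i, ∫⁻ a, φ (Z i) a ^ ρ ∂(stdC m) := fun Z => by
    rw [cGaussianArray]
    exact lintegral_fintype_prod _ fun i => hφρ.comp (measurable_prodMk_left (x := Z i))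
  have hin : Measurable fun z => ∫⁻ a, φ z a ^ ρ ∂(stdC m) := hφρ.lintegral_prod_right'
  have hprod : Measurable fun q : (n → l → ℂ) × (n → m → ℂ) => ∏ i, φ (q.1 i) (q.2 i) ^ ρ :=
    Finset.measurable_prod _ fun i _ => hφρ.comp (f := fun q : (n → l → ℂ) × (n → m → ℂ) =>
      ((q.1 i, q.2 i) : (l → ℂ) × (m → ℂ))) (by fun_prop)
  rw [lintegral_prod _ hG.aemeasurable]
  calc _ = ∫⁻ Z, ∫⁻ A, cGaussianArray n κ v (Prod.mk
      (Z, fun i j => ((√(v : ℝ) : ℝ) : ℂ) * A i j) ⁻¹' ⋃ i ∈ s,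
      {p : ((n → l → ℂ) × (n → m → ℂ)) × (n → κ → ℂ) |
        energy (residual H₁ H₂ (e i) p) ≤ energy (Matrix.of p.1.1)})
        ∂(cGaussianArray n m 1) ∂(cGaussianArray n l 1) := by
        refine lintegral_congr fun Z => ?_
        have h3 := hG.comp (measurable_prodMk_left (x := Z))
        exact (hsmulm.lintegral_comp h3).symm
    _ ≤ ∫⁻ Z, ∫⁻ A, ENNReal.ofReal ((s.card : ℝ) ^ ρ) * ∏ i, φ (Z i) (A i) ^ ρ
        ∂(cGaussianArray n m 1) ∂(cGaussianArray n l 1) :=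
        lintegral_mono fun Z => lintegral_mono fun A => hsec Z A
    _ = ∫⁻ Z, ENNReal.ofReal ((s.card : ℝ) ^ ρ) * ∏ i, ∫⁻ a, φ (Z i) a ^ ρ ∂(stdC m)
        ∂(cGaussianArray n l 1) := by
        refine lintegral_congr fun Z => ?_
        have h4 := hprod.comp (measurable_prodMk_left (x := Z))
        rw [← hrow Z]
        exact lintegral_const_mul _ h4
    _ = ENNReal.ofReal ((s.card : ℝ) ^ ρ) *
          (∫⁻ z, ∫⁻ a, φ z a ^ ρ ∂(stdC m) ∂(stdC l)) ^ Fintype.card n := by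
        have h5 : Measurable fun Z : n → l → ℂ => ∏ i, ∫⁻ a, φ (Z i) a ^ ρ ∂(stdC m) :=
          Finset.measurable_prod _ fun i _ => hin.comp (measurable_pi_apply i)
        rw [lintegral_const_mul _ h5, cGaussianArray, lintegral_fintype_prod _ fun _ => hin]
        simp
    _ = _ := by
        have h6 := lintegral_gallager_row T₁ T₂ hρ hβ hρβ
        have h7 : ∫⁻ z, ∫⁻ a, φ z a ^ ρ ∂(stdC m) ∂(stdC l) = _ := h6
        have d2 : (1 + β • (T₂ * T₂ᴴ)).det = (1 + (β * v) • (H₂ᴴ * H₂)).det := by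
          rw [hT₂, smul_transpose_mul_conjTranspose, smul_smul, ← Matrix.transpose_smul,
            ← Matrix.transpose_one, ← Matrix.transpose_add, Matrix.det_transpose,
            Matrix.transpose_one]
        have d12 : (1 + (β * (1 - ρ * β)) • (ρ • (T₁ * T₁ᴴ) + T₂ * T₂ᴴ)).det =
            (1 + (β * (1 - ρ * β) * v) • (ρ • (H₁ᴴ * H₁) + H₂ᴴ * H₂)).det := by
          rw [hT₂, hT₁, smul_transpose_mul_conjTranspose, smul_transpose_mul_conjTranspose,
            smul_comm ρ, ← smul_add, smul_smul, ← Matrix.transpose_smul, ← Matrix.transpose_add,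
            ← Matrix.transpose_smul, ← Matrix.transpose_one, ← Matrix.transpose_add,
            Matrix.det_transpose, Matrix.transpose_one]
        rw [h7, d2, d12, ← ENNReal.ofReal_pow (Real.exp_nonneg _), ← Real.exp_nat_mul]
        congr 3
        ring

end GallagerArray

/-! ### Symmetry -/

theorem selected_apply {n K M : ℕ} (A : Codebook n K M) (S : Finset (Fin K)) (w : Fin K → Fin M)
    (i : Fin n) (k : Fin K) : selected A S w i k = if k ∈ S then A i (k, w k) else 0 := by
  rw [selected, Matrix.mul_apply, Finset.sum_eq_single (k, w k)]
  · by_cases hk : k ∈ S <;> simp [selection, hk]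
  · rintro ⟨k', m⟩ _ hne
    have : ¬ (k' = k ∧ k ∈ S ∧ m = w k) := by
      rintro ⟨rfl, _, rfl⟩; exact hne rfl
    simp [selection, this]
  · simp

/-- Users are classified by their membership in the two sets. Corresponding classes have equal size,
so bijections of the classes glue to a permutation. -/
theorem exists_perm_of_card {K : ℕ} {S₁ S₂ T₁ T₂ : Finset (Fin K)}
    (h : (S₁ ∩ S₂).card = (T₁ ∩ T₂).card) (h₁ : (S₁ \ S₂).card = (T₁ \ T₂).card)
    (h₂ : (S₂ \ S₁).card = (T₂ \ T₁).card) :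
    ∃ σ : Equiv.Perm (Fin K), ∀ k, (σ k ∈ T₁ ↔ k ∈ S₁) ∧ (σ k ∈ T₂ ↔ k ∈ S₂) := by
  have hcompl : ((S₁ ∪ S₂)ᶜ).card = ((T₁ ∪ T₂)ᶜ).card := by
    have e : ∀ A B : Finset (Fin K), (A ∪ B).card = (A ∩ B).card + (A \ B).card + (B \ A).card := by
      intro A B
      have e1 := Finset.card_inter_add_card_sdiff A B
      have e2 := Finset.card_sdiff_add_card B A
      rw [Finset.union_comm] at e2
      omega
    rw [Finset.card_compl, Finset.card_compl, e, e, h, h₁, h₂]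
  let f : Fin K → Bool × Bool := fun k => (decide (k ∈ S₁), decide (k ∈ S₂))
  let g : Fin K → Bool × Bool := fun k => (decide (k ∈ T₁), decide (k ∈ T₂))
  have hcard : ∀ c, Fintype.card {k // f k = c} = Fintype.card {k // g k = c} := by
    intro c
    rw [Fintype.card_subtype, Fintype.card_subtype]
    have hf : ∀ (A B : Finset (Fin K)) (a b : Bool), (Finset.univ.filter fun k =>
        (decide (k ∈ A), decide (k ∈ B)) = (a, b)) = match a, b with
          | true, true => A ∩ B
          | true, false => A \ B
          | false, true => B \ A
          | false, false => (A ∪ B)ᶜ := by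
      intro A B a b
      ext k
      cases a <;> cases b <;> simp [and_comm]
    obtain ⟨a, b⟩ := c
    simp only [f, g]
    rw [hf, hf]
    cases a <;> cases b <;> simp only <;> assumption
  let F : ∀ c, {k // f k = c} ≃ {k // g k = c} := fun c => Fintype.equivOfCardEq (hcard c)
  let σ : Equiv.Perm (Fin K) :=
    (Equiv.sigmaFiberEquiv f).symm.trans ((Equiv.sigmaCongrRight F).trans (Equiv.sigmaFiberEquiv g))
  have hσ : ∀ k, g (σ k) = f k := fun k => (F (f k) ⟨k, rfl⟩).2
  refine ⟨σ, fun k => ?_⟩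
  have := hσ k
  simp only [f, g, Prod.mk.injEq, decide_eq_decide] at this
  exact this

/-- Used with `p` and `q` saying that a user belongs to `S₁` and to `S₂`: a message has to be
matched only for the sets that contain the user. -/
theorem exists_message_perm {α : Type*} [DecidableEq α] {p q : Prop} {a b c d : α}
    (hab : p → q → a ≠ b) (hcd : c ≠ d) :
    ∃ τ : Equiv.Perm α, (p → τ a = c) ∧ (q → τ b = d) := by
  by_cases hp : p
  · by_cases hq : q
    -- The first transposition sends `a` to `c`; the second sends the image of `b` to `d` and fixes
    -- `c`.
    · refine ⟨(Equiv.swap a c).trans (Equiv.swap (Equiv.swap a c b) d), fun _ => ?_, fun _ => ?_⟩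
      · rw [Equiv.trans_apply, Equiv.swap_apply_left]
        refine Equiv.swap_apply_of_ne_of_ne (fun h => hab hp hq ?_) hcd
        rw [← (Equiv.swap a c).injective.eq_iff, Equiv.swap_apply_left]
        exact h
      · rw [Equiv.trans_apply, Equiv.swap_apply_left]
    · exact ⟨Equiv.swap a c, fun _ => Equiv.swap_apply_left _ _, fun h => absurd h hq⟩
  · exact ⟨Equiv.swap b d, fun h => absurd h hp, fun _ => Equiv.swap_apply_left _ _⟩

theorem measurePreserving_columnEquiv {ι κ : Type*} [Fintype ι] [Fintype κ] (v : ℝ≥0)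
    (e : Equiv.Perm κ) : MeasurePreserving (columnEquiv ι e) (cGaussianArray ι κ v)
      (cGaussianArray ι κ v) :=
  measurePreserving_array_columns v e.injective

/-- A permutation of the users together with a permutation of the messages of each user permutes the
columns of the codebook and preserves its law. On `S₁ ∩ S₂` the two codewords of a user must be
distinct, otherwise they would not be independent. -/
theorem lintegral_selected_eq {n K M : ℕ} (P' : ℝ) {S₁ S₂ T₁ T₂ : Finset (Fin K)}
    {v v' w w' : Fin K → Fin M} (h : (S₁ ∩ S₂).card = (T₁ ∩ T₂).card)
    (h₁ : (S₁ \ S₂).card = (T₁ \ T₂).card) (h₂ : (S₂ \ S₁).card = (T₂ \ T₁).card)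
    (hv : ∀ k ∈ S₁, k ∈ S₂ → v k ≠ v' k) (hw : ∀ k, w k ≠ w' k)
    (F : Matrix (Fin n) (Fin K) ℂ → Matrix (Fin n) (Fin K) ℂ → ℝ≥0∞)
    (hF : ∀ (σ : Equiv.Perm (Fin K)) A₁ A₂, F (A₁.submatrix id σ) (A₂.submatrix id σ) = F A₁ A₂) :
    ∫⁻ A, F (selected A S₁ v) (selected A S₂ v') ∂(codebookLaw n K M P') =
      ∫⁻ A, F (selected A T₁ w) (selected A T₂ w') ∂(codebookLaw n K M P') := by
  obtain ⟨σ, hσ⟩ := exists_perm_of_card h h₁ h₂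
  choose τ hτ hτ' using fun k => exists_message_perm (p := k ∈ S₁) (q := k ∈ S₂)
    (fun hp hq => hv k hp hq) (hw (σ k))
  let π : Equiv.Perm (Fin K × Fin M) :=
    (Equiv.prodShear σ τ)
  have hπ : ∀ k m, π (k, m) = (σ k, τ k m) := fun _ _ => rfl
  have hmp := measurePreserving_columnEquiv (ι := Fin n) P'.toNNReal π
  have h1 := hmp.lintegral_comp_emb (MeasurableEquiv.measurableEmbedding _) fun A =>
    F (selected A S₁ v) (selected A S₂ v')
  refine h1.symm.trans (lintegral_congr fun A => ?_)
  have e1 : selected (columnEquiv (Fin n) π A) S₁ v = (selected A T₁ w).submatrix id σ := by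
    ext i k
    rw [Matrix.submatrix_apply, selected_apply, selected_apply]
    by_cases hk : k ∈ S₁
    · rw [if_pos hk, if_pos ((hσ k).1.2 hk), ← hτ k hk]
      rfl
    · rw [if_neg hk, if_neg (mt (hσ k).1.1 hk)]
  have e2 : selected (columnEquiv (Fin n) π A) S₂ v' = (selected A T₂ w').submatrix id σ := by
    ext i k
    rw [Matrix.submatrix_apply, selected_apply, selected_apply]
    by_cases hk : k ∈ S₂
    · rw [if_pos hk, if_pos ((hσ k).2.2 hk), ← hτ' k hk]
      rfl
    · rw [if_neg hk, if_neg (mt (hσ k).2.1 hk)]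
  rw [e1, e2, hF]

theorem matB_submatrix {n K : ℕ} (ω u r : ℝ) (A₁ A₂ : Matrix (Fin n) (Fin K) ℂ)
    (σ : Equiv.Perm (Fin K)) : matB ω u r (A₁.submatrix id σ) (A₂.submatrix id σ) =
      (matB ω u r A₁ A₂).submatrix σ σ := by
  ext i j
  simp only [matB, Matrix.sub_apply, Matrix.smul_apply, Matrix.mul_apply, Matrix.submatrix_apply,
    Matrix.conjTranspose_apply, id]

theorem chernoffMin_submatrix {n K : ℕ} (L : ℕ) (ω ν : ℝ) (A₁ A₂ : Matrix (Fin n) (Fin K) ℂ)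
    (σ : Equiv.Perm (Fin K)) : chernoffMin L ω ν (A₁.submatrix id σ) (A₂.submatrix id σ) =
      chernoffMin L ω ν A₁ A₂ := by
  have hspec : ∀ B : Matrix (Fin K) (Fin K) ℂ, spectrum ℝ (B.submatrix σ σ) = spectrum ℝ B :=
    fun B => AlgEquiv.spectrum_eq (Matrix.reindexAlgEquiv ℝ ℂ σ.symm) B
  have hdet : ∀ B : Matrix (Fin K) (Fin K) ℂ, (1 + B.submatrix σ σ).det = (1 + B).det := by
    intro B
    rw [← Matrix.det_submatrix_equiv_self σ (1 + B), Matrix.submatrix_add, Pi.add_apply,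
      Pi.add_apply, Matrix.submatrix_one_equiv]
  unfold chernoffMin
  simp_rw [matB_submatrix, hspec, hdet]

theorem submatrix_mul_conjTranspose {n K : ℕ} (A : Matrix (Fin n) (Fin K) ℂ)
    (σ : Equiv.Perm (Fin K)) : A.submatrix id σ * (A.submatrix id σ)ᴴ = A * Aᴴ := by
  ext i j
  simp only [Matrix.mul_apply, Matrix.submatrix_apply, Matrix.conjTranspose_apply, id]
  exact Equiv.sum_comp σ fun k => A i k * star (A j k)

/-- The Gram matrix of the rows in `S` of the fading coefficients. -/
theorem rows_conjTranspose_mul_self {K L : ℕ} (H : Fin K → Fin L → ℂ) (S : Finset (Fin K)) :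
    (rows H S)ᴴ * rows H S = Matrix.of fun l l' => ∑ k ∈ S, star (H k l) * H k l' := by
  ext l l'
  rw [Matrix.mul_apply]
  exact Finset.sum_coe_sort S fun k => star (H k l) * H k l'

theorem lintegral_rows_eq {K L : ℕ} {S₁ S₂ T₁ T₂ : Finset (Fin K)}
    (h : (S₁ ∩ S₂).card = (T₁ ∩ T₂).card)
    (h₁ : (S₁ \ S₂).card = (T₁ \ T₂).card) (h₂ : (S₂ \ S₁).card = (T₂ \ T₁).card)
    (F : Matrix (Fin L) (Fin L) ℂ → Matrix (Fin L) (Fin L) ℂ → ℝ≥0∞) :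
    ∫⁻ H, F ((rows H S₁)ᴴ * rows H S₁) ((rows H S₂)ᴴ * rows H S₂)
        ∂(cGaussianArray (Fin K) (Fin L) 1) =
      ∫⁻ H, F ((rows H T₁)ᴴ * rows H T₁) ((rows H T₂)ᴴ * rows H T₂)
        ∂(cGaussianArray (Fin K) (Fin L) 1) := by
  obtain ⟨σ, hσ⟩ := exists_perm_of_card h h₁ h₂
  have hmp : MeasurePreserving (MeasurableEquiv.piCongrLeft (fun _ : Fin K => Fin L → ℂ) σ.symm)
      (cGaussianArray (Fin K) (Fin L) 1) (cGaussianArray (Fin K) (Fin L) 1) :=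
    measurePreserving_piCongrLeft (fun _ => Measure.pi fun _ => cGaussian 1) σ.symm
  have h1 := hmp.lintegral_comp_emb (MeasurableEquiv.measurableEmbedding _) fun H =>
    F ((rows H S₁)ᴴ * rows H S₁) ((rows H S₂)ᴴ * rows H S₂)
  refine h1.symm.trans (lintegral_congr fun H => ?_)
  have e : ∀ S T : Finset (Fin K), (∀ k, σ k ∈ T ↔ k ∈ S) →
      (rows (MeasurableEquiv.piCongrLeft (fun _ : Fin K => Fin L → ℂ) σ.symm H) S)ᴴ *
        rows (MeasurableEquiv.piCongrLeft (fun _ : Fin K => Fin L → ℂ) σ.symm H) S =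
      (rows H T)ᴴ * rows H T := by
    intro S T hST
    have e0 : ∀ k, MeasurableEquiv.piCongrLeft (fun _ : Fin K => Fin L → ℂ) σ.symm H k =
        H (σ k) := fun k => by
      have := Equiv.piCongrLeft_apply_apply (fun _ : Fin K => Fin L → ℂ) σ.symm H (σ k)
      rw [Equiv.symm_apply_apply] at this
      exact this
    rw [rows_conjTranspose_mul_self, rows_conjTranspose_mul_self]
    ext l l'
    simp only [Matrix.of_apply, e0]
    exact Finset.sum_equiv σ (fun k => (hST k).symm) fun k _ => rfl
  rw [e S₁ T₁ fun k => (hσ k).1, e S₂ T₂ fun k => (hσ k).2]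

/-! ### The error patterns of the decoder -/

section Patterns

variable {n K L M : ℕ}

/-- The active users whose message is not decoded correctly. -/
def errorSet (active : Finset (Fin K)) (W : Fin K → Fin M) (e : Estimate K M) : Finset (Fin K) :=
  active.filter fun k => e k ≠ some (W k)

/-- The false alarm messages of the users in `S₂₁`, which are in error, and in `S₂₂`, which are
inactive; the remaining users have the message prescribed by `d`. -/
def altMessages (W d : Fin K → Fin M) (S₂₁ S₂₂ : Finset (Fin K)) : Finset (Fin K → Fin M) :=
  Fintype.piFinset fun k => if k ∈ S₂₁ then Finset.univ.erase (W k) else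
    if k ∈ S₂₂ then Finset.univ else {d k}

theorem card_altMessages (W d : Fin K → Fin M) {S₂₁ S₂₂ : Finset (Fin K)}
    (h : Disjoint S₂₁ S₂₂) :
    (altMessages W d S₂₁ S₂₂).card = (M - 1) ^ S₂₁.card * M ^ S₂₂.card := by
  rw [altMessages, Fintype.card_piFinset]
  have h1 : ∀ k, (if k ∈ S₂₁ then Finset.univ.erase (W k) else
      if k ∈ S₂₂ then Finset.univ else {d k}).card =
      (if k ∈ S₂₁ then M - 1 else 1) * (if k ∈ S₂₂ then M else 1) := by
    intro k
    by_cases h1 : k ∈ S₂₁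
    · have h2 : k ∉ S₂₂ := Finset.disjoint_left.1 h h1
      simp [h1, h2]
    · by_cases h2 : k ∈ S₂₂ <;> simp [h1, h2]
  simp_rw [h1]
  rw [Finset.prod_mul_distrib, Finset.prod_ite_mem, Finset.prod_ite_mem]
  simp

theorem altMessages_ne {W d v : Fin K → Fin M} {S₂₁ S₂₂ : Finset (Fin K)}
    (hv : v ∈ altMessages W d S₂₁ S₂₂) {k : Fin K} (hk : k ∈ S₂₁) : W k ≠ v k := by
  have := Fintype.mem_piFinset.1 hv k
  rw [if_pos hk] at this
  exact (Finset.ne_of_mem_erase this).symm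

theorem selected_mul_apply (A : Codebook n K M) (S : Finset (Fin K)) (v : Fin K → Fin M)
    (H : Fin K → Fin L → ℂ) (i : Fin n) (l : Fin L) :
    (selected A S v * Matrix.of H) i l = ∑ k ∈ S, A i (k, v k) * H k l := by
  simp_rw [Matrix.mul_apply, selected_apply, ite_mul, zero_mul]
  rw [Finset.sum_ite_mem, Finset.univ_inter]
  rfl

/-- The difference between the received signal and its reconstruction from a wrong estimate. -/
def errorSignal (S₁ S₂ : Finset (Fin K)) (v v' : Fin K → Fin M) (A : Codebook n K M)
    (H : Fin K → Fin L → ℂ) (Z : Fin n → Fin L → ℂ) : Matrix (Fin n) (Fin L) ℂ :=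
  Matrix.of Z + (selected A S₁ v - selected A S₂ v') * Matrix.of H

theorem errorSignal_apply (S₁ S₂ : Finset (Fin K)) (v v' : Fin K → Fin M) (A : Codebook n K M)
    (H : Fin K → Fin L → ℂ) (Z : Fin n → Fin L → ℂ) (i : Fin n) (l : Fin L) :
    errorSignal S₁ S₂ v v' A H Z i l = Z i l +
      (∑ k ∈ S₁, A i (k, v k) * H k l - ∑ k ∈ S₂, A i (k, v' k) * H k l) := by
  rw [errorSignal, Matrix.add_apply, Matrix.sub_mul, Matrix.sub_apply, selected_mul_apply,
    selected_mul_apply]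
  rfl

theorem metric_eq_energy (A : Codebook n K M) (Y : Fin n → Fin L → ℂ) (H : Fin K → Fin L → ℂ)
    (e : Estimate K M) : metric A Y H e = energy (Matrix.of fun i l =>
      Y i l - ∑ k, (e k).elim 0 (fun m => H k l * A i (k, m))) := Finset.sum_comm

/-- The truth declares `K_a` users and has metric `‖Z‖²`, so the decoder's metric is at most that.
The correctly decoded users cancel in the decoder's residual. -/
theorem exists_confusion {active : Finset (Fin K)} {A : Codebook n K M} {W d : Fin K → Fin M}
    {H : Fin K → Fin L → ℂ} {Z : Fin n → Fin L → ℂ} {e : Estimate K M}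
    (he : numDetected e = active.card)
    (hmin : ∀ e', numDetected e' = active.card → metric A (received active A W H Z) H e ≤
      metric A (received active A W H Z) H e') :
    ∃ S₂₁ ⊆ errorSet active W e, ∃ S₂₂ ⊆ activeᶜ,
      S₂₁.card + S₂₂.card = (errorSet active W e).card ∧
      ∃ v' ∈ altMessages W d S₂₁ S₂₂,
        energy (errorSignal (errorSet active W e) (S₂₁ ∪ S₂₂) W v' A H Z) ≤
          energy (Matrix.of Z) := by
  set S₁ := errorSet active W e with hS₁
  let D : Finset (Fin K) := Finset.univ.filter fun k => (e k).isSome = true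
  have hD : ∀ k, k ∈ D ↔ (e k).isSome = true := fun k => by simp [D]
  have hmemS : ∀ k, k ∈ S₁ ↔ k ∈ active ∧ e k ≠ some (W k) := fun k => by
    simp [hS₁, errorSet]
  have hcorrect : ∀ k ∈ active, k ∉ S₁ → e k = some (W k) := fun k hk hk' => by
    by_contra h; exact hk' ((hmemS k).2 ⟨hk, h⟩)
  have hsub : S₁ ⊆ active := Finset.filter_subset _ _
  -- `D` is the set of users declared active: `S₁ ∩ D` are the active users with a wrong message and
  -- `activeᶜ ∩ D` the false alarms. The number of declared users is the number of active ones, so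
  -- the false alarms are as many as the missed users.
  refine ⟨S₁ ∩ D, Finset.inter_subset_left, activeᶜ ∩ D, Finset.inter_subset_left, ?_,
    fun k => if k ∈ (S₁ ∩ D) ∪ (activeᶜ ∩ D) then (e k).getD (d k) else d k, ?_, ?_⟩
  · have h1 : D.card = active.card := he
    have h2 : D = (active \ S₁) ∪ ((S₁ ∩ D) ∪ (activeᶜ ∩ D)) := by
      ext k
      simp only [Finset.mem_union, Finset.mem_sdiff, Finset.mem_inter, Finset.mem_compl]
      constructor
      · intro hk
        by_cases ha : k ∈ active
        · by_cases hs : k ∈ S₁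
          · exact Or.inr (Or.inl ⟨hs, hk⟩)
          · exact Or.inl ⟨ha, hs⟩
        · exact Or.inr (Or.inr ⟨ha, hk⟩)
      · rintro (⟨ha, hs⟩ | ⟨_, hk⟩ | ⟨_, hk⟩)
        · rw [hD, hcorrect k ha hs]; rfl
        · exact hk
        · exact hk
    have hd2 : Disjoint (S₁ ∩ D) (activeᶜ ∩ D) := Finset.disjoint_left.2 fun k hk hk' =>
      (Finset.mem_compl.1 (Finset.mem_inter.1 hk').1) (hsub (Finset.mem_inter.1 hk).1)
    have hd1 : Disjoint (active \ S₁) ((S₁ ∩ D) ∪ (activeᶜ ∩ D)) := by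
      refine Finset.disjoint_left.2 fun k hk hk' => ?_
      obtain ⟨ha, hs⟩ := Finset.mem_sdiff.1 hk
      rcases Finset.mem_union.1 hk' with h | h
      · exact hs (Finset.mem_inter.1 h).1
      · exact Finset.mem_compl.1 (Finset.mem_inter.1 h).1 ha
    have h3 := congrArg Finset.card h2
    rw [Finset.card_union_of_disjoint hd1, Finset.card_union_of_disjoint hd2,
      Finset.card_sdiff_of_subset hsub] at h3
    have h4 := Finset.card_le_card hsub
    omega
  · refine Fintype.mem_piFinset.2 fun k => ?_
    by_cases h1 : k ∈ S₁ ∩ D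
    · rw [if_pos h1, if_pos (Finset.mem_union_left _ h1), Finset.mem_erase]
      refine ⟨fun h => ?_, Finset.mem_univ _⟩
      obtain ⟨hs, hd⟩ := Finset.mem_inter.1 h1
      obtain ⟨m, hm⟩ := Option.isSome_iff_exists.1 ((hD k).1 hd)
      rw [hm, Option.getD_some] at h
      exact ((hmemS k).1 hs).2 (by rw [hm, h])
    · rw [if_neg h1]
      by_cases h2 : k ∈ activeᶜ ∩ D
      · rw [if_pos h2]; exact Finset.mem_univ _
      · rw [if_neg h2, if_neg (by rw [Finset.mem_union, not_or]; exact ⟨h1, h2⟩)]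
        exact Finset.mem_singleton_self _
  -- The true estimate, as competitor of the decoder's output.
  · let e' : Estimate K M := fun k => if k ∈ active then some (W k) else none
    have he' : numDetected e' = active.card := by
      unfold numDetected
      congr 1
      ext k
      by_cases hk : k ∈ active <;> simp [e', hk]
    have h := hmin e' he'
    rw [metric_eq_energy, metric_eq_energy] at h
    have h1 : (Matrix.of fun i l => received active A W H Z i l -
        ∑ k, (e' k).elim 0 (fun m => H k l * A i (k, m))) = Matrix.of Z := by
      ext i l
      have : ∑ k, (e' k).elim 0 (fun m => H k l * A i (k, m)) =
          ∑ k ∈ active, H k l * A i (k, W k) := by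
        rw [← Finset.sum_subset (Finset.subset_univ active)]
        · exact Finset.sum_congr rfl fun k hk => by simp [e', hk]
        · intro k _ hk; simp [e', hk]
      rw [Matrix.of_apply, Matrix.of_apply, this, received, add_sub_cancel_left]
    rw [h1] at h
    refine le_trans (le_of_eq (congrArg energy ?_)) h
    ext i l
    rw [errorSignal_apply, Matrix.of_apply, received]
    have key : ∀ k, (if k ∈ active then H k l * A i (k, W k) else 0) -
        (e k).elim 0 (fun m => H k l * A i (k, m)) =
        (if k ∈ S₁ then A i (k, W k) * H k l else 0) -
        (if k ∈ (S₁ ∩ D) ∪ (activeᶜ ∩ D) then A i (k, if k ∈ (S₁ ∩ D) ∪ (activeᶜ ∩ D) then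
          (e k).getD (d k) else d k) * H k l else 0) := by
      intro k
      by_cases ha : k ∈ active
      · by_cases hs : k ∈ S₁
        · cases hek : e k with
          | none =>
            have hd : k ∉ D := by rw [hD, hek]; simp
            simp [ha, hs, hd, mul_comm]
          | some m =>
            have hd : k ∈ D := by rw [hD, hek]; rfl
            simp [ha, hs, hd, mul_comm]
        · simp [ha, hs, hcorrect k ha hs]
      · have hs : k ∉ S₁ := fun h => ha (hsub h)
        cases hek : e k with
        | none =>
          have hd : k ∉ D := by rw [hD, hek]; simp
          simp [ha, hs, hd]
        | some m =>
          have hd : k ∈ D := by rw [hD, hek]; rfl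
          simp [ha, hs, hd, mul_comm]
    have hsum := Finset.sum_congr (rfl : (Finset.univ : Finset (Fin K)) = Finset.univ)
      fun k _ => key k
    rw [Finset.sum_sub_distrib, Finset.sum_sub_distrib, Finset.sum_ite_mem, Finset.sum_ite_mem,
      Finset.sum_ite_mem, Finset.univ_inter, Finset.univ_inter, Finset.univ_inter] at hsum
    rw [← hsum]
    ring

end Patterns

/-! ### The events of the error analysis -/

section Events

variable {n K L M : ℕ}

/-- The joint law of the codebook, of the fading coefficients and of the noise. -/
def jointLaw (n K L M : ℕ) (P' : ℝ) :
    Measure (Codebook n K M × (Fin K → Fin L → ℂ) × (Fin n → Fin L → ℂ)) :=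
  (codebookLaw n K M P').prod
    ((cGaussianArray (Fin K) (Fin L) 1).prod (cGaussianArray (Fin n) (Fin L) 1))

instance {ι κ : Type*} [Fintype ι] [Fintype κ] (v : ℝ≥0) :
    IsProbabilityMeasure (cGaussianArray ι κ v) := isProbabilityMeasure_cGaussianArray v

instance (P' : ℝ) : IsProbabilityMeasure (codebookLaw n K M P') :=
  isProbabilityMeasure_cGaussianArray _

instance (P' : ℝ) : IsProbabilityMeasure (jointLaw n K L M P') := by
  unfold jointLaw
  infer_instance

/-- The wrong codewords `v'` of the users in `S₂` fit the received signal better than the correct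
codewords `v` of the users in `S₁`. -/
def confusionEvent (S₁ S₂ : Finset (Fin K)) (v v' : Fin K → Fin M) :
    Set (Codebook n K M × (Fin K → Fin L → ℂ) × (Fin n → Fin L → ℂ)) :=
  {p | energy (errorSignal S₁ S₂ v v' p.1 p.2.1 p.2.2) ≤ energy (Matrix.of p.2.2)}

/-- The good region. -/
def goodEvent (ω c : ℝ) (S₁ : Finset (Fin K)) (v : Fin K → Fin M) :
    Set (Codebook n K M × (Fin K → Fin L → ℂ) × (Fin n → Fin L → ℂ)) :=
  {p | energy (Matrix.of p.2.2) ≤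
    ω * energy (Matrix.of p.2.2 + selected p.1 S₁ v * Matrix.of p.2.1) + c}

/-- Exactly `t` active users are not decoded correctly when the codebook itself is transmitted. -/
def errorCountEvent (active : Finset (Fin K)) (W : Fin K → Fin M)
    (dec : Codebook n K M → (Fin n → Fin L → ℂ) → (Fin K → Fin L → ℂ) → Estimate K M) (t : ℕ) :
    Set (Codebook n K M × (Fin K → Fin L → ℂ) × (Fin n → Fin L → ℂ)) :=
  {p | (errorSet active W (dec p.1 (received active p.1 W p.2.1 p.2.2) p.2.1)).card = t}

theorem measurable_energy_errorSignal (S₁ S₂ : Finset (Fin K)) (v v' : Fin K → Fin M) :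
    Measurable fun p : Codebook n K M × (Fin K → Fin L → ℂ) × (Fin n → Fin L → ℂ) =>
      energy (errorSignal S₁ S₂ v v' p.1 p.2.1 p.2.2) := by
  simp only [energy, errorSignal_apply]
  fun_prop

theorem measurable_energy_noise :
    Measurable fun p : Codebook n K M × (Fin K → Fin L → ℂ) × (Fin n → Fin L → ℂ) =>
      energy (Matrix.of p.2.2) := by
  simp only [energy, Matrix.of_apply]
  fun_prop

theorem errorSignal_empty (S₁ : Finset (Fin K)) (v v' : Fin K → Fin M) (A : Codebook n K M)
    (H : Fin K → Fin L → ℂ) (Z : Fin n → Fin L → ℂ) : errorSignal S₁ ∅ v v' A H Z =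
      Matrix.of Z + selected A S₁ v * Matrix.of H := by
  ext i l
  rw [errorSignal_apply, Matrix.add_apply, selected_mul_apply, Finset.sum_empty, sub_zero]
  rfl

theorem measurable_energy_signal (S₁ : Finset (Fin K)) (v : Fin K → Fin M) :
    Measurable fun p : Codebook n K M × (Fin K → Fin L → ℂ) × (Fin n → Fin L → ℂ) =>
      energy (Matrix.of p.2.2 + selected p.1 S₁ v * Matrix.of p.2.1) := by
  have := measurable_energy_errorSignal (n := n) (L := L) S₁ ∅ v v
  simpa only [errorSignal_empty] using this

theorem measurableSet_confusionEvent (S₁ S₂ : Finset (Fin K)) (v v' : Fin K → Fin M) :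
    MeasurableSet (confusionEvent (n := n) (L := L) S₁ S₂ v v') :=
  measurableSet_le (measurable_energy_errorSignal S₁ S₂ v v') measurable_energy_noise

theorem measurableSet_goodEvent (ω c : ℝ) (S₁ : Finset (Fin K)) (v : Fin K → Fin M) :
    MeasurableSet (goodEvent (n := n) (L := L) ω c S₁ v) :=
  measurableSet_le measurable_energy_noise
    (((measurable_energy_signal S₁ v).const_mul ω).add_const c)

theorem jointLaw_apply {P' : ℝ}
    {E : Set (Codebook n K M × (Fin K → Fin L → ℂ) × (Fin n → Fin L → ℂ))}
    (hE : MeasurableSet E) : jointLaw n K L M P' E =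
      ∫⁻ A, ((cGaussianArray (Fin K) (Fin L) 1).prod (cGaussianArray (Fin n) (Fin L) 1))
        (Prod.mk A ⁻¹' E) ∂(codebookLaw n K M P') :=
  Measure.prod_apply hE

theorem errorCountEvent_subset {active : Finset (Fin K)} (W d : Fin K → Fin M)
    {dec : Codebook n K M → (Fin n → Fin L → ℂ) → (Fin K → Fin L → ℂ) → Estimate K M}
    (hdec : IsMLDecoder active.card dec) (t : ℕ) :
    errorCountEvent active W dec t ⊆ ⋃ S₁ ∈ active.powersetCard t, ⋃ t₀ ∈ Finset.range (t + 1),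
      ⋃ S₂₁ ∈ S₁.powersetCard t₀, ⋃ S₂₂ ∈ activeᶜ.powersetCard (t - t₀),
        ⋃ v' ∈ altMessages W d S₂₁ S₂₂, confusionEvent S₁ (S₂₁ ∪ S₂₂) W v' := by
  rintro ⟨A, H, Z⟩ hp
  obtain ⟨S₂₁, h21, S₂₂, h22, hcard, v', hv', hE⟩ := exists_confusion (d := d)
    (hdec.numDetected_eq A (received active A W H Z) H)
    (hdec.metric_le A (received active A W H Z) H)
  have hp' : (errorSet active W (dec A (received active A W H Z) H)).card = t := hp
  rw [hp'] at hcard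
  simp only [Set.mem_iUnion, Finset.mem_powersetCard, Finset.mem_range]
  exact ⟨_, ⟨Finset.filter_subset _ _, hp'⟩, S₂₁.card, by omega, S₂₁, ⟨h21, rfl⟩, S₂₂,
    ⟨h22, by omega⟩, v', hv', hE⟩

/-- The union bound over the error patterns. -/
theorem errorCountEvent_le {active : Finset (Fin K)} (W d : Fin K → Fin M)
    {dec : Codebook n K M → (Fin n → Fin L → ℂ) → (Fin K → Fin L → ℂ) → Estimate K M}
    (hdec : IsMLDecoder active.card dec) (t : ℕ) (P' : ℝ)
    (G : Finset (Fin K) → Set (Codebook n K M × (Fin K → Fin L → ℂ) × (Fin n → Fin L → ℂ)))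
    (b : ℕ → ℝ≥0∞)
    (hb : ∀ S₁ ⊆ active, S₁.card = t → ∀ t₀ ≤ t, ∀ S₂₁ ⊆ S₁, S₂₁.card = t₀ →
      ∀ S₂₂, Disjoint S₂₂ active → S₂₂.card = t - t₀ → jointLaw n K L M P'
        ((⋃ v' ∈ altMessages W d S₂₁ S₂₂, confusionEvent S₁ (S₂₁ ∪ S₂₂) W v') ∩ G S₁) ≤ b t₀) :
    jointLaw n K L M P' (errorCountEvent active W dec t) ≤
      (∑ t₀ ∈ Finset.range (t + 1),
        ((active.card.choose t * t.choose t₀ * (K - active.card).choose (t - t₀) : ℕ) : ℝ≥0∞) *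
          b t₀) +
      jointLaw n K L M P' (⋃ S₁ ∈ active.powersetCard t, (G S₁)ᶜ) := by
  set Q := jointLaw n K L M P'
  set C : Finset (Fin K) → Finset (Fin K) → Finset (Fin K) →
    Set (Codebook n K M × (Fin K → Fin L → ℂ) × (Fin n → Fin L → ℂ)) := fun S₁ S₂₁ S₂₂ =>
      ⋃ v' ∈ altMessages W d S₂₁ S₂₂, confusionEvent S₁ (S₂₁ ∪ S₂₂) W v' with hC
  -- The complement of `G S₁` is counted once for each `S₁`, not once for each choice of `S₂` and of
  -- the false messages.
  have hsub : errorCountEvent active W dec t ⊆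
      (⋃ S₁ ∈ active.powersetCard t, ⋃ t₀ ∈ Finset.range (t + 1), ⋃ S₂₁ ∈ S₁.powersetCard t₀,
        ⋃ S₂₂ ∈ activeᶜ.powersetCard (t - t₀), C S₁ S₂₁ S₂₂ ∩ G S₁) ∪
      ⋃ S₁ ∈ active.powersetCard t, (G S₁)ᶜ := by
    intro p hp
    have h := errorCountEvent_subset W d hdec t hp
    simp only [Set.mem_iUnion, exists_prop] at h
    obtain ⟨S₁, h1, t₀, h0, S₂₁, h21, S₂₂, h22, h⟩ := h
    by_cases hG : p ∈ G S₁
    · left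
      simp only [Set.mem_iUnion, exists_prop]
      refine ⟨S₁, h1, t₀, h0, S₂₁, h21, S₂₂, h22, ?_, hG⟩
      simpa only [hC, Set.mem_iUnion, exists_prop] using h
    · right
      simp only [Set.mem_iUnion, exists_prop]
      exact ⟨S₁, h1, hG⟩
  refine (measure_mono hsub).trans ((measure_union_le _ _).trans (add_le_add ?_ le_rfl))
  calc _ ≤ ∑ S₁ ∈ active.powersetCard t, ∑ t₀ ∈ Finset.range (t + 1),
        ∑ S₂₁ ∈ S₁.powersetCard t₀, ∑ S₂₂ ∈ activeᶜ.powersetCard (t - t₀),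
          Q (C S₁ S₂₁ S₂₂ ∩ G S₁) :=
      (measure_biUnion_finset_le _ _).trans <| Finset.sum_le_sum fun S₁ _ =>
        (measure_biUnion_finset_le _ _).trans <| Finset.sum_le_sum fun t₀ _ =>
          (measure_biUnion_finset_le _ _).trans <| Finset.sum_le_sum fun S₂₁ _ =>
            measure_biUnion_finset_le _ _
    _ ≤ ∑ S₁ ∈ active.powersetCard t, ∑ t₀ ∈ Finset.range (t + 1),
        ∑ S₂₁ ∈ S₁.powersetCard t₀, ∑ S₂₂ ∈ activeᶜ.powersetCard (t - t₀), b t₀ := by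
      refine Finset.sum_le_sum fun S₁ h1 => Finset.sum_le_sum fun t₀ h0 =>
        Finset.sum_le_sum fun S₂₁ h21 => Finset.sum_le_sum fun S₂₂ h22 => ?_
      rw [Finset.mem_powersetCard] at h1 h21 h22
      exact hb S₁ h1.1 h1.2 t₀ (Nat.lt_succ_iff.1 (Finset.mem_range.1 h0)) S₂₁ h21.1 h21.2 S₂₂
        (Finset.subset_compl_iff_disjoint_right.1 h22.1) h22.2
    _ = _ := by
      rw [Finset.sum_comm]
      refine Finset.sum_congr rfl fun t₀ _ => ?_
      have h : ∀ S₁ ∈ active.powersetCard t, ∑ S₂₁ ∈ S₁.powersetCard t₀,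
          ∑ S₂₂ ∈ activeᶜ.powersetCard (t - t₀), b t₀ =
          ((t.choose t₀ * (K - active.card).choose (t - t₀) : ℕ) : ℝ≥0∞) * b t₀ := by
        intro S₁ h1
        rw [Finset.mem_powersetCard] at h1
        rw [Finset.sum_const, Finset.sum_const, Finset.card_powersetCard,
          Finset.card_powersetCard, Finset.card_compl, Fintype.card_fin, h1.2, smul_smul,
          nsmul_eq_mul]
      rw [Finset.sum_congr rfl h, Finset.sum_const, Finset.card_powersetCard, nsmul_eq_mul,
        ← mul_assoc, ← Nat.cast_mul, mul_assoc (active.card.choose t)]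

theorem card_pattern {active S₁ S₂₁ S₂₂ : Finset (Fin K)} {t t₀ : ℕ} (h1 : S₁ ⊆ active)
    (h1c : S₁.card = t) (h21 : S₂₁ ⊆ S₁) (h21c : S₂₁.card = t₀) (h22 : Disjoint S₂₂ active)
    (h22c : S₂₂.card = t - t₀) : (S₁ ∩ (S₂₁ ∪ S₂₂)).card = t₀ ∧
      (S₁ \ (S₂₁ ∪ S₂₂)).card = t - t₀ ∧ ((S₂₁ ∪ S₂₂) \ S₁).card = t - t₀ := by
  have hd : ∀ k ∈ S₂₂, k ∉ S₁ := fun k hk hk' => Finset.disjoint_left.1 h22 hk (h1 hk')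
  have e1 : S₁ ∩ (S₂₁ ∪ S₂₂) = S₂₁ := by
    ext k
    have := @h21 k
    have := hd k
    simp only [Finset.mem_inter, Finset.mem_union]
    tauto
  have e2 : S₁ \ (S₂₁ ∪ S₂₂) = S₁ \ S₂₁ := by
    ext k
    have := hd k
    simp only [Finset.mem_sdiff, Finset.mem_union]
    tauto
  have e3 : (S₂₁ ∪ S₂₂) \ S₁ = S₂₂ := by
    ext k
    have := @h21 k
    have := hd k
    simp only [Finset.mem_sdiff, Finset.mem_union]
    tauto
  rw [e1, e2, e3, Finset.card_sdiff_of_subset h21, h1c, h21c, h22c]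
  exact ⟨rfl, rfl, rfl⟩

/-- The confusion events in the good region. -/
theorem confusion_inter_good_le {S₁ S₂ : Finset (Fin K)} (v v' : Fin K → Fin M) {ω : ℝ}
    (hω : ω ≤ 1) (ν P' : ℝ) :
    jointLaw n K L M P' (confusionEvent S₁ S₂ v v' ∩ goodEvent ω (n * L * ν) S₁ v) ≤
      ∫⁻ A, chernoffMin L ω ν (selected A S₁ v) (selected A S₂ v') ∂(codebookLaw n K M P') := by
  rw [jointLaw_apply ((measurableSet_confusionEvent _ _ _ _).inter
    (measurableSet_goodEvent _ _ _ _))]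
  refine lintegral_mono fun A => (measure_mono ?_).trans
    (goodRegion_le_chernoffMin L hω ν (selected A S₁ v) (selected A S₂ v'))
  exact fun q hq => ⟨hq.1, hq.2⟩

/-- Union bound over the false messages. By symmetry each term equals the representative
expectation, since a user of `S₂` that lies in `S₁` belongs to `S₂₁` and so has a false message
different from the sent one. -/
theorem confusions_inter_good_le {active S₁ S₂₁ S₂₂ T₁ T₂ : Finset (Fin K)} {W w w' : Fin K → Fin M}
    (d : Fin K → Fin M) (hw : ∀ k, w' k ≠ w k) {t t₀ : ℕ} (h1 : S₁ ⊆ active)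
    (h1c : S₁.card = t) (h21 : S₂₁ ⊆ S₁) (h21c : S₂₁.card = t₀) (h22 : Disjoint S₂₂ active)
    (h22c : S₂₂.card = t - t₀) (hT : (T₁ ∩ T₂).card = t₀ ∧ (T₁ \ T₂).card = t - t₀ ∧
      (T₂ \ T₁).card = t - t₀) {ω : ℝ} (hω : ω ≤ 1) (ν P' : ℝ) :
    jointLaw n K L M P' ((⋃ v' ∈ altMessages W d S₂₁ S₂₂, confusionEvent S₁ (S₂₁ ∪ S₂₂) W v') ∩
        goodEvent ω (n * L * ν) S₁ W) ≤ (((M - 1) ^ t₀ * M ^ (t - t₀) : ℕ) : ℝ≥0∞) *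
      ∫⁻ A, chernoffMin L ω ν (selected A T₁ w) (selected A T₂ w') ∂(codebookLaw n K M P') := by
  obtain ⟨hc, hc1, hc2⟩ := card_pattern h1 h1c h21 h21c h22 h22c
  have hd : Disjoint S₂₁ S₂₂ := Finset.disjoint_left.2 fun k hk hk' =>
    Finset.disjoint_left.1 h22 hk' (h1 (h21 hk))
  rw [Set.iUnion₂_inter]
  refine (measure_biUnion_finset_le _ _).trans ?_
  have h : ∀ v' ∈ altMessages W d S₂₁ S₂₂, jointLaw n K L M P'
      (confusionEvent S₁ (S₂₁ ∪ S₂₂) W v' ∩ goodEvent ω (n * L * ν) S₁ W) ≤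
      ∫⁻ A, chernoffMin L ω ν (selected A T₁ w) (selected A T₂ w') ∂(codebookLaw n K M P') := by
    intro v' hv'
    refine (confusion_inter_good_le W v' hω ν P').trans (le_of_eq ?_)
    refine lintegral_selected_eq P' (hc.trans hT.1.symm) (hc1.trans hT.2.1.symm)
      (hc2.trans hT.2.2.symm) (fun k hk hk2 => ?_) (fun k => (hw k).symm) (chernoffMin L ω ν)
      (fun σ A₁ A₂ => chernoffMin_submatrix L ω ν A₁ A₂ σ)
    refine altMessages_ne hv' ?_
    rcases Finset.mem_union.1 hk2 with h | h
    · exact h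
    · exact absurd (h1 hk) (Finset.disjoint_left.1 h22 h)
  refine (Finset.sum_le_sum h).trans (le_of_eq ?_)
  rw [Finset.sum_const, card_altMessages W d hd, h21c, h22c, nsmul_eq_mul]

end Events

/-! ### The bad region -/

section BadRegion

variable {n K L M : ℕ}

/-- The ratio is the probability in `cGaussianArray_energy_le`. -/
theorem gammaRatio_le_one {a b : ℕ} (ha : 0 < a) (hb : 0 < b) (x : ℝ) :
    gammaRatio (a * b) x ≤ 1 := by
  have : Nonempty (Fin a) := ⟨⟨0, ha⟩⟩
  have : Nonempty (Fin b) := ⟨⟨0, hb⟩⟩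
  have h := cGaussianArray_energy_le (ι := Fin a) (κ := Fin b) x
  rw [Fintype.card_fin, Fintype.card_fin] at h
  rw [← ENNReal.ofReal_le_one, ← h]
  exact prob_le_one

theorem det_one_add_mul_conjTranspose_nonneg {ι κ : Type*} [Fintype ι] [Fintype κ] [DecidableEq ι]
    (A : Matrix ι κ ℂ) {ω : ℝ} (hω : 0 ≤ ω) : 0 ≤ (1 + ω • (A * Aᴴ)).det.re := by
  have h : (1 + ω • (A * Aᴴ)).PosDef :=
    Matrix.PosDef.one.add_posSemidef ((Matrix.posSemidef_self_mul_conjTranspose A).smul hω)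
  exact h.det_re_pos.1.le

/-- The matrix of the selected codewords, without the zero columns. -/
def selectedColumns (A : Codebook n K M) (S : Finset (Fin K)) (v : Fin K → Fin M) :
    Matrix (Fin n) S ℂ :=
  Matrix.of fun i k => A i (k, v k)

theorem selected_mul_eq (A : Codebook n K M) (S : Finset (Fin K)) (v : Fin K → Fin M)
    (H : Fin K → Fin L → ℂ) : selected A S v * Matrix.of H =
      selectedColumns A S v * Matrix.of fun (k : S) l => H k l := by
  ext i l
  rw [selected_mul_apply, Matrix.mul_apply]
  exact (Finset.sum_coe_sort S fun k => A i (k, v k) * H k l).symm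

theorem selected_mul_conjTranspose (A : Codebook n K M) (S : Finset (Fin K)) (v : Fin K → Fin M) :
    selected A S v * (selected A S v)ᴴ = selectedColumns A S v * (selectedColumns A S v)ᴴ := by
  ext i j
  simp only [Matrix.mul_apply, Matrix.conjTranspose_apply, selected_apply, ite_mul, zero_mul]
  rw [Finset.sum_ite_mem, Finset.univ_inter]
  refine (Finset.sum_congr rfl fun k hk => ?_).trans
    (Finset.sum_coe_sort S fun k => A i (k, v k) * star (A j (k, v k))).symm
  rw [if_pos hk]

theorem measurePreserving_restrict_rows (S : Finset (Fin K)) :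
    MeasurePreserving (fun q : (Fin K → Fin L → ℂ) × (Fin n → Fin L → ℂ) =>
        ((fun (k : S) l => q.1 k l : S → Fin L → ℂ), q.2))
      ((cGaussianArray (Fin K) (Fin L) 1).prod (cGaussianArray (Fin n) (Fin L) 1))
      ((cGaussianArray S (Fin L) 1).prod (cGaussianArray (Fin n) (Fin L) 1)) :=
  (measurePreserving_array_rows (κ := Fin L) 1
    (Subtype.val_injective (p := fun k => k ∈ S))).prod
    (MeasurePreserving.id (cGaussianArray (Fin n) (Fin L) 1))

/-- For a fixed codebook this is `badRegion_le` for the matrix of the nonzero columns, whose number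
`S.card ≤ n` provides the embedding of columns into rows. -/
theorem goodEvent_compl_le {S : Finset (Fin K)} (hS : 0 < S.card) (hSn : S.card ≤ n) (hn : 0 < n)
    (hL : 0 < L) (v : Fin K → Fin M) {ω : ℝ} (hω : 0 < ω) (hω1 : ω ≤ 1) (x y c P' : ℝ) :
    jointLaw n K L M P' (goodEvent ω c S v)ᶜ ≤
      ∫⁻ A, ENNReal.ofReal (gammaRatio (S.card * L) ((x + (1 - ω) * y - c) *
        (1 + ω • (selected A S v * (selected A S v)ᴴ)).det.re ^ (-(1 / (S.card : ℝ)))))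
          ∂(codebookLaw n K M P') +
      ENNReal.ofReal (2 - gammaRatio (S.card * L) x - gammaRatio (n * L) y) := by
  have : Nonempty (Fin n) := ⟨⟨0, hn⟩⟩
  have : Nonempty (Fin L) := ⟨⟨0, hL⟩⟩
  have : Nonempty S := (Finset.card_pos.1 hS).to_subtype
  have e : S ↪ Fin n := (Function.Embedding.nonempty_of_card_le (by simpa using hSn)).some
  rw [jointLaw_apply (measurableSet_goodEvent ω c S v).compl]
  have h2 : ENNReal.ofReal (2 - gammaRatio (S.card * L) x - gammaRatio (n * L) y) =
      ENNReal.ofReal (1 - gammaRatio (S.card * L) x) + ENNReal.ofReal (1 - gammaRatio (n * L) y) := by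
    rw [← ENNReal.ofReal_add (sub_nonneg.2 (gammaRatio_le_one hS hL x))
      (sub_nonneg.2 (gammaRatio_le_one hn hL y))]
    congr 1; ring
  rw [h2]
  calc _ ≤ ∫⁻ A, (ENNReal.ofReal (gammaRatio (S.card * L) ((x + (1 - ω) * y - c) *
        (1 + ω • (selected A S v * (selected A S v)ᴴ)).det.re ^ (-(1 / (S.card : ℝ))))) +
        (ENNReal.ofReal (1 - gammaRatio (S.card * L) x) +
          ENNReal.ofReal (1 - gammaRatio (n * L) y))) ∂(codebookLaw n K M P') := by
        refine lintegral_mono fun A => ?_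
        have h := badRegion_le (l := Fin L) e (selectedColumns A S v) hω hω1 x y c
        have hmeas : MeasurableSet {p : (S → Fin L → ℂ) × (Fin n → Fin L → ℂ) |
            ω * energy (Matrix.of p.2 + selectedColumns A S v * Matrix.of p.1) + c <
              energy (Matrix.of p.2)} :=
          measurableSet_lt (by fun_prop) (measurable_energy.comp measurable_snd)
        rw [← (measurePreserving_restrict_rows S).measure_preimage hmeas.nullMeasurableSet,
          Fintype.card_coe, Fintype.card_fin, Fintype.card_fin, add_assoc, div_eq_mul_inv,
          ← Real.rpow_neg (det_one_add_mul_conjTranspose_nonneg _ hω.le),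
          ← selected_mul_conjTranspose] at h
        refine le_trans (measure_mono ?_) h
        rintro ⟨H, Z⟩ hq
        have hq' : ¬ (energy (Matrix.of Z) ≤
          ω * energy (Matrix.of Z + selected A S v * Matrix.of H) + c) := hq
        rw [selected_mul_eq] at hq'
        exact not_le.1 hq'
    _ = _ := by rw [lintegral_add_right _ measurable_const, lintegral_const, measure_univ, mul_one]

theorem signal_energy_le {S : Finset (Fin K)} (hSn : n ≤ S.card) (hn : 0 < n)
    (hL : 0 < L) (v : Fin K → Fin M) (x P' : ℝ) :
    jointLaw n K L M P' {p | energy (Matrix.of p.2.2 + selected p.1 S v * Matrix.of p.2.1) ≤ x} ≤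
      ∫⁻ A, ENNReal.ofReal (gammaRatio (n * L) (x /
        (1 + selected A S v * (selected A S v)ᴴ).det.re ^ (1 / (n : ℝ))))
          ∂(codebookLaw n K M P') := by
  have : Nonempty (Fin n) := ⟨⟨0, hn⟩⟩
  have : Nonempty (Fin L) := ⟨⟨0, hL⟩⟩
  have e : Fin n ↪ S := (Function.Embedding.nonempty_of_card_le (by simpa using hSn)).some
  rw [jointLaw_apply (measurableSet_le (measurable_energy_signal S v) measurable_const)]
  refine lintegral_mono fun A => ?_
  have h := energy_add_mul_le (l := Fin L) e (selectedColumns A S v) x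
  have hmeas : MeasurableSet {p : (S → Fin L → ℂ) × (Fin n → Fin L → ℂ) |
      energy (Matrix.of p.2 + selectedColumns A S v * Matrix.of p.1) ≤ x} :=
    measurableSet_le (by fun_prop) measurable_const
  rw [← (measurePreserving_restrict_rows S).measure_preimage hmeas.nullMeasurableSet,
    Fintype.card_fin, Fintype.card_fin, ← selected_mul_conjTranspose] at h
  refine le_trans (measure_mono ?_) h
  rintro ⟨H, Z⟩ hq
  have hq' : energy (Matrix.of Z + selected A S v * Matrix.of H) ≤ x := hq
  rw [selected_mul_eq] at hq'
  exact hq'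

theorem noise_energy_gt (hn : 0 < n) (hL : 0 < L) (x P' : ℝ) :
    jointLaw n K L M P' {p | x < energy (Matrix.of p.2.2)} =
      ENNReal.ofReal (1 - gammaRatio (n * L) x) := by
  have : Nonempty (Fin n) := ⟨⟨0, hn⟩⟩
  have : Nonempty (Fin L) := ⟨⟨0, hL⟩⟩
  have h := cGaussianArray_energy_gt (ι := Fin n) (κ := Fin L) x
  rw [Fintype.card_fin, Fintype.card_fin] at h
  have hmz : MeasurableSet {z : Fin n → Fin L → ℂ | x < ∑ i, ∑ k, ‖z i k‖ ^ 2} :=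
    measurableSet_lt measurable_const (by fun_prop)
  have hmp := (measurePreserving_snd (μ := cGaussianArray (Fin K) (Fin L) 1)
    (ν := cGaussianArray (Fin n) (Fin L) 1)).comp (measurePreserving_snd
      (μ := codebookLaw n K M P') (ν := (cGaussianArray (Fin K) (Fin L) 1).prod
        (cGaussianArray (Fin n) (Fin L) 1)))
  rw [← h, ← hmp.measure_preimage hmz.nullMeasurableSet]
  rfl

/-- The expectation of a function of the Gram matrix depends only on the number of users. -/
theorem lintegral_gram_eq {S T : Finset (Fin K)} (h : S.card = T.card) {W w w' : Fin K → Fin M}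
    (hw : ∀ k, w' k ≠ w k) (P' : ℝ) (F : Matrix (Fin n) (Fin n) ℂ → ℝ≥0∞) :
    ∫⁻ A, F (selected A S W * (selected A S W)ᴴ) ∂(codebookLaw n K M P') =
      ∫⁻ A, F (selected A T w * (selected A T w)ᴴ) ∂(codebookLaw n K M P') :=
  lintegral_selected_eq (S₂ := ∅) (T₂ := ∅) (v' := w') P' (by simp) (by simpa using h) (by simp)
    (by simp) (fun k => (hw k).symm) (fun A₁ _ => F (A₁ * A₁ᴴ))
    (fun σ A₁ _ => by rw [submatrix_mul_conjTranspose])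

/-- The probability of the bad region. -/
theorem goodEvents_compl_le_q2 {active T : Finset (Fin K)} {t : ℕ} (ht : 0 < t) (hTc : T.card = t)
    (hn : 0 < n) (hL : 0 < L) {W w w' : Fin K → Fin M} (hw : ∀ k, w' k ≠ w k) {ω : ℝ} (hω : 0 ≤ ω)
    (hω1 : ω ≤ 1) (ν P' : ℝ) :
    jointLaw n K L M P' (⋃ S₁ ∈ active.powersetCard t, (goodEvent ω (n * L * ν) S₁ W)ᶜ) ≤
      q2 n L active.card P' T w t ω ν := by
  have hsum : ∀ (b : ℝ≥0∞) (E : Finset (Fin K) →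
      Set (Codebook n K M × (Fin K → Fin L → ℂ) × (Fin n → Fin L → ℂ))),
      (∀ S₁ : Finset (Fin K), S₁.card = t → jointLaw n K L M P' (E S₁) ≤ b) →
      jointLaw n K L M P' (⋃ S₁ ∈ active.powersetCard t, E S₁) ≤
        (active.card.choose t : ℝ≥0∞) * b := by
    intro b E hb
    refine (measure_biUnion_finset_le _ _).trans
      ((Finset.sum_le_sum fun S₁ h1 => hb S₁ (Finset.mem_powersetCard.1 h1).2).trans ?_)
    rw [Finset.sum_const, Finset.card_powersetCard, nsmul_eq_mul]
  unfold q2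
  split_ifs with h0 htn
  -- For `ω = 0` the good region involves only the noise and is the same for all `S₁`, so no
  -- binomial factor appears.
  · subst h0
    rw [← noise_energy_gt (K := K) (M := M) hn hL _ P']
    refine measure_mono ?_
    intro p hp
    simp only [Set.mem_iUnion, goodEvent, Set.mem_compl_iff, Set.mem_ofPred_eq, zero_mul, zero_add,
      not_le, exists_prop] at hp
    exact hp.choose_spec.2
  · have hωp : 0 < ω := lt_of_le_of_ne hω (Ne.symm h0)
    refine le_iInf fun η => le_iInf fun δ => le_iInf fun _ => ?_
    rw [← mul_add]
    refine hsum _ _ fun S₁ h1 => ?_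
    refine (goodEvent_compl_le (by omega) (by omega) hn hL W hωp hω1 (t * L * (1 + η))
      (n * L * (1 + δ)) (n * L * ν) P').trans (le_of_eq ?_)
    rw [h1, lintegral_gram_eq (h1.trans hTc.symm) hw P' fun B => ENNReal.ofReal (gammaRatio (t * L)
      ((t * L * (1 + η) + (1 - ω) * (n * L * (1 + δ)) - n * L * ν) *
        (1 + ω • B).det.re ^ (-(1 / (t : ℝ)))))]
    congr 1
    refine lintegral_congr fun A => ?_
    congr 2
    ring
  · have hωp : 0 < ω := lt_of_le_of_ne hω (Ne.symm h0)
    refine le_iInf fun η => le_iInf fun _ => ?_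
    set a : ℝ := n * L * (1 + η) with ha
    -- The event of large noise energy does not depend on `S₁` and is taken out of the union, so
    -- only the signal term is multiplied by the binomial coefficient.
    have hsub : (⋃ S₁ ∈ active.powersetCard t, (goodEvent ω (n * L * ν) S₁ W)ᶜ) ⊆
        (⋃ S₁ ∈ active.powersetCard t, {p : Codebook n K M × (Fin K → Fin L → ℂ) ×
          (Fin n → Fin L → ℂ) | energy (Matrix.of p.2.2 + selected p.1 S₁ W * Matrix.of p.2.1) ≤
            n * L * (1 + η - ν) / ω}) ∪ {p | a < energy (Matrix.of p.2.2)} := by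
      intro p hp
      simp only [Set.mem_iUnion, goodEvent, Set.mem_compl_iff, Set.mem_ofPred_eq, not_le,
        exists_prop] at hp
      obtain ⟨S₁, h1, hp⟩ := hp
      by_cases hz : a < energy (Matrix.of p.2.2)
      · exact Or.inr hz
      · left
        simp only [Set.mem_iUnion, exists_prop, Set.mem_ofPred_eq]
        refine ⟨S₁, h1, ?_⟩
        rw [le_div_iff₀ hωp]
        rw [not_lt] at hz
        have : (n : ℝ) * L * (1 + η - ν) = a - n * L * ν := by rw [ha]; ring
        rw [this]
        linarith
    refine (measure_mono hsub).trans ((measure_union_le _ _).trans (add_le_add ?_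
      (noise_energy_gt hn hL a P').le))
    refine hsum _ _ fun S₁ h1 => ?_
    refine (signal_energy_le (by omega) hn hL W (n * L * (1 + η - ν) / ω) P').trans (le_of_eq ?_)
    rw [lintegral_gram_eq (h1.trans hTc.symm) hw P' fun B => ENNReal.ofReal (gammaRatio (n * L)
      (n * L * (1 + η - ν) / ω / (1 + B).det.re ^ (1 / (n : ℝ))))]
    simp_rw [div_div]

end BadRegion

/-- The set `S₂₂` of `t - t₀` inactive users witnesses `t - t₀ ≤ K - K_a`, the condition under which
`S₂ t t₀` is constrained. -/
theorem AdmissibleSets.card_pattern {K : ℕ} {active : Finset (Fin K)} {S₁ : ℕ → Finset (Fin K)}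
    {S₂ : ℕ → ℕ → Finset (Fin K)} (hS : AdmissibleSets active S₁ S₂) {t t₀ : ℕ} (ht : 1 ≤ t)
    (htK : t ≤ active.card) (h0 : t₀ ≤ t) {S₂₂ : Finset (Fin K)} (h22 : Disjoint S₂₂ active)
    (h22c : S₂₂.card = t - t₀) : (S₁ t ∩ S₂ t t₀).card = t₀ ∧
      (S₁ t \ S₂ t t₀).card = t - t₀ ∧ (S₂ t t₀ \ S₁ t).card = t - t₀ := by
  obtain ⟨⟨hT, hTc⟩, hT2⟩ := hS t ht htK
  have hle : S₂₂.card ≤ K - active.card := by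
    have h := Finset.card_le_card (Finset.subset_compl_iff_disjoint_right.2 h22)
    rwa [Finset.card_compl, Fintype.card_fin] at h
  obtain ⟨T₂₁, T₂₂, hT2e, hT21, hT21c, hT22, hT22c⟩ := hT2 t₀ h0 (h22c ▸ hle)
  rw [hT2e]
  exact MassiveAccess.card_pattern hT hTc hT21 hT21c hT22 hT22c

/-- The bound from the good region. -/
theorem errorCountEvent_le_p1 {n K L M : ℕ} {active : Finset (Fin K)} {W w w' : Fin K → Fin M}
    {dec : Codebook n K M → (Fin n → Fin L → ℂ) → (Fin K → Fin L → ℂ) → Estimate K M}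
    (hdec : IsMLDecoder active.card dec) (hn : 0 < n) (hL : 0 < L) {S₁ : ℕ → Finset (Fin K)}
    {S₂ : ℕ → ℕ → Finset (Fin K)} (hS : AdmissibleSets active S₁ S₂) (hw : ∀ k, w' k ≠ w k)
    {t : ℕ} (ht : 1 ≤ t) (htK : t ≤ active.card) (P' : ℝ) :
    jointLaw n K L M P' (errorCountEvent active W dec t) ≤
      p1 n L active.card P' (S₁ t) (S₂ t) w w' t := by
  have hTc := (hS t ht htK).1.2
  refine le_iInf fun ω => le_iInf fun ν => le_iInf fun ⟨hω, hω1, _⟩ => ?_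
  refine (errorCountEvent_le W w hdec t P' (fun S => goodEvent ω (n * L * ν) S W)
    (fun t₀ => (((M - 1) ^ t₀ * M ^ (t - t₀) : ℕ) : ℝ≥0∞) * ∫⁻ A, chernoffMin L ω ν
      (selected A (S₁ t) w) (selected A (S₂ t t₀) w') ∂(codebookLaw n K M P')) ?_).trans
    (add_le_add (le_of_eq ?_) (goodEvents_compl_le_q2 ht hTc hn hL hw hω hω1 ν P'))
  · intro S h1 h1c t₀ h0 S₂₁ h21 h21c S₂₂ h22 h22c
    exact confusions_inter_good_le w hw h1 h1c h21 h21c h22 h22c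
      (hS.card_pattern ht htK h0 h22 h22c) hω1 ν P'
  · refine Finset.sum_congr rfl fun t₀ _ => ?_
    rw [← mul_assoc, ← Nat.cast_mul, countC, ← mul_assoc]

/-! ### Gallager's bound for the error events -/

section Gallager

variable {n K L M : ℕ}

/-- The codewords that are not sent by the users in `S`. -/
abbrev OtherCodewords (S : Finset (Fin K)) (W : Fin K → Fin M) :=
  {km : Fin K × Fin M // ¬ (km.1 ∈ S ∧ km.2 = W km.1)}

/-- The codebook is split into the codewords sent by the users in `S` and the others. -/
def splitCodebook (S : Finset (Fin K)) (W : Fin K → Fin M)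
    (p : Codebook n K M × (Fin K → Fin L → ℂ) × (Fin n → Fin L → ℂ)) :
    (Fin K → Fin L → ℂ) × ((Fin n → Fin L → ℂ) × (Fin n → S → ℂ)) ×
      (Fin n → OtherCodewords S W → ℂ) :=
  (p.2.1, ((p.2.2, fun i k => p.1 i (k, W k)), fun i km => p.1 i km))

/-- The sent and the other codewords occupy disjoint columns of the codebook, hence are independent;
the rest is reassociation of products. -/
theorem measurePreserving_splitCodebook (S : Finset (Fin K)) (W : Fin K → Fin M) (P' : ℝ) :
    MeasurePreserving (splitCodebook (n := n) (L := L) S W) (jointLaw n K L M P')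
      ((cGaussianArray (Fin K) (Fin L) 1).prod (((cGaussianArray (Fin n) (Fin L) 1).prod
        (cGaussianArray (Fin n) S P'.toNNReal)).prod
          (cGaussianArray (Fin n) (OtherCodewords S W) P'.toNNReal))) := by
  have hinj : Function.Injective (Sum.elim (fun k : S => ((k : Fin K), W k))
      (fun km : OtherCodewords S W => (km : Fin K × Fin M))) := by
    refine Function.Injective.sumElim ?_ Subtype.val_injective ?_
    · intro a b h
      exact Subtype.ext (congrArg Prod.fst h)
    · rintro a ⟨b, hb⟩ rfl
      exact hb ⟨a.2, rfl⟩
  have h1 := measurePreserving_array_columns_pair (ι := Fin n) P'.toNNReal hinj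
  have h2 := h1.prod (MeasurePreserving.id
    ((cGaussianArray (Fin K) (Fin L) 1).prod (cGaussianArray (Fin n) (Fin L) 1)))
  have h3 := Measure.measurePreserving_swap.comp h2
  have h4 := (measurePreserving_prodAssoc (cGaussianArray (Fin K) (Fin L) 1)
    (cGaussianArray (Fin n) (Fin L) 1) ((cGaussianArray (Fin n) S P'.toNNReal).prod
          (cGaussianArray (Fin n) (OtherCodewords S W) P'.toNNReal))).comp h3
  exact ((MeasurePreserving.id (cGaussianArray (Fin K) (Fin L) 1)).prod
    (measurePreserving_prodAssoc (cGaussianArray (Fin n) (Fin L) 1)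
      (cGaussianArray (Fin n) S P'.toNNReal)
      (cGaussianArray (Fin n) (OtherCodewords S W) P'.toNNReal)).symm).comp h4

theorem measurable_energy_residual_rows (S₁ S₂ : Finset (Fin K)) {κ : Type*} (e : S₂ → κ) :
    Measurable fun q : (Fin K → Fin L → ℂ) × ((Fin n → Fin L → ℂ) × (Fin n → S₁ → ℂ)) ×
      (Fin n → κ → ℂ) => energy (residual (rows q.1 S₁) (rows q.1 S₂) e q.2) := by
  simp only [energy, residual, Matrix.sub_apply, Matrix.add_apply, Matrix.mul_apply,
    Matrix.of_apply, rows]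
  fun_prop

/-- For fixed fading this is `gallager_union_le`. No false codeword is among those sent by `S₁`: the
users in `S₂₁` have another message, and those in `S₂₂` are outside `S₁`. -/
theorem confusions_le_gallager {S₁ S₂₁ S₂₂ : Finset (Fin K)} (W d : Fin K → Fin M)
    (h22 : Disjoint S₂₂ S₁) {P' : ℝ} (hP' : 0 ≤ P') {ρ β : ℝ} (hρ : 0 ≤ ρ) (hρ1 : ρ ≤ 1)
    (hβ : 0 ≤ β) (hρβ : ρ * β < 1) :
    jointLaw n K L M P' (⋃ v' ∈ altMessages W d S₂₁ S₂₂, confusionEvent S₁ (S₂₁ ∪ S₂₂) W v') ≤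
      ENNReal.ofReal (((altMessages W d S₂₁ S₂₂).card : ℝ) ^ ρ) *
      ∫⁻ H, ENNReal.ofReal (Real.exp (
        (1 - ρ) * n * Real.log
          ((1 + (β * P') • ((rows H (S₂₁ ∪ S₂₂))ᴴ * rows H (S₂₁ ∪ S₂₂))).det.re)
        - n * Real.log ((1 + (β * (1 - ρ * β) * P') • (ρ • ((rows H S₁)ᴴ * rows H S₁) +
            (rows H (S₂₁ ∪ S₂₂))ᴴ * rows H (S₂₁ ∪ S₂₂))).det.re)))
          ∂(cGaussianArray (Fin K) (Fin L) 1) := by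
  set S₂ := S₂₁ ∪ S₂₂ with hS₂
  set V := altMessages W d S₂₁ S₂₂ with hV
  let e : V → S₂ → OtherCodewords S₁ W := fun v' k => ⟨(k, v'.1 k), by
    rintro ⟨hk1, hk2⟩
    rcases Finset.mem_union.1 k.2 with h | h
    · exact altMessages_ne v'.2 h hk2.symm
    · exact Finset.disjoint_left.1 h22 h hk1⟩
  have he : ∀ v', Function.Injective (e v') := fun v' a b h =>
    Subtype.ext (congrArg (fun z : OtherCodewords S₁ W => z.1.1) h)
  let E : Set ((Fin K → Fin L → ℂ) × ((Fin n → Fin L → ℂ) × (Fin n → S₁ → ℂ)) ×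
      (Fin n → OtherCodewords S₁ W → ℂ)) :=
    {q | ∃ v' ∈ (Finset.univ : Finset V),
      energy (residual (rows q.1 S₁) (rows q.1 S₂) (e v') q.2) ≤ energy (Matrix.of q.2.1.1)}
  have hEm : MeasurableSet E := by
    have : E = ⋃ v' : V, {q | energy (residual (rows q.1 S₁) (rows q.1 S₂) (e v') q.2) ≤
        energy (Matrix.of q.2.1.1)} := by
      ext q
      simp [E]
    rw [this]
    refine MeasurableSet.iUnion fun v' => measurableSet_le
      (measurable_energy_residual_rows S₁ S₂ (e v')) ?_
    exact measurable_energy.comp (measurable_fst.comp (measurable_fst.comp measurable_snd))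
  have hpre : (⋃ v' ∈ V, confusionEvent S₁ S₂ W v') = splitCodebook (n := n) (L := L) S₁ W ⁻¹' E := by
    ext ⟨A, H, Z⟩
    have hres : ∀ v' : V, residual (rows H S₁) (rows H S₂) (e v')
        (splitCodebook S₁ W (A, H, Z)).2 = errorSignal S₁ S₂ W v'.1 A H Z := by
      intro v'
      ext i l
      rw [errorSignal_apply, residual, Matrix.sub_apply, Matrix.add_apply, Matrix.mul_apply,
        Matrix.mul_apply, add_sub_assoc]
      refine congrArg₂ _ rfl (congrArg₂ _ ?_ ?_)
      · exact Finset.sum_coe_sort S₁ fun k => A i (k, W k) * H k l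
      · exact Finset.sum_coe_sort S₂ fun k => A i (k, v'.1 k) * H k l
    have hiff : (A, H, Z) ∈ splitCodebook S₁ W ⁻¹' E ↔ ∃ v' : V,
        energy (residual (rows H S₁) (rows H S₂) (e v') (splitCodebook S₁ W (A, H, Z)).2) ≤
          energy (Matrix.of Z) :=
      ⟨fun ⟨v', _, h⟩ => ⟨v', h⟩, fun ⟨v', h⟩ => ⟨v', Finset.mem_univ _, h⟩⟩
    simp only [hiff, hres, Set.mem_iUnion, exists_prop, Subtype.exists]
    rfl
  rw [hpre, (measurePreserving_splitCodebook S₁ W P').measure_preimage hEm.nullMeasurableSet,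
    Measure.prod_apply hEm, ← lintegral_const_mul']
  · refine lintegral_mono fun H => ?_
    have h := gallager_union_le (n := Fin n) P'.toNNReal (rows H S₁) (rows H S₂) Finset.univ e
      (fun v' _ => he v') hρ hρ1 hβ hρβ
    rw [Real.coe_toNNReal P' hP', Fintype.card_fin, Finset.card_univ, Fintype.card_coe] at h
    exact h
  · exact ENNReal.ofReal_ne_top

theorem card_altMessages_rpow_le (W d : Fin K → Fin M) {S₂₁ S₂₂ : Finset (Fin K)} {t t₀ : ℕ}
    (h : Disjoint S₂₁ S₂₂) (h0 : t₀ ≤ t) (h21 : S₂₁.card = t₀) (h22 : S₂₂.card = t - t₀) {ρ : ℝ}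
    (hρ : 0 ≤ ρ) : ((altMessages W d S₂₁ S₂₂).card : ℝ) ^ ρ ≤ (M : ℝ) ^ (ρ * t) := by
  have h1 : (altMessages W d S₂₁ S₂₂).card ≤ M ^ t := by
    rw [card_altMessages W d h, h21, h22]
    calc _ ≤ M ^ t₀ * M ^ (t - t₀) := Nat.mul_le_mul_right _ (Nat.pow_le_pow_left (Nat.sub_le _ _) _)
      _ = M ^ t := by rw [← pow_add, Nat.add_sub_cancel' h0]
  rw [mul_comm, Real.rpow_mul (Nat.cast_nonneg M), Real.rpow_natCast]
  exact Real.rpow_le_rpow (Nat.cast_nonneg _) (by exact_mod_cast h1) hρ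

/-- The bound from Gallager's `ρ`-trick. -/
theorem errorCountEvent_le_p2 {active : Finset (Fin K)} (W : Fin K → Fin M)
    {dec : Codebook n K M → (Fin n → Fin L → ℂ) → (Fin K → Fin L → ℂ) → Estimate K M}
    (hdec : IsMLDecoder active.card dec) {S₁ : ℕ → Finset (Fin K)}
    {S₂ : ℕ → ℕ → Finset (Fin K)} (hS : AdmissibleSets active S₁ S₂)
    {t : ℕ} (ht : 1 ≤ t) (htK : t ≤ active.card) {P' : ℝ} (hP' : 0 ≤ P') :
    jointLaw n K L M P' (errorCountEvent active W dec t) ≤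
      p2 n L active.card M P' (S₁ t) (S₂ t) t := by
  refine le_iInf fun ρ => le_iInf fun β => le_iInf fun ⟨hρ, hρ1, hβ, hρβ⟩ => ?_
  let F : Matrix (Fin L) (Fin L) ℂ → Matrix (Fin L) (Fin L) ℂ → ℝ≥0∞ := fun X Y =>
    ENNReal.ofReal (Real.exp ((1 - ρ) * n * Real.log ((1 + (β * P') • Y).det.re)
      - n * Real.log ((1 + (β * (1 - ρ * β) * P') • (ρ • X + Y)).det.re)))
  -- The good region is the whole space, so the complement term vanishes.
  refine (errorCountEvent_le W W hdec t P' (fun _ => Set.univ)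
    (fun t₀ => ENNReal.ofReal ((M : ℝ) ^ (ρ * t)) * ∫⁻ H, F ((rows H (S₁ t))ᴴ * rows H (S₁ t))
      ((rows H (S₂ t t₀))ᴴ * rows H (S₂ t t₀)) ∂(cGaussianArray (Fin K) (Fin L) 1)) ?_).trans
    (le_of_eq ?_)
  · intro S h1 h1c t₀ h0 S₂₁ h21 h21c S₂₂ h22 h22c
    have hd : Disjoint S₂₂ S := Finset.disjoint_of_subset_right h1 h22
    rw [Set.inter_univ]
    refine (confusions_le_gallager W W hd hP' hρ hρ1 hβ hρβ).trans (mul_le_mul'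
      (ENNReal.ofReal_le_ofReal (card_altMessages_rpow_le W W
        (Finset.disjoint_of_subset_left h21 hd.symm) h0 h21c h22c hρ)) (le_of_eq ?_))
    obtain ⟨hc, hc1, hc2⟩ := card_pattern h1 h1c h21 h21c h22 h22c
    obtain ⟨ht0, ht1, ht2⟩ := hS.card_pattern ht htK h0 h22 h22c
    exact lintegral_rows_eq (hc.trans ht0.symm) (hc1.trans ht1.symm) (hc2.trans ht2.symm) F
  · simp only [Set.compl_univ, Set.iUnion_empty, measure_empty, add_zero]
    refine Finset.sum_congr rfl fun t₀ _ => ?_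
    rw [← mul_assoc]

end Gallager

/-! ### The maximum-likelihood decoder -/

section Decoder

variable {n K L M : ℕ}

theorem measurable_metric (e : Estimate K M) : Measurable
    fun p : Codebook n K M × (Fin n → Fin L → ℂ) × (Fin K → Fin L → ℂ) =>
      metric p.1 p.2.1 p.2.2 e := by
  have h : ∀ (k : Fin K) (i : Fin n) (l : Fin L), Measurable
      fun p : Codebook n K M × (Fin n → Fin L → ℂ) × (Fin K → Fin L → ℂ) =>
        (e k).elim 0 (fun m => p.2.2 k l * p.1 i (k, m)) := by
    intro k i l
    cases e k with
    | none => exact measurable_const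
    | some m => simp only [Option.elim_some]; fun_prop
  unfold metric
  refine Finset.measurable_sum _ fun l _ => Finset.measurable_sum _ fun i _ => ?_
  have h' := Finset.measurable_sum Finset.univ fun k _ => h k i l
  have h2 : Measurable fun p : Codebook n K M × (Fin n → Fin L → ℂ) × (Fin K → Fin L → ℂ) =>
    p.2.1 i l := by fun_prop
  exact ((h2.sub h').norm).pow_const 2

/-- The estimates are enumerated by `ℕ`, with repetitions, and ties are resolved by taking the first
minimizer, which is a measurable choice. -/
theorem exists_isMLDecoder {active : Finset (Fin K)} (hM : 0 < M) :
    ∃ dec : Codebook n K M → (Fin n → Fin L → ℂ) → (Fin K → Fin L → ℂ) → Estimate K M,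
      IsMLDecoder active.card dec := by
  classical
  have hne : ∃ e : Estimate K M, numDetected e = active.card := by
    refine ⟨fun k => if k ∈ active then some ⟨0, hM⟩ else none, ?_⟩
    unfold numDetected
    congr 1
    ext k
    by_cases hk : k ∈ active <;> simp [hk]
  obtain ⟨g, hg⟩ := exists_surjective_nat (Estimate K M)
  let C := {e : Estimate K M // numDetected e = active.card}
  let p : Codebook n K M × (Fin n → Fin L → ℂ) × (Fin K → Fin L → ℂ) → ℕ → Prop := fun x N =>
    numDetected (g N) = active.card ∧
      ∀ e : C, metric x.1 x.2.1 x.2.2 (g N) ≤ metric x.1 x.2.1 x.2.2 e.1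
  have hp : ∀ x, ∃ N, p x N := by
    intro x
    have : Nonempty C := ⟨⟨hne.choose, hne.choose_spec⟩⟩
    obtain ⟨e₀, he₀⟩ := Finite.exists_min fun e : C => metric x.1 x.2.1 x.2.2 e.1
    obtain ⟨N, hN⟩ := hg e₀.1
    refine ⟨N, ?_, fun e => ?_⟩
    · rw [hN]; exact e₀.2
    · rw [hN]; exact he₀ e
  have hm : ∀ N, MeasurableSet {x | p x N} := by
    intro N
    have : {x | p x N} = {x | numDetected (g N) = active.card} ∩ ⋂ e : C,
        {x | metric x.1 x.2.1 x.2.2 (g N) ≤ metric x.1 x.2.1 x.2.2 e.1} := by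
      ext x
      simp [p]
    rw [this]
    exact (MeasurableSet.const _).inter (MeasurableSet.iInter fun e =>
      measurableSet_le (measurable_metric _) (measurable_metric _))
  refine ⟨fun A Y H => g (Nat.find (hp (A, Y, H))), fun e => ?_, fun A Y H => ?_,
    fun A Y H e he => ?_⟩
  · exact measurable_find hp hm (MeasurableSet.of_discrete (s := {N | g N = e}))
  · exact (Nat.find_spec (hp (A, Y, H))).1
  · exact (Nat.find_spec (hp (A, Y, H))).2 ⟨e, he⟩

variable {dec : Codebook n K M → (Fin n → Fin L → ℂ) → (Fin K → Fin L → ℂ) → Estimate K M}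

theorem IsMLDecoder.measurableSet_preimage {Ka : ℕ} (hdec : IsMLDecoder Ka dec)
    (R : Set (Estimate K M)) : MeasurableSet
      {p : Codebook n K M × (Fin n → Fin L → ℂ) × (Fin K → Fin L → ℂ) |
        dec p.1 p.2.1 p.2.2 ∈ R} := by
  have : {p : Codebook n K M × (Fin n → Fin L → ℂ) × (Fin K → Fin L → ℂ) |
      dec p.1 p.2.1 p.2.2 ∈ R} = ⋃ e ∈ R, {p | dec p.1 p.2.1 p.2.2 = e} := by
    ext p
    simp
  rw [this]
  exact MeasurableSet.biUnion (Set.to_countable R) fun e _ => hdec.measurable e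

theorem measurable_received {X : Codebook n K M → Codebook n K M} (hX : Measurable X)
    (active : Finset (Fin K)) (W : Fin K → Fin M) :
    Measurable fun p : Codebook n K M × (Fin K → Fin L → ℂ) × (Fin n → Fin L → ℂ) =>
      received active (X p.1) W p.2.1 p.2.2 := by
  have h : ∀ i km, Measurable
      fun p : Codebook n K M × (Fin K → Fin L → ℂ) × (Fin n → Fin L → ℂ) => X p.1 i km :=
    fun i km => (measurable_pi_apply km).comp ((measurable_pi_apply i).comp (hX.comp measurable_fst))
  refine measurable_pi_lambda _ fun i => measurable_pi_lambda _ fun l => ?_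
  have hH : ∀ k, Measurable
      fun p : Codebook n K M × (Fin K → Fin L → ℂ) × (Fin n → Fin L → ℂ) => p.2.1 k l :=
    fun k => by fun_prop
  have hZ : Measurable
      fun p : Codebook n K M × (Fin K → Fin L → ℂ) × (Fin n → Fin L → ℂ) => p.2.2 i l := by fun_prop
  exact (Finset.measurable_sum active fun k _ => (hH k).mul (h i (k, W k))).add hZ

theorem measurable_truncateCodebook (P : ℝ) :
    Measurable (truncateCodebook P : Codebook n K M → Codebook n K M) := by
  refine measurable_pi_lambda _ fun i => measurable_pi_lambda _ fun km => ?_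
  unfold truncateCodebook
  refine Measurable.ite (measurableSet_le ?_ measurable_const) ?_ measurable_const
  · fun_prop
  · fun_prop

/-- The estimate belongs to `R` when the codebook `X A` is transmitted. -/
def decodeEvent (active : Finset (Fin K)) (X : Codebook n K M → Codebook n K M) (W : Fin K → Fin M)
    (dec : Codebook n K M → (Fin n → Fin L → ℂ) → (Fin K → Fin L → ℂ) → Estimate K M)
    (R : Set (Estimate K M)) :
    Set (Codebook n K M × (Fin K → Fin L → ℂ) × (Fin n → Fin L → ℂ)) :=
  {p | dec p.1 (received active (X p.1) W p.2.1 p.2.2) p.2.1 ∈ R}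

theorem IsMLDecoder.measurableSet_decodeEvent {Ka : ℕ} (hdec : IsMLDecoder Ka dec)
    (active : Finset (Fin K)) {X : Codebook n K M → Codebook n K M} (hX : Measurable X)
    (W : Fin K → Fin M) (R : Set (Estimate K M)) : MeasurableSet (decodeEvent active X W dec R) := by
  have h : Measurable fun p : Codebook n K M × (Fin K → Fin L → ℂ) × (Fin n → Fin L → ℂ) =>
      (p.1, received active (X p.1) W p.2.1 p.2.2, p.2.1) :=
    measurable_fst.prodMk ((measurable_received hX active W).prodMk
      (measurable_fst.comp measurable_snd))
  exact h (hdec.measurableSet_preimage R)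

/-- The sum over the users of the error probabilities, in terms of the number of errors. -/
theorem sum_measure_decodeEvent {Ka : ℕ} (hdec : IsMLDecoder Ka dec) (active : Finset (Fin K))
    (W : Fin K → Fin M) (P' : ℝ) :
    ∑ k ∈ active, jointLaw n K L M P' (decodeEvent active id W dec {e | e k ≠ some (W k)}) =
      ∑ t ∈ Finset.Icc 1 active.card,
        (t : ℝ≥0∞) * jointLaw n K L M P' (errorCountEvent active W dec t) := by
  classical
  have hm1 : ∀ k, MeasurableSet (decodeEvent active id W dec {e | e k ≠ some (W k)}) := fun k =>
    hdec.measurableSet_decodeEvent active measurable_id W _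
  have hm2 : ∀ t, MeasurableSet (errorCountEvent active W dec t) := fun t =>
    hdec.measurableSet_decodeEvent active measurable_id W {e | (errorSet active W e).card = t}
  have e1 : ∑ k ∈ active, jointLaw n K L M P'
      (decodeEvent active id W dec {e | e k ≠ some (W k)}) = ∫⁻ p, ∑ k ∈ active,
        (decodeEvent active id W dec {e | e k ≠ some (W k)}).indicator 1 p
          ∂(jointLaw n K L M P') := by
    rw [lintegral_finsetSum]
    · exact Finset.sum_congr rfl fun k _ => (lintegral_indicator_one (hm1 k)).symm
    · exact fun k _ => measurable_one.indicator (hm1 k)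
  have e2 : ∑ t ∈ Finset.Icc 1 active.card,
        (t : ℝ≥0∞) * jointLaw n K L M P' (errorCountEvent active W dec t) =
      ∫⁻ p, ∑ t ∈ Finset.Icc 1 active.card,
        (t : ℝ≥0∞) * (errorCountEvent active W dec t).indicator 1 p ∂(jointLaw n K L M P') := by
    rw [lintegral_finsetSum]
    · refine Finset.sum_congr rfl fun t _ => ?_
      rw [lintegral_const_mul _ (measurable_one.indicator (hm2 t)), lintegral_indicator_one (hm2 t)]
    · exact fun t _ => (measurable_one.indicator (hm2 t)).const_mul _
  rw [e1, e2]
  refine lintegral_congr fun p => ?_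
  set e := dec p.1 (received active p.1 W p.2.1 p.2.2) p.2.1 with he
  -- Pointwise both integrands equal the number of misdecoded active users; the missing index `t =
  -- 0` would contribute nothing.
  have h1 : ∑ k ∈ active, (decodeEvent active id W dec {e | e k ≠ some (W k)}).indicator
      1 p = ((errorSet active W e).card : ℝ≥0∞) := by
    rw [errorSet, Finset.card_filter, Nat.cast_sum]
    refine Finset.sum_congr rfl fun k _ => ?_
    rw [Set.indicator_apply, Nat.cast_ite, Nat.cast_one, Nat.cast_zero]
    exact if_congr Iff.rfl rfl rfl
  have h2 : ∀ t : ℕ, (errorCountEvent active W dec t).indicator 1 p =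
      if (errorSet active W e).card = t then (1 : ℝ≥0∞) else 0 := fun t => by
    rw [Set.indicator_apply]
    exact if_congr Iff.rfl rfl rfl
  simp_rw [h1, h2, mul_ite, mul_one, mul_zero]
  rw [Finset.sum_ite_eq]
  split_ifs with h
  · rfl
  · have hle : (errorSet active W e).card ≤ active.card := Finset.card_filter_le _ _
    rw [Finset.mem_Icc, not_and] at h
    have h0 : (errorSet active W e).card = 0 := by
      by_contra h0
      exact h (Nat.one_le_iff_ne_zero.2 h0) hle
    rw [h0, Nat.cast_zero]

end Decoder

/-! ### The truncation of the codebook -/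

section Truncation

variable {n K L M : ℕ}

theorem codeword_energy_gt (hn : 0 < n) {P' : ℝ} (hP' : 0 < P') (x : ℝ) (km : Fin K × Fin M) :
    codebookLaw n K M P' {A | x < ∑ i, ‖A i km‖ ^ 2} =
      ENNReal.ofReal (1 - gammaRatio n (x / P')) := by
  have : Nonempty (Fin n) := ⟨⟨0, hn⟩⟩
  have h1 := measurePreserving_array_columns (ι := Fin n) (κ := Fin K × Fin M) P'.toNNReal
    (e := fun _ : Unit => km) (Function.injective_of_subsingleton _)
  have h2 := measurePreserving_array_smul (ι := Fin n) (κ := Unit) P'.toNNReal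
  have hm : MeasurableSet {z : Fin n → Unit → ℂ | x < ∑ i, ‖z i ()‖ ^ 2} :=
    measurableSet_lt measurable_const (by fun_prop)
  have h3 := cGaussianArray_energy_gt (ι := Fin n) (κ := Unit) (x / P')
  rw [Fintype.card_fin, Fintype.card_unit, Nat.cast_one, mul_one] at h3
  have h4 : {A : Codebook n K M | x < ∑ i, ‖A i km‖ ^ 2} =
      (fun (x : Codebook n K M) i (_ : Unit) => x i km) ⁻¹'
        {z : Fin n → Unit → ℂ | x < ∑ i, ‖z i ()‖ ^ 2} := rfl
  rw [h4, codebookLaw, h1.measure_preimage hm.nullMeasurableSet,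
    ← h2.measure_preimage hm.nullMeasurableSet, ← h3]
  congr 1
  ext z
  have h5 : ∀ i, ‖((√(P'.toNNReal : ℝ) : ℝ) : ℂ) * z i ()‖ ^ 2 = P' * ‖z i ()‖ ^ 2 := fun i => by
    rw [norm_mul, mul_pow, Complex.norm_real, Real.norm_eq_abs, sq_abs,
      Real.sq_sqrt (NNReal.coe_nonneg _), Real.coe_toNNReal _ hP'.le]
  simp only [Set.mem_preimage, Set.mem_ofPred_eq, h5, ← Finset.mul_sum, Finset.univ_unique,
    Finset.sum_singleton]
  rw [div_lt_iff₀' hP']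

theorem powerConstraint_truncateCodebook {P : ℝ} (hP : 0 ≤ P) (A : Codebook n K M) :
    PowerConstraint P (truncateCodebook P A) := by
  intro k m
  by_cases h : ∑ j, ‖A j (k, m)‖ ^ 2 ≤ n * P
  · simpa only [truncateCodebook, if_pos h] using h
  · simp only [truncateCodebook, if_neg h, norm_zero]
    simpa using mul_nonneg (Nat.cast_nonneg n) hP

/-- Only the sent codewords enter the received signal, and the decoder uses the untruncated
codebook; so truncation has no effect unless it alters a sent codeword. -/
theorem decodeEvent_truncate_subset (active : Finset (Fin K)) (P : ℝ) (W : Fin K → Fin M)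
    (dec : Codebook n K M → (Fin n → Fin L → ℂ) → (Fin K → Fin L → ℂ) → Estimate K M)
    (R : Set (Estimate K M)) : decodeEvent active (truncateCodebook P) W dec R ⊆
      decodeEvent active id W dec R ∪
        ⋃ j ∈ active, {p | n * P < ∑ i, ‖p.1 i (j, W j)‖ ^ 2} := by
  rintro ⟨A, H, Z⟩ hp
  by_cases hb : ∃ j ∈ active, n * P < ∑ i, ‖A i (j, W j)‖ ^ 2
  · obtain ⟨j, hj, h⟩ := hb
    exact Or.inr (Set.mem_biUnion hj h)
  · left
    push Not at hb
    have h : received active (truncateCodebook P A) W H Z = received active A W H Z := by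
      funext i l
      unfold received
      congr 1
      refine Finset.sum_congr rfl fun k hk => ?_
      rw [truncateCodebook, if_pos (hb k hk)]
    have hp' : dec A (received active (truncateCodebook P A) W H Z) H ∈ R := hp
    rw [h] at hp'
    exact hp'

theorem measure_truncation_le (hn : 0 < n) (active : Finset (Fin K)) (W : Fin K → Fin M) {P P' : ℝ}
    (hP' : 0 < P') : jointLaw n K L M P' (⋃ j ∈ active, {p | n * P < ∑ i, ‖p.1 i (j, W j)‖ ^ 2}) ≤
      p0 n active.card P P' := by
  refine (measure_biUnion_finset_le _ _).trans (le_of_eq ?_)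
  have h : ∀ j, jointLaw n K L M P' {p | n * P < ∑ i, ‖p.1 i (j, W j)‖ ^ 2} =
      ENNReal.ofReal (1 - gammaRatio n (n * P / P')) := by
    intro j
    rw [← codeword_energy_gt hn hP' (n * P) (j, W j)]
    have hm : MeasurableSet {A : Codebook n K M | n * P < ∑ i, ‖A i (j, W j)‖ ^ 2} :=
      measurableSet_lt measurable_const (by fun_prop)
    exact (measurePreserving_fst (μ := codebookLaw n K M P')
      (ν := (cGaussianArray (Fin K) (Fin L) 1).prod
        (cGaussianArray (Fin n) (Fin L) 1))).measure_preimage hm.nullMeasurableSet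
  simp_rw [h]
  rw [Finset.sum_const, nsmul_eq_mul, p0, ENNReal.ofReal_mul (Nat.cast_nonneg _),
    ENNReal.ofReal_natCast]

end Truncation

/-! ### The per-user probability of error -/

section PUPE

variable {n K L M : ℕ}
  {dec : Codebook n K M → (Fin n → Fin L → ℂ) → (Fin K → Fin L → ℂ) → Estimate K M}

/-- Each of the `K_a` users pays `p0` for the truncation, and the division by `K_a` leaves `p0`
once. The bound does not depend on the messages `W`. -/
theorem sum_measure_truncated_le {active : Finset (Fin K)} (hdec : IsMLDecoder active.card dec)
    (hn : 0 < n) (hL : 0 < L) (hKa : 0 < active.card) {S₁ : ℕ → Finset (Fin K)}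
    {S₂ : ℕ → ℕ → Finset (Fin K)} (hS : AdmissibleSets active S₁ S₂) {w w' : Fin K → Fin M}
    (hw : ∀ k, w' k ≠ w k) (W : Fin K → Fin M) {P P' : ℝ} (hP' : 0 < P') :
    (∑ k ∈ active, jointLaw n K L M P'
      (decodeEvent active (truncateCodebook P) W dec {e | e k ≠ some (W k)})) / active.card ≤
        pupeBound n L active.card P P' S₁ S₂ w w' := by
  have hc0 : (active.card : ℝ≥0∞) ≠ 0 := Nat.cast_ne_zero.2 hKa.ne'
  have hct : (active.card : ℝ≥0∞) ≠ ∞ := ENNReal.natCast_ne_top _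
  have h1 : ∑ k ∈ active, jointLaw n K L M P'
      (decodeEvent active (truncateCodebook P) W dec {e | e k ≠ some (W k)}) ≤
      (∑ k ∈ active, jointLaw n K L M P' (decodeEvent active id W dec {e | e k ≠ some (W k)})) +
        active.card * p0 n active.card P P' := by
    rw [← nsmul_eq_mul, ← Finset.sum_const, ← Finset.sum_add_distrib]
    refine Finset.sum_le_sum fun k _ => ?_
    exact (measure_mono (decodeEvent_truncate_subset active P W dec _)).trans
      ((measure_union_le _ _).trans (add_le_add le_rfl (measure_truncation_le hn active W hP')))
  refine (ENNReal.div_le_div_right h1 _).trans ?_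
  rw [sum_measure_decodeEvent hdec, ENNReal.add_div, add_comm, mul_comm,
    ENNReal.mul_div_cancel_right hc0 hct, pupeBound]
  refine add_le_add le_rfl ?_
  rw [div_eq_mul_inv, Finset.sum_mul]
  refine Finset.sum_le_sum fun t ht => ?_
  rw [Finset.mem_Icc] at ht
  rw [mul_right_comm, ← div_eq_mul_inv]
  refine mul_le_mul' le_rfl (le_min prob_le_one (le_min ?_ ?_))
  · exact errorCountEvent_le_p1 hdec hn hL hS hw ht.1 ht.2 P'
  · exact errorCountEvent_le_p2 W hdec hS ht.1 ht.2 hP'.le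

theorem channelLaw_decode {Ka : ℕ} (hdec : IsMLDecoder Ka dec) (active : Finset (Fin K))
    {X : Codebook n K M → Codebook n K M} (hX : Measurable X) (A : Codebook n K M) (k : Fin K) :
    channelLaw n K L M
        {ω | dec A (received active (X A) ω.1 ω.2.1 ω.2.2) ω.2.1 k ≠ some (ω.1 k)} =
      ∑ W, ((cGaussianArray (Fin K) (Fin L) 1).prod (cGaussianArray (Fin n) (Fin L) 1))
        (Prod.mk A ⁻¹' decodeEvent active X W dec {e | e k ≠ some (W k)}) *
          uniformOn Set.univ {W} := by
  have hsec : ∀ W, MeasurableSet (Prod.mk A ⁻¹' decodeEvent active X W dec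
      {e | e k ≠ some (W k)}) := fun W =>
    measurable_prodMk_left (hdec.measurableSet_decodeEvent active hX W _)
  have hE : MeasurableSet {ω : (Fin K → Fin M) × (Fin K → Fin L → ℂ) × (Fin n → Fin L → ℂ) |
      dec A (received active (X A) ω.1 ω.2.1 ω.2.2) ω.2.1 k ≠ some (ω.1 k)} := by
    have : {ω : (Fin K → Fin M) × (Fin K → Fin L → ℂ) × (Fin n → Fin L → ℂ) |
        dec A (received active (X A) ω.1 ω.2.1 ω.2.2) ω.2.1 k ≠ some (ω.1 k)} =
        ⋃ W : Fin K → Fin M, {W} ×ˢ (Prod.mk A ⁻¹' decodeEvent active X W dec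
          {e | e k ≠ some (W k)}) := by
      ext ⟨W, q⟩
      simp only [Set.mem_iUnion, Set.mem_prod, Set.mem_singleton_iff]
      constructor
      · exact fun h => ⟨W, rfl, h⟩
      · rintro ⟨_, rfl, h⟩
        exact h
    rw [this]
    exact MeasurableSet.iUnion fun W => (measurableSet_singleton W).prod (hsec W)
  rw [channelLaw, Measure.prod_apply hE, lintegral_fintype]
  rfl

theorem pupe_eq {Ka : ℕ} (hdec : IsMLDecoder Ka dec) (active : Finset (Fin K))
    {X : Codebook n K M → Codebook n K M} (hX : Measurable X) (A : Codebook n K M) :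
    pupe active (X A) (dec A) = ∑ W, (∑ k ∈ active,
      ((cGaussianArray (Fin K) (Fin L) 1).prod (cGaussianArray (Fin n) (Fin L) 1))
        (Prod.mk A ⁻¹' decodeEvent active X W dec {e | e k ≠ some (W k)})) *
          ((active.card : ℝ≥0∞)⁻¹ * uniformOn Set.univ {W}) := by
  unfold pupe
  simp_rw [channelLaw_decode hdec active hX A]
  rw [Finset.sum_comm, div_eq_mul_inv, Finset.sum_mul]
  refine Finset.sum_congr rfl fun W _ => ?_
  rw [← Finset.sum_mul, mul_assoc, mul_comm (uniformOn Set.univ {W})]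

theorem measurable_section_decodeEvent {Ka : ℕ} (hdec : IsMLDecoder Ka dec)
    (active : Finset (Fin K)) {X : Codebook n K M → Codebook n K M} (hX : Measurable X)
    (W : Fin K → Fin M) (R : Set (Estimate K M)) : Measurable fun A =>
      ((cGaussianArray (Fin K) (Fin L) 1).prod (cGaussianArray (Fin n) (Fin L) 1))
        (Prod.mk A ⁻¹' decodeEvent active X W dec R) :=
  measurable_measure_prodMk_left (hdec.measurableSet_decodeEvent active hX W R)

theorem measurable_pupe {Ka : ℕ} (hdec : IsMLDecoder Ka dec) (active : Finset (Fin K))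
    {X : Codebook n K M → Codebook n K M} (hX : Measurable X) :
    Measurable fun A => pupe active (X A) (dec A) := by
  simp_rw [pupe_eq hdec active hX]
  exact Finset.measurable_sum _ fun W _ => (Finset.measurable_sum _ fun k _ =>
    measurable_section_decodeEvent hdec active hX W _).mul_const _

/-- The average over the codebook is exchanged with the finite sum over the messages; for each `W`
the bound is the same, and the weights sum to one. -/
theorem randomCodingPUPE_le {active : Finset (Fin K)} (hdec : IsMLDecoder active.card dec)
    (hn : 0 < n) (hL : 0 < L) (hKa : 0 < active.card) {S₁ : ℕ → Finset (Fin K)}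
    {S₂ : ℕ → ℕ → Finset (Fin K)} (hS : AdmissibleSets active S₁ S₂) {w w' : Fin K → Fin M}
    (hw : ∀ k, w' k ≠ w k) {P P' : ℝ} (hP' : 0 < P') :
    randomCodingPUPE active P P' dec ≤ pupeBound n L active.card P P' S₁ S₂ w w' := by
  have hX := measurable_truncateCodebook (n := n) (K := K) (M := M) P
  have : Nonempty (Fin K → Fin M) := ⟨w⟩
  have : IsProbabilityMeasure (uniformOn (Set.univ : Set (Fin K → Fin M))) :=
    isProbabilityMeasure_uniformOn Set.finite_univ Set.univ_nonempty
  unfold randomCodingPUPE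
  simp_rw [pupe_eq hdec active hX]
  rw [lintegral_finsetSum _ fun W _ => (Finset.measurable_sum _ fun k _ =>
    measurable_section_decodeEvent hdec active hX W _).mul_const _]
  calc _ = ∑ W, (∑ k ∈ active, jointLaw n K L M P'
        (decodeEvent active (truncateCodebook P) W dec {e | e k ≠ some (W k)})) / active.card *
          uniformOn Set.univ {W} := by
        refine Finset.sum_congr rfl fun W _ => ?_
        rw [lintegral_mul_const _ (Finset.measurable_sum _ fun k _ =>
          measurable_section_decodeEvent hdec active hX W _), lintegral_finsetSum _ fun k _ =>
          measurable_section_decodeEvent hdec active hX W _, div_eq_mul_inv, mul_assoc]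
        congr 1
        exact Finset.sum_congr rfl fun k _ =>
          (jointLaw_apply (hdec.measurableSet_decodeEvent active hX W _)).symm
    _ ≤ ∑ W, pupeBound n L active.card P P' S₁ S₂ w w' *
          uniformOn (Set.univ : Set (Fin K → Fin M)) {W} :=
        Finset.sum_le_sum fun W _ => mul_le_mul'
          (sum_measure_truncated_le hdec hn hL hKa hS hw W hP') le_rfl
    _ = _ := by
        rw [← lintegral_fintype fun _ => pupeBound n L active.card P P' S₁ S₂ w w',
          lintegral_const, measure_univ, mul_one]

end PUPE

end MassiveAccess

end

open MassiveAccess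
theorem mainTheorem3 (n K L J Ka : ℕ) (hn : 1 ≤ n) (hL : 1 ≤ L) (hJ : 1 ≤ J) (hKa : 1 ≤ Ka)
    (P : ℝ) (hP : 0 < P)
    -- the set of active users
    (active : Finset (Fin K)) (hactive : active.card = Ka)
    -- the representative sets and messages in the expectations of the bound
    (S₁ : ℕ → Finset (Fin K)) (S₂ : ℕ → ℕ → Finset (Fin K)) (hS : AdmissibleSets active S₁ S₂)
    (w w' : Fin K → Fin (2 ^ J)) (hw : ∀ k, w' k ≠ w k) :
    -- a maximum-likelihood decoder exists
    (∃ dec : Codebook n K (2 ^ J) → (Fin n → Fin L → ℂ) → (Fin K → Fin L → ℂ) →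
      Estimate K (2 ^ J), IsMLDecoder Ka dec) ∧
    -- and for every such decoder
    ∀ dec : Codebook n K (2 ^ J) → (Fin n → Fin L → ℂ) → (Fin K → Fin L → ℂ) →
      Estimate K (2 ^ J), IsMLDecoder Ka dec →
      -- random coding satisfies the bound for every `P' < P`,
      (∀ P' : ℝ, 0 < P' → P' < P →
        randomCodingPUPE active P P' dec ≤ pupeBound n L Ka P P' S₁ S₂ w w') ∧
      -- so does a fixed code that satisfies the power constraint,
      (∀ P' : ℝ, 0 < P' → P' < P → ∃ A : Codebook n K (2 ^ J),
        PowerConstraint P (truncateCodebook P A) ∧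
        pupe active (truncateCodebook P A) (dec A) ≤ pupeBound n L Ka P P' S₁ S₂ w w') ∧
      -- and the best code achieves the minimum over `P'`
      (⨅ A : Codebook n K (2 ^ J), pupe active (truncateCodebook P A) (dec A)) ≤
        ⨅ (P' : ℝ) (_ : 0 < P' ∧ P' < P), pupeBound n L Ka P P' S₁ S₂ w w' := by

  subst hactive
  refine ⟨exists_isMLDecoder (pow_pos two_pos J), fun dec hdec => ?_⟩
  have h1 : ∀ P' : ℝ, 0 < P' →
      randomCodingPUPE active P P' dec ≤ pupeBound n L active.card P P' S₁ S₂ w w' :=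
    fun P' hP' => randomCodingPUPE_le hdec hn hL hKa hS hw hP'
  have h2 : ∀ P' : ℝ, 0 < P' → ∃ A : Codebook n K (2 ^ J),
      pupe active (truncateCodebook P A) (dec A) ≤ pupeBound n L active.card P P' S₁ S₂ w w' := by
    intro P' hP'
    -- Under the probability law of the codebook, some realization is at most the mean.
    obtain ⟨A, hA⟩ := exists_le_lintegral (μ := codebookLaw n K (2 ^ J) P')
      (measurable_pupe hdec active (measurable_truncateCodebook P)).aemeasurable
    exact ⟨A, hA.trans (h1 P' hP')⟩
  refine ⟨fun P' hP' _ => h1 P' hP', fun P' hP' _ => ?_, ?_⟩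
  · obtain ⟨A, hA⟩ := h2 P' hP'
    exact ⟨A, powerConstraint_truncateCodebook hP.le A, hA⟩
  · refine le_iInf fun P' => le_iInf fun hP' => ?_
    obtain ⟨A, hA⟩ := h2 P' hP'.1
    exact (iInf_le _ A).trans hA
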